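/- **Setting.** Let $p\in(1,\infty)$, $p'=p/(p-1)$, $p\wedge p'=\min(p,p')$, $\kappa\ge 0$, and $S(A)=(\kappa+|A|^2)^{(p-2)/2}A$ for $A\in\mathbb R^{n\times n}$ ($|\cdot|$ the Frobenius norm). Let $\mathcal O\subset\mathbb R^n$ be bounded and open, $\|\cdot\|_{L^r}=\|\cdot\|_{L^r(\mathcal O)}$, and let $(\cdot,\cdot)$ denote the integral over $\mathcal O$ of the pointwise inner product. For $k\in\mathbb N$ let $\mathbb W^{k,\infty}_{\mathrm{div}}(\mathcal O)$ be the closure in $W^{k,\infty}(\mathcal O)$ of the divergence-free vector fields that are smooth in $\mathcal O$. Let $\sigma\in\mathbb W^{1,\infty}_{\mathrm{div}}(\mathcal O)$ (noise coefficient), $g\in\mathbb W^{2,\infty}_{\mathrm{div}}(\mathcal O)$ (boundary condition) and $v^{\mathrm{in}}\in L^2(\mathcal O)^n$ be deterministic. Write $\varepsilon g$ for the symmetric part of $\nabla g$, and $(\nabla u)_{ji}=\partial_j u_i$, so that $(\sigma\cdot\nabla)g=\sigma^T\nabla g$. Let $W$ be a real Wiener process with respect to a filtration on a probability space, and let $\tau>0$,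 $t_k=k\tau$, $\Delta_{k+1}W=W(t_{k+1})-W(t_k)$. **Gradient discretisation.** $\mathcal D$ consists of finite-dimensional real vector spaces $X_{\mathcal D,0}$, $Y_{\mathcal D}$ and linear maps $\nabla_{\mathcal D},\varepsilon_{\mathcal D}:X_{\mathcal D,0}\to L^p(\mathcal O)^{n\times n}$, $\mathrm{div}_{\mathcal D}:X_{\mathcal D,0}\to L^p(\mathcal O)$, $\Pi_{\mathcal D}:X_{\mathcal D,0}\to L^2(\mathcal O)^n$, $\chi_{\mathcal D}:Y_{\mathcal D}\to L^{p\wedge p'}(\mathcal O)$ such that, with $Y_{\mathcal D,0}=\{q\in Y_{\mathcal D}:\int_{\mathcal O}\chi_{\mathcal D}q\,dx=0\}$ and $E_{\mathcal D,0}=\{v\in X_{\mathcal D,0}: (\chi_{\mathcal D}q,\mathrm{div}_{\mathcal D}v)=0\ \forall q\in Y_{\mathcal D,0}\}$: $\|\varepsilon_{\mathcal D}\cdot\|_{L^p}$ is a norm on $X_{\mathcal D,0}$, $\|\chi_{\mathcal D}\cdot\|_{L^{p\wedge p'}}$ is a norm on $Y_{\mathcal D,0}$, and $\Pi_{\mathcal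 D}$ is one-to-one on $E_{\mathcal D,0}$. The $L^2$-projection $\mathcal K_{\mathcal D}u\in E_{\mathcal D,0}$ of $u\in L^2(\mathcal O)^n$ is defined by $(u-\Pi_{\mathcal D}\mathcal K_{\mathcal D}u,\Pi_{\mathcal D}\xi)=0$ for all $\xi\in E_{\mathcal D,0}$. Put $$C_{\mathcal D}(r)=\sup_{0\ne v\in X_{\mathcal D,0}}\frac{\|\Pi_{\mathcal D}v\|_{L^r}+\|\mathrm{div}_{\mathcal D}v\|_{L^r}+\|\nabla_{\mathcal D}v\|_{L^r}}{\|\varepsilon_{\mathcal D}v\|_{L^r}},\qquad C^{\mathrm{Sob}}_{\mathcal D}(r)=\sup_{0\ne z\in W^{1,r}(\mathcal O)^n\cap L^2(\mathcal O)^n}\frac{\|\varepsilon_{\mathcal D}\mathcal K_{\mathcal D}z\|_{L^r}}{\|z\|_{W^{1,r}}},$$ $$\beta_{\mathcal D}(p)=\inf_{0\neq q\in Y_{\mathcal D,0}}\ \sup_{0\ne v\in X_{\mathcal D,0}}\frac{(\chi_{\mathcal D}q,\mathrm{div}_{\mathcal D}v)}{\|\chi_{\mathcal D}q\|_{L^{p\wedge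 p'}}(\|\varepsilon_{\mathcal D}v\|_{L^p}+\|\varepsilon_{\mathcal D}v\|_{L^{p'}})},$$ where $\|z\|_{W^{1,r}}=(\|z\|_{L^r}^r+\|\nabla z\|_{L^r}^r)^{1/r}$ and $C_{\mathcal D}(r)=\infty$ if some $\varepsilon_{\mathcal D}v\notin L^r(\mathcal O)^{n\times n}$. For $\Gamma\in[1,\infty)$, $\mathcal D$ is called $\Gamma$-stable if $C_{\mathcal D}(p)+C_{\mathcal D}(p')\le\Gamma$, $\beta_{\mathcal D}(p)\ge\Gamma^{-1}$ and $C^{\mathrm{Sob}}_{\mathcal D}(p)+C^{\mathrm{Sob}}_{\mathcal D}(p')\le\Gamma$. **Scheme.** Let $B^\sigma_{\mathcal D}(v,\xi)=\tfrac12(\sigma^T\nabla_{\mathcal D}v,\Pi_{\mathcal D}\xi)-\tfrac12(\Pi_{\mathcal D}v,\sigma^T\nabla_{\mathcal D}\xi)$. Let the random elements $(v^k_{\mathcal D},\pi^k_{\mathcal D})\in X_{\mathcal D,0}\times Y_{\mathcal D,0}$, $k\in\mathbb N_0$, satisfy almost surely, for all $\xi\in X_{\mathcal D,0}$, $q\in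 Y_{\mathcal D,0}$ and $k\in\mathbb N_0$, with $v^{k+1/2}_{\mathcal D}=\tfrac12(v^{k+1}_{\mathcal D}+v^k_{\mathcal D})$, $$(\Pi_{\mathcal D}v^0_{\mathcal D},\Pi_{\mathcal D}\xi)+(\chi_{\mathcal D}\pi^0_{\mathcal D},\mathrm{div}_{\mathcal D}\xi)=(v^{\mathrm{in}},\Pi_{\mathcal D}\xi),\qquad(\mathrm{div}_{\mathcal D}v^0_{\mathcal D},\chi_{\mathcal D}q)=0,$$ $$(\Pi_{\mathcal D}v^{k+1}_{\mathcal D}-\Pi_{\mathcal D}v^k_{\mathcal D},\Pi_{\mathcal D}\xi)+\tau\big(S(\varepsilon_{\mathcal D}v^{k+1/2}_{\mathcal D}+\varepsilon g),\varepsilon_{\mathcal D}\xi\big)-(\chi_{\mathcal D}\pi^{k+1}_{\mathcal D}-\chi_{\mathcal D}\pi^k_{\mathcal D},\mathrm{div}_{\mathcal D}\xi)=\big[B^\sigma_{\mathcal D}(v^{k+1/2}_{\mathcal D},\xi)+((\sigma\cdot\nabla)g,\Pi_{\mathcal D}\xi)\big]\Delta_{k+1}W,$$ $$(\mathrm{div}_{\mathcal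 D}v^{k+1/2}_{\mathcal D},\chi_{\mathcal D}q)=0.$$ **Theorem.** For every $q>0$ there is a constant $C>0$ such that, for every $\Gamma$-stable gradient discretisation $\mathcal D$, every $\tau>0$, every $v^{\mathrm{in}}$, every sequence generated by the scheme and every $N\in\mathbb N_0$, the random variable below is integrable and $$\mathbb E\Big[\max_{0\le k\le N}\|\Pi_{\mathcal D}v^k_{\mathcal D}\|_{L^2}^{2q}+\Big(\sum_{k=0}^{N-1}\tau\,\|\varepsilon_{\mathcal D}v^{k+1/2}_{\mathcal D}\|_{L^p}^p\Big)^{q}\Big]\le C\big(\|v^{\mathrm{in}}\|_{L^2}^{2q}+(\tau N)^q\big).$$ The constant $C$ depends only on $q$, $n$, $p$, $\kappa$, $\Gamma$, the volume $|\mathcal O|$, and on $\sigma$ and $g$, the latter two only through an upper bound $M$ for $\|\sigma\|_{W^{1,\infty}}$ and $\|g\|_{W^{2,\infty}}$. Here $\|u\|_{W^{k,\infty}}$ is the largest $L^\infty$-norm of a weak partial derivative of order at most $k$ of a component of $u$. -/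

import Mathlib

open MeasureTheory ProbabilityTheory
open scoped NNReal ENNReal

noncomputable section

/-- Vectors in `ℝⁿ` with the Euclidean norm. -/
abbrev Vec (n : ℕ) : Type := EuclideanSpace ℝ (Fin n)

/-- Real `n × n` matrices with the inner product `A : B = ∑ i j, A i j * B i j`
and the associated (Frobenius) norm. -/
abbrev Mat (n : ℕ) : Type := EuclideanSpace ℝ (Fin n × Fin n)

/-- Lebesgue measure on the domain `O`. -/
abbrev leb {n : ℕ} (O : Set (Vec n)) : Measure (Vec n) := volume.restrict O

/-- The symmetric part `(A + Aᵀ) / 2`. -/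
def symPart {n : ℕ} (A : Mat n) : Mat n :=
  WithLp.toLp 2 fun ij => (A (ij.1, ij.2) + A (ij.2, ij.1)) / 2

/-- The product `sᵀ A`, i.e. `(sᵀ A) i = ∑ j, s j * A j i`. With the convention
`(∇u) j i = ∂ⱼ uᵢ` one has `sᵀ ∇u = (s ⋅ ∇) u`. -/
def transMul {n : ℕ} (s : Vec n) (A : Mat n) : Vec n :=
  WithLp.toLp 2 fun i => ∑ j, s j * A (j, i)

/-- The viscous stress tensor `S(A) = (κ + |A|²)^((p-2)/2) A` of a power-law fluid. -/
def stress {n : ℕ} (κ p : ℝ) (A : Mat n) : Mat n :=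
  (κ + ‖A‖ ^ 2) ^ ((p - 2) / 2) • A

/-! ### Sobolev spaces through weak derivatives -/

/-- Iterated classical partial derivatives: `iterPartial [j₁, …, jₘ] φ = ∂_{j₁} ⋯ ∂_{jₘ} φ`. -/
def iterPartial {n : ℕ} : List (Fin n) → (Vec n → ℝ) → Vec n → ℝ
  | [], φ => φ
  | j :: l, φ => fun x => fderiv ℝ (iterPartial l φ) x (EuclideanSpace.single j 1)

/-- `h` is the weak derivative of `f` on `O` in the directions listed in `l`. -/
def IsWeakDeriv {n : ℕ} (O : Set (Vec n)) (l : List (Fin n)) (f h : Vec n → ℝ) : Prop :=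
  LocallyIntegrableOn f O ∧ LocallyIntegrableOn h O ∧
    ∀ φ : Vec n → ℝ, ContDiff ℝ (⊤ : ℕ∞) φ → HasCompactSupport φ → tsupport φ ⊆ O →
      ∫ x in O, f x * iterPartial l φ x = (-1) ^ l.length * ∫ x in O, h x * φ x

open Classical in
/-- The weak derivative (unique up to null sets), where it exists. -/
def weakDeriv {n : ℕ} (O : Set (Vec n)) (l : List (Fin n)) (f : Vec n → ℝ) : Vec n → ℝ :=
  if h : ∃ w, IsWeakDeriv O l f w then h.choose else 0

/-- The weak gradient of a vector field, `(∇u) j i = ∂ⱼ uᵢ`. -/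
def weakGrad {n : ℕ} (O : Set (Vec n)) (u : Vec n → Vec n) : Vec n → Mat n :=
  fun x => WithLp.toLp 2 fun ji => weakDeriv O [ji.1] (fun y => u y ji.2) x

/-- The vector field `u` belongs to `W^{k,r}(O)`. -/
def MemSobolev {n : ℕ} (O : Set (Vec n)) (k : ℕ) (r : ℝ≥0∞) (u : Vec n → Vec n) : Prop :=
  ∀ l : List (Fin n), l.length ≤ k → ∀ i : Fin n,
    ∃ h, IsWeakDeriv O l (fun x => u x i) h ∧ MemLp h r (leb O)

/-- The norm of `W^{k,∞}(O)`: the largest essential supremum of a weak partial derivative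
of order at most `k` of a component of `u`. -/
def sobolevNormTop {n : ℕ} (O : Set (Vec n)) (k : ℕ) (u : Vec n → Vec n) : ℝ≥0∞ :=
  ⨆ (l : List (Fin n)) (_ : l.length ≤ k) (i : Fin n),
    eLpNorm (weakDeriv O l fun x => u x i) ∞ (leb O)

/-- The norm of `W^{1,r}(O)` for finite `r`. -/
def sobolevNormOne {n : ℕ} (O : Set (Vec n)) (r : ℝ) (u : Vec n → Vec n) : ℝ≥0∞ :=
  (eLpNorm u (ENNReal.ofReal r) (leb O) ^ r
    + eLpNorm (weakGrad O u) (ENNReal.ofReal r) (leb O) ^ r) ^ (1 / r)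

/-- `u ∈ 𝕎^{k,∞}_div(O)`: the closure, in the norm of `W^{k,∞}(O)`, of the vector fields which are
smooth in `O` and have zero divergence there. -/
def MemSobolevDivTop {n : ℕ} (O : Set (Vec n)) (k : ℕ) (u : Vec n → Vec n) : Prop :=
  MemSobolev O k ∞ u ∧
    ∀ δ : ℝ, 0 < δ → ∃ φ : Vec n → Vec n, ContDiffOn ℝ (⊤ : ℕ∞) φ O ∧
      (∀ x ∈ O, ∑ i, iterPartial [i] (fun y => φ y i) x = 0) ∧
      ∀ l : List (Fin n), l.length ≤ k → ∀ i : Fin n,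
        eLpNorm (fun x => weakDeriv O l (fun y => u y i) x - iterPartial l (fun y => φ y i) x)
          ∞ (leb O) ≤ ENNReal.ofReal δ

/-! ### Gradient discretisations -/

/-- The exponent `p ∧ p'` with `p' = p / (p - 1)`. -/
def minExp (p : ℝ) : ℝ := min p p.conjExponent

/-- The reconstruction operators of a gradient discretisation with discrete velocity unknowns `X`
and discrete pressure unknowns `Y`. -/
structure GDData (n : ℕ) (O : Set (Vec n)) (p : ℝ) (X Y : Type*)
    [AddCommGroup X] [Module ℝ X] [AddCommGroup Y] [Module ℝ Y] where
  /-- the discrete gradient `∇_D` -/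
  grad : X →ₗ[ℝ] Lp (Mat n) (ENNReal.ofReal p) (leb O)
  /-- the discrete symmetric gradient `ε_D` -/
  eps : X →ₗ[ℝ] Lp (Mat n) (ENNReal.ofReal p) (leb O)
  /-- the reconstruction of the pressure `χ_D` -/
  chi : Y →ₗ[ℝ] Lp ℝ (ENNReal.ofReal (minExp p)) (leb O)
  /-- the discrete divergence `div_D` -/
  dvg : X →ₗ[ℝ] Lp ℝ (ENNReal.ofReal p) (leb O)
  /-- the reconstruction of the velocity `Π_D` -/
  recon : X →ₗ[ℝ] Lp (Vec n) 2 (leb O)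

namespace GDData

variable {n : ℕ} {O : Set (Vec n)} {p : ℝ} {X Y : Type*}
    [AddCommGroup X] [Module ℝ X] [AddCommGroup Y] [Module ℝ Y]

/-- `q ∈ Y_{D,0}`: discrete pressures with zero mean value. -/
def MeanFree (D : GDData n O p X Y) (q : Y) : Prop := ∫ x in O, D.chi q x = 0

/-- `v ∈ E_{D,0}`: discretely divergence-free velocities. -/
def DivFree (D : GDData n O p X Y) (v : X) : Prop :=
  ∀ q, D.MeanFree q → ∫ x in O, D.chi q x * D.dvg v x = 0

end GDData

/-- A gradient discretisation for the generalised Stokes equations: `‖ε_D ⬝‖_{L^p}` is a norm on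
`X_{D,0}`, `‖χ_D ⬝‖_{L^{p ∧ p'}}` is a norm on `Y_{D,0}` (they are seminorms by linearity), and
`Π_D` is one-to-one on `E_{D,0}`. -/
structure GradientDiscretisation (n : ℕ) (O : Set (Vec n)) (p : ℝ) (X Y : Type*)
    [AddCommGroup X] [Module ℝ X] [AddCommGroup Y] [Module ℝ Y]
    extends GDData n O p X Y where
  eps_norm : ∀ v : X, ‖eps v‖ = 0 → v = 0
  chi_norm : ∀ q : Y, toGDData.MeanFree q → ‖chi q‖ = 0 → q = 0
  recon_injOn : Set.InjOn recon {v | toGDData.DivFree v}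

namespace GradientDiscretisation

variable {n : ℕ} {O : Set (Vec n)} {p : ℝ} {X Y : Type*}
    [AddCommGroup X] [Module ℝ X] [AddCommGroup Y] [Module ℝ Y]

open Classical in
/-- The coercivity constant `C_D(r)`: the supremum of
`(‖Π_D v‖_{L^r} + ‖div_D v‖_{L^r} + ‖∇_D v‖_{L^r}) / ‖ε_D v‖_{L^r}`. It is finite only if
all the reconstructions lie in `L^r`: a quotient with infinite denominator counts as `∞`.
The quotient `0 / 0` counts as `0`. -/
def coercivity (D : GradientDiscretisation n O p X Y) (r : ℝ) : ℝ≥0∞ :=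
  ⨆ v : X,
    if eLpNorm (D.eps v) (ENNReal.ofReal r) (leb O) = ∞ then ∞
    else (eLpNorm (D.recon v) (ENNReal.ofReal r) (leb O)
        + eLpNorm (D.dvg v) (ENNReal.ofReal r) (leb O)
        + eLpNorm (D.grad v) (ENNReal.ofReal r) (leb O))
      / eLpNorm (D.eps v) (ENNReal.ofReal r) (leb O)

/-- The inf-sup constant `β_D(p)`; the infimum runs over the non-zero `q ∈ Y_{D,0}`. -/
def infSup (D : GradientDiscretisation n O p X Y) : ℝ≥0∞ :=
  ⨅ (q : Y) (_ : D.MeanFree q ∧ q ≠ 0), ⨆ v : X,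
    ENNReal.ofReal (∫ x in O, D.chi q x * D.dvg v x)
      / (eLpNorm (D.chi q) (ENNReal.ofReal (minExp p)) (leb O)
        * (eLpNorm (D.eps v) (ENNReal.ofReal p) (leb O)
          + eLpNorm (D.eps v) (ENNReal.ofReal p.conjExponent) (leb O)))

/-- `w` is the `L²`-projection of `u` onto the discretely divergence-free velocities. -/
def IsL2Projection (D : GradientDiscretisation n O p X Y) (u : Vec n → Vec n) (w : X) : Prop :=
  D.DivFree w ∧
    ∀ ξ : X, D.DivFree ξ → ∫ x in O, inner ℝ (u x - D.recon w x) (D.recon ξ x) = 0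

open Classical in
/-- The `L²`-projection `K_D u ∈ E_{D,0}` of `u ∈ L²(O)`. -/
def l2Projection (D : GradientDiscretisation n O p X Y) (u : Vec n → Vec n) : X :=
  if h : ∃ w, D.IsL2Projection u w then h.choose else 0

/-- The Sobolev-stability constant `C_D^Sob(r)` of the `L²`-projection: the supremum of
`‖ε_D K_D z‖_{L^r} / ‖z‖_{W^{1,r}}` over `z ∈ W^{1,r}(O) ∩ L²(O)`. -/
def sobolevStability (D : GradientDiscretisation n O p X Y) (r : ℝ) : ℝ≥0∞ :=
  ⨆ (z : Vec n → Vec n) (_ : MemLp z 2 (leb O) ∧ MemSobolev O 1 (ENNReal.ofReal r) z),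
    eLpNorm (D.eps (D.l2Projection z)) (ENNReal.ofReal r) (leb O) / sobolevNormOne O r z

/-- `Γ`-stability of a gradient discretisation. -/
structure IsStable (D : GradientDiscretisation n O p X Y) (Γ : ℝ) : Prop where
  coercivity_le : D.coercivity p + D.coercivity p.conjExponent ≤ ENNReal.ofReal Γ
  le_infSup : ENNReal.ofReal Γ⁻¹ ≤ D.infSup
  sobolev_le : D.sobolevStability p + D.sobolevStability p.conjExponent ≤ ENNReal.ofReal Γ

/-- The discrete noise coefficient
`B_D^σ(v, ξ) = ½ (σᵀ ∇_D v, Π_D ξ) - ½ (Π_D v, σᵀ ∇_D ξ)`. -/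
def noise (D : GradientDiscretisation n O p X Y) (σ : Vec n → Vec n) (v ξ : X) : ℝ :=
  1 / 2 * (∫ x in O, inner ℝ (transMul (σ x) (D.grad v x)) (D.recon ξ x))
    - 1 / 2 * ∫ x in O, inner ℝ (D.recon v x) (transMul (σ x) (D.grad ξ x))

/-- `(v, π) ∈ X_{D,0} × Y_{D,0}` is the discrete Helmholtz decomposition of `vin`. -/
structure IsHelmholtz (D : GradientDiscretisation n O p X Y) (vin : Lp (Vec n) 2 (leb O))
    (v : X) (π : Y) : Prop where
  meanFree : D.MeanFree π
  momentum : ∀ ξ : X,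
    inner ℝ (D.recon v) (D.recon ξ) + ∫ x in O, D.chi π x * D.dvg ξ x = inner ℝ vin (D.recon ξ)
  divergence : ∀ q : Y, D.MeanFree q → ∫ x in O, D.dvg v x * D.chi q x = 0

/-- One step of the Crank–Nicolson scheme with step size `τ` and noise increment `dW`,
from `(v, π)` to `(v₁, π₁) ∈ X_{D,0} × Y_{D,0}`. -/
structure IsStep (D : GradientDiscretisation n O p X Y) (κ : ℝ) (σ g : Vec n → Vec n) (τ dW : ℝ)
    (v : X) (π : Y) (v₁ : X) (π₁ : Y) : Prop where
  meanFree : D.MeanFree π₁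
  momentum : ∀ ξ : X,
    inner ℝ (D.recon v₁ - D.recon v) (D.recon ξ)
      + τ * (∫ x in O, inner ℝ
          (stress κ p (D.eps ((1 / 2 : ℝ) • (v₁ + v)) x + symPart (weakGrad O g x))) (D.eps ξ x))
      - (∫ x in O, (D.chi π₁ x - D.chi π x) * D.dvg ξ x)
    = (D.noise σ ((1 / 2 : ℝ) • (v₁ + v)) ξ
        + ∫ x in O, inner ℝ (transMul (σ x) (weakGrad O g x)) (D.recon ξ x)) * dW
  divergence : ∀ q : Y, D.MeanFree q →
    ∫ x in O, D.dvg ((1 / 2 : ℝ) • (v₁ + v)) x * D.chi q x = 0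

end GradientDiscretisation

/-! ### The stochastic scheme -/

/-- `W` is a real Wiener process with respect to the filtration `𝓕`: a Brownian motion that is
adapted to `𝓕` and whose increments after time `s` are independent of `𝓕 s`. -/
structure IsWienerProcess {Ω : Type*} [mΩ : MeasurableSpace Ω] (P : Measure Ω)
    (𝓕 : Filtration ℝ≥0 mΩ) (W : ℝ≥0 → Ω → ℝ) : Prop where
  isBrownian : IsBrownianReal W P
  adapted : Adapted 𝓕 W
  indep : ∀ s t : ℝ≥0, s ≤ t →
    Indep (MeasurableSpace.comap (fun ω => W t ω - W s ω) inferInstance) (𝓕 s) P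

/-- `(v, π)` is generated by the fully discrete Crank–Nicolson algorithm with time step `τ`,
started from the discrete Helmholtz decomposition of `vin`. -/
def IsCrankNicolson {n : ℕ} {O : Set (Vec n)} {p : ℝ} {X Y : Type*}
    [AddCommGroup X] [Module ℝ X] [AddCommGroup Y] [Module ℝ Y]
    (D : GradientDiscretisation n O p X Y) (κ : ℝ) (σ g : Vec n → Vec n)
    {Ω : Type*} [MeasurableSpace Ω] (P : Measure Ω) (W : ℝ≥0 → Ω → ℝ) (τ : ℝ≥0)
    (vin : Lp (Vec n) 2 (leb O)) (v : ℕ → Ω → X) (π : ℕ → Ω → Y) : Prop :=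
  ∀ᵐ ω ∂P, D.IsHelmholtz vin (v 0 ω) (π 0 ω) ∧
    ∀ k : ℕ, D.IsStep κ σ g τ (W ((k + 1) * τ) ω - W (k * τ) ω)
      (v k ω) (π k ω) (v (k + 1) ω) (π (k + 1) ω)

end

/-! Write F = (σ·∇)g, s for the noise increment and w for the midpoint velocity. Testing one step
with w removes the noise operator, which is skew, and leaves ‖Πv₁‖² − ‖Πv‖² + 2τ(S(εw + εg), εw) =
2(F, Πw)s. Coercivity of S turns the stress term into dissipation, up to an error of order τ. The
right side is not a martingale increment, since w involves v₁. It equals 2(F, Πv)s + (F, Π(v₁ −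
v))s, and since v₁ − v is discretely divergence-free, F may be replaced in the last term by Πz with
z = K_D F. Testing the step with z expresses (Π(v₁ − v), Πz) through τ(S, εz), B(w, z)s and ‖Πz‖²s.
Sobolev stability bounds εz in L^p and L^{p'} once F is known to lie in W^{1,p} and W^{1,p'}, which
is a product rule for weak derivatives. Young's inequality absorbs the powers of εw into the
dissipation and leaves τ times a polynomial in |s|/√τ. This is the argument for τ ≤ 1; for τ > 1 the
right side is absorbed directly (`exists_energy_scalar`, `exists_energy_le`).

Hence kinetic plus dissipated energy is dominated by a process U with increments √τ b Z + τR(1 +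
|Z|)^a, where Z is standard Gaussian and independent of the past and b² ≤ BU
(`exists_energyMajorant`). As b² is at most linear in U and the drift does not grow with U, the
moments E U_k^m are bounded by multiples of (u₀ + τk)^m, with no exponential factor
(`exists_integral_pow_le`). A pathwise Doob inequality passes to the running maximum for a high
integer power, and comparison of powers gives every q > 0 (`exists_integral_partialSups_rpow_le`).

The martingale argument needs coefficients measurable with respect to the past, whereas the
velocities are only given pathwise. Monotonicity of S makes one step single-valued and locally
Lipschitz in (Πv, s), so Πv agrees almost surely with an adapted process
(`DataBounds.exists_measurable_step`, `DataBounds.exists_adapted`). -/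

lemma add_rpow_le_two_rpow_mul {a b p : ℝ} (ha : 0 ≤ a) (hb : 0 ≤ b) (hp : 0 ≤ p) :
    (a + b) ^ p ≤ 2 ^ p * (a ^ p + b ^ p) := by
  have h1 : (a + b) ^ p ≤ (2 * max a b) ^ p := by
    apply Real.rpow_le_rpow (by positivity) _ hp
    linarith [le_max_left a b, le_max_right a b]
  rw [Real.mul_rpow (by norm_num) (le_max_of_le_left ha)] at h1
  refine h1.trans (mul_le_mul_of_nonneg_left ?_ (by positivity))
  rcases max_choice a b with h | h <;> rw [h]
  · linarith [Real.rpow_nonneg hb p]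
  · linarith [Real.rpow_nonneg ha p]

/-! ### The power-law stress: growth, coercivity and monotonicity. -/

section Stress

variable {n : ℕ} {κ p : ℝ}

lemma sq_rpow_half {t p : ℝ} (ht : 0 ≤ t) : (t ^ 2) ^ (p / 2) = t ^ p := by
  rw [← Real.rpow_natCast, ← Real.rpow_mul ht]
  congr 1
  push_cast
  ring

lemma stress_eq_sqrt_rpow_smul (hκ : 0 ≤ κ) (A : Mat n) :
    stress κ p A = √(κ + ‖A‖ ^ 2) ^ (p - 2) • A := by
  rw [stress, ← sq_rpow_half (Real.sqrt_nonneg _), Real.sq_sqrt (by positivity)]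

lemma norm_le_sqrt_add_sq (hκ : 0 ≤ κ) (A : Mat n) : ‖A‖ ≤ √(κ + ‖A‖ ^ 2) :=
  Real.le_sqrt_of_sq_le (by linarith)

lemma sqrt_add_sq_le (hκ : 0 ≤ κ) (A : Mat n) : √(κ + ‖A‖ ^ 2) ≤ √κ + ‖A‖ := by
  rw [Real.sqrt_le_left (by positivity)]
  nlinarith [Real.sq_sqrt hκ, Real.sqrt_nonneg κ, norm_nonneg A]

lemma norm_stress_le_sqrt_rpow (hκ : 0 ≤ κ) (A : Mat n) :
    ‖stress κ p A‖ ≤ √(κ + ‖A‖ ^ 2) ^ (p - 1) := by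
  rw [stress_eq_sqrt_rpow_smul hκ, norm_smul, Real.norm_of_nonneg (by positivity)]
  rcases (Real.sqrt_nonneg (κ + ‖A‖ ^ 2)).eq_or_lt with h | h
  · have : ‖A‖ = 0 := le_antisymm (h ▸ norm_le_sqrt_add_sq hκ A) (norm_nonneg _)
    rw [this]
    simp only [mul_zero]
    positivity
  · calc _ ≤ √(κ + ‖A‖ ^ 2) ^ (p - 2) * √(κ + ‖A‖ ^ 2) := by
          gcongr; exact norm_le_sqrt_add_sq hκ A
      _ = _ := by
          rw [← Real.rpow_add_one h.ne']
          congr 1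
          ring

lemma norm_stress_le (hκ : 0 ≤ κ) (hp : 1 < p) (A : Mat n) :
    ‖stress κ p A‖ ≤ (√κ + ‖A‖) ^ (p - 1) :=
  (norm_stress_le_sqrt_rpow hκ A).trans
    (Real.rpow_le_rpow (by positivity) (sqrt_add_sq_le hκ A) (by linarith))

/-- For t ≥ 2K the subtracted term is at most half of t ^ p; for t ≤ 2K it is at most (2K) ^ p / 2.
-/
lemma rpow_sub_mul_rpow_ge {t K : ℝ} (ht : 0 < t) (hK : 0 ≤ K) (hp : 1 < p) :
    t ^ p / 2 - (2 * K) ^ p ≤ t ^ p - K * t ^ (p - 1) := by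
  have htp : t ^ p = t ^ (p - 1) * t := by
    rw [← Real.rpow_add_one ht.ne']
    congr 1
    ring
  have h1 : 0 ≤ t ^ (p - 1) := by positivity
  rcases le_total (2 * K) t with h | h
  · have : 0 ≤ (2 * K) ^ p := by positivity
    nlinarith
  · have h2 : t ^ p ≤ (2 * K) ^ p := Real.rpow_le_rpow ht.le h (by linarith)
    have h3 : K * t ^ (p - 1) ≤ (2 * K) ^ p / 2 := by
      have h4 : t ^ (p - 1) ≤ (2 * K) ^ (p - 1) := Real.rpow_le_rpow ht.le h (by linarith)
      have h5 : (2 * K) ^ p = (2 * K) ^ (p - 1) * (2 * K) := by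
        rw [← Real.rpow_add_one (by linarith)]
        congr 1
        ring
      nlinarith
    have : 0 ≤ (2 * K) ^ p := by positivity
    linarith [Real.rpow_nonneg ht.le p]

/-- The natural variable is t = √(κ + ‖A + G‖²), not ‖A‖: in it the pairing is at least t ^ p − K t
^ (p − 1), for every p > 1. The bound ‖A‖ ≤ t + K then returns to ‖A‖ ^ p. -/
lemma stress_coercive (hκ : 0 ≤ κ) (hp : 1 < p) (A G : Mat n) {K : ℝ} (hK : √κ + ‖G‖ ≤ K) :
    (2 ^ p)⁻¹ / 2 * ‖A‖ ^ p - 2 * (2 * K) ^ p ≤ inner ℝ (stress κ p (A + G)) A := by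
  set B := A + G with hB
  set t := √(κ + ‖B‖ ^ 2) with ht
  have hK0 : 0 ≤ K := le_trans (by positivity) hK
  have hBt : ‖B‖ ≤ t := norm_le_sqrt_add_sq hκ B
  have ht0 : 0 ≤ t := Real.sqrt_nonneg _
  have hAB : A = B - G := by simp [hB]
  have hAt : ‖A‖ ≤ t + K := by
    rw [hAB]
    linarith [norm_sub_le B G, Real.sqrt_nonneg κ]
  have h2p : (0 : ℝ) < 2 ^ p := by positivity
  have hA : (2 ^ p)⁻¹ * ‖A‖ ^ p ≤ t ^ p + K ^ p := by
    rw [inv_mul_le_iff₀ h2p]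
    exact (Real.rpow_le_rpow (norm_nonneg _) hAt (by linarith)).trans
      (add_rpow_le_two_rpow_mul ht0 hK0 (by linarith))
  have hKK : K ^ p ≤ (2 * K) ^ p := Real.rpow_le_rpow hK0 (by linarith) (by linarith)
  have key : t ^ p / 2 - (2 * K) ^ p ≤ inner ℝ (stress κ p B) A := by
    -- If t = 0 then B = 0 and the stress vanishes, whatever the value of the possibly negative
    -- power of 0.
    rcases ht0.eq_or_lt with h | h
    · have hB0 : B = 0 := by
        rw [← norm_eq_zero]; exact le_antisymm (h ▸ hBt) (norm_nonneg _)
      rw [← h, Real.zero_rpow (by linarith), hB0]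
      simp only [stress, smul_zero, inner_zero_left]
      linarith [Real.rpow_nonneg (by linarith : 0 ≤ 2 * K) p]
    · refine (rpow_sub_mul_rpow_ge h hK0 hp).trans ?_
      rw [stress_eq_sqrt_rpow_smul hκ, ← ht, real_inner_smul_left]
      have e1 : t ^ (p - 1) = t ^ (p - 2) * t := by
        rw [← Real.rpow_add_one h.ne']; congr 1; ring
      have e2 : t ^ p = t ^ (p - 2) * t ^ 2 := by
        rw [← Real.rpow_natCast, ← Real.rpow_add h]; congr 1; push_cast; ring
      have hsq : t ^ 2 = κ + ‖B‖ ^ 2 := Real.sq_sqrt (by positivity)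
      -- Here B : A = t² − κ − B : G, and the two losses are at most √κ t and ‖G‖ t, together at
      -- most K t.
      have h3 : t ^ 2 - K * t ≤ inner ℝ B A := by
        have h4 : inner ℝ B A = ‖B‖ ^ 2 - inner ℝ B G := by
          rw [hAB, inner_sub_right, real_inner_self_eq_norm_sq]
        have h5 : inner ℝ B G ≤ t * ‖G‖ :=
          (real_inner_le_norm B G).trans (by gcongr)
        have h6 : √κ ≤ t := Real.sqrt_le_sqrt (by nlinarith [sq_nonneg ‖B‖])
        have h7 : κ ≤ √κ * t := by
          nlinarith [Real.mul_self_sqrt hκ, Real.sqrt_nonneg κ]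
        nlinarith
      rw [e1, e2]
      calc _ = t ^ (p - 2) * (t ^ 2 - K * t) := by ring
        _ ≤ _ := by gcongr
  linarith [Real.rpow_nonneg hK0 p]

/-- As p − 2 may be negative, s ^ (p − 2) a is split into s ^ (p − 1) and a / s. Both factors
increase with a, the second because a²(κ + b²) ≤ b²(κ + a²). -/
lemma monotoneOn_sqrt_rpow_mul (hκ : 0 ≤ κ) (hp : 1 < p) {a b : ℝ} (ha : 0 ≤ a) (hab : a ≤ b) :
    √(κ + a ^ 2) ^ (p - 2) * a ≤ √(κ + b ^ 2) ^ (p - 2) * b := by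
  set s := √(κ + a ^ 2) with hs
  set t := √(κ + b ^ 2) with ht
  have hb : 0 ≤ b := ha.trans hab
  have hst : s ≤ t := Real.sqrt_le_sqrt (by gcongr)
  have hs0 : 0 ≤ s := Real.sqrt_nonneg _
  rcases hs0.eq_or_lt with h | h
  · have : a ≤ s := Real.le_sqrt_of_sq_le (by linarith)
    have ha0 : a = 0 := by linarith
    rw [ha0, mul_zero]
    positivity
  · have hsq : s ^ 2 = κ + a ^ 2 := Real.sq_sqrt (by positivity)
    have htq : t ^ 2 = κ + b ^ 2 := Real.sq_sqrt (by positivity)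
    have ht0 : 0 < t := h.trans_le hst
    have h1 : a * t ≤ b * s := by
      apply le_of_sq_le_sq _ (by positivity)
      rw [mul_pow, mul_pow, hsq, htq]
      nlinarith [mul_le_mul hab hab ha hb]
    have e (r : ℝ) (hr : 0 < r) : r ^ (p - 2) = r ^ (p - 1) * r⁻¹ := by
      rw [← Real.rpow_neg_one, ← Real.rpow_add hr]; congr 1; ring
    rw [e s h, e t ht0, mul_assoc, mul_assoc]
    have h2 : s⁻¹ * a ≤ t⁻¹ * b := by
      rw [inv_mul_eq_div, inv_mul_eq_div, div_le_div_iff₀ h ht0]; exact h1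
    have h3 : s ^ (p - 1) ≤ t ^ (p - 1) := Real.rpow_le_rpow hs0 hst (by linarith)
    exact mul_le_mul h3 h2 (by positivity) (by positivity)

/-- Cauchy–Schwarz reduces the claim to the scalar monotonicity of the magnitude of the stress. It
serves the continuous dependence of a time step on its data, not the energy estimate. -/
lemma stress_monotone (hκ : 0 ≤ κ) (hp : 1 < p) (A B : Mat n) :
    0 ≤ inner ℝ (stress κ p A - stress κ p B) (A - B) := by
  rw [stress_eq_sqrt_rpow_smul hκ, stress_eq_sqrt_rpow_smul hκ]
  set α := √(κ + ‖A‖ ^ 2) ^ (p - 2) with hα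
  set β := √(κ + ‖B‖ ^ 2) ^ (p - 2) with hβ
  have hα0 : 0 ≤ α := by positivity
  have hβ0 : 0 ≤ β := by positivity
  have e : inner ℝ (α • A - β • B) (A - B)
      = α * ‖A‖ ^ 2 + β * ‖B‖ ^ 2 - (α + β) * inner ℝ A B := by
    simp only [inner_sub_left, inner_sub_right, real_inner_smul_left, real_inner_self_eq_norm_sq,
      real_inner_comm A B]
    ring
  have h1 : inner ℝ A B ≤ ‖A‖ * ‖B‖ := real_inner_le_norm A B
  have h2 : 0 ≤ (α * ‖A‖ - β * ‖B‖) * (‖A‖ - ‖B‖) := by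
    rcases le_total ‖A‖ ‖B‖ with h | h
    · exact mul_nonneg_of_nonpos_of_nonpos
        (by linarith [monotoneOn_sqrt_rpow_mul hκ hp (norm_nonneg A) h]) (by linarith)
    · exact mul_nonneg
        (by linarith [monotoneOn_sqrt_rpow_mul hκ hp (norm_nonneg B) h]) (by linarith)
  rw [e]
  nlinarith [mul_le_mul_of_nonneg_left h1 (add_nonneg hα0 hβ0)]

lemma measurable_stress : Measurable (stress κ p : Mat n → Mat n) := by
  unfold stress
  fun_prop

lemma norm_symPart_le (A : Mat n) : ‖symPart A‖ ≤ ‖A‖ := by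
  have hswap : ‖(WithLp.toLp 2 fun ij : Fin n × Fin n => A (ij.2, ij.1) : Mat n)‖ = ‖A‖ := by
    rw [EuclideanSpace.norm_eq, EuclideanSpace.norm_eq]
    congr 1
    exact (Equiv.prodComm (Fin n) (Fin n)).sum_comp (fun ij => ‖A ij‖ ^ 2)
  have e : symPart A = (1 / 2 : ℝ) •
      (A + WithLp.toLp 2 fun ij : Fin n × Fin n => A (ij.2, ij.1)) := by
    ext ij
    simp [symPart]
    ring
  rw [e, norm_smul]
  have := norm_add_le A (WithLp.toLp 2 fun ij : Fin n × Fin n => A (ij.2, ij.1))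
  rw [hswap] at this
  rw [Real.norm_of_nonneg (by norm_num)]
  linarith

lemma measurable_symPart : Measurable (symPart : Mat n → Mat n) := by
  unfold symPart
  fun_prop

lemma norm_transMul_le (s : Vec n) (A : Mat n) : ‖transMul s A‖ ≤ ‖s‖ * ‖A‖ := by
  rw [EuclideanSpace.norm_eq, EuclideanSpace.norm_eq s, EuclideanSpace.norm_eq A,
    ← Real.sqrt_mul (by positivity)]
  apply Real.sqrt_le_sqrt
  rw [Fintype.sum_prod_type_right, Finset.mul_sum]
  refine Finset.sum_le_sum fun i _ => ?_
  simp only [transMul, Real.norm_eq_abs, sq_abs]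
  exact Finset.sum_mul_sq_le_sq_mul_sq _ _ _

lemma measurable_transMul : Measurable (fun q : Vec n × Mat n => transMul q.1 q.2) := by
  unfold transMul
  fun_prop

lemma transMul_add (s : Vec n) (A B : Mat n) :
    transMul s (A + B) = transMul s A + transMul s B := by
  ext i
  simp [transMul, mul_add, Finset.sum_add_distrib]

lemma transMul_smul (s : Vec n) (c : ℝ) (A : Mat n) :
    transMul s (c • A) = c • transMul s A := by
  ext i
  simp [transMul, Finset.mul_sum, mul_left_comm]

end Stress

/-! ### Real-valued L^r norms and Hölder's inequality; integral bounds for the stress. -/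

section RealLpNorm

variable {α E F : Type*} [MeasurableSpace α] {μ : Measure α} [NormedAddCommGroup E]
  [NormedAddCommGroup F]

/-- The `L^r`-norm as a real number, for a real exponent `r`. -/
noncomputable def lrNorm (r : ℝ) (μ : Measure α) (f : α → E) : ℝ :=
  (eLpNorm f (ENNReal.ofReal r) μ).toReal

lemma lrNorm_nonneg (r : ℝ) (f : α → E) : 0 ≤ lrNorm r μ f := ENNReal.toReal_nonneg

lemma lrNorm_eq {r : ℝ} (hr : 0 < r) {f : α → E} (hf : MemLp f (ENNReal.ofReal r) μ) :
    lrNorm r μ f = (∫ x, ‖f x‖ ^ r ∂μ) ^ r⁻¹ := by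
  rw [lrNorm, hf.eLpNorm_eq_integral_rpow_norm (by simpa using hr) ENNReal.ofReal_ne_top,
    ENNReal.toReal_ofReal hr.le, ENNReal.toReal_ofReal (by positivity)]

lemma lrNorm_rpow {r : ℝ} (hr : 0 < r) {f : α → E} (hf : MemLp f (ENNReal.ofReal r) μ) :
    lrNorm r μ f ^ r = ∫ x, ‖f x‖ ^ r ∂μ := by
  rw [lrNorm_eq hr hf, Real.rpow_inv_rpow (by positivity) hr.ne']

lemma integrable_norm_rpow_of_memLp {r : ℝ} (hr : 0 < r) {f : α → E}
    (hf : MemLp f (ENNReal.ofReal r) μ) : Integrable (fun x => ‖f x‖ ^ r) μ := by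
  have := (integrable_norm_rpow_iff hf.1 (by simpa using hr) ENNReal.ofReal_ne_top).2 hf
  rwa [ENNReal.toReal_ofReal hr.le] at this

lemma lrNorm_le_of_ae_le_mul {r c : ℝ} {f : α → E} {g : α → F} (hc : 0 ≤ c)
    (hg : MemLp g (ENNReal.ofReal r) μ) (h : ∀ᵐ x ∂μ, ‖f x‖ ≤ c * ‖g x‖) :
    lrNorm r μ f ≤ c * lrNorm r μ g := by
  have := ENNReal.toReal_mono (ENNReal.mul_ne_top ENNReal.ofReal_ne_top hg.2.ne)
    (eLpNorm_le_mul_eLpNorm_of_ae_le_mul h (ENNReal.ofReal r))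
  rwa [ENNReal.toReal_mul, ENNReal.toReal_ofReal hc] at this

lemma lrNorm_add_le {r : ℝ} (hr : 1 ≤ r) {f g : α → E} (hf : MemLp f (ENNReal.ofReal r) μ)
    (hg : MemLp g (ENNReal.ofReal r) μ) :
    lrNorm r μ (fun x => f x + g x) ≤ lrNorm r μ f + lrNorm r μ g := by
  have := ENNReal.toReal_mono (ENNReal.add_ne_top.2 ⟨hf.2.ne, hg.2.ne⟩)
    (eLpNorm_add_le hf.1 hg.1 (by simpa using hr))
  rwa [ENNReal.toReal_add hf.2.ne hg.2.ne] at this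

lemma lrNorm_le_of_bound {r C : ℝ} {V : ℝ≥0} (hV : μ Set.univ = V) (hr : 0 < r) (hC : 0 ≤ C)
    {f : α → E} (h : ∀ᵐ x ∂μ, ‖f x‖ ≤ C) : lrNorm r μ f ≤ (V : ℝ) ^ r⁻¹ * C := by
  have h1 := eLpNorm_le_of_ae_bound (p := ENNReal.ofReal r) h
  rw [hV] at h1
  have h2 := ENNReal.toReal_mono (ENNReal.mul_ne_top
    (ENNReal.rpow_ne_top_of_nonneg (by positivity) ENNReal.coe_ne_top) ENNReal.ofReal_ne_top) h1
  rwa [ENNReal.toReal_mul, ENNReal.toReal_ofReal hC, ← ENNReal.toReal_rpow,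
    ENNReal.coe_toReal, ENNReal.toReal_ofReal hr.le] at h2

lemma integrable_norm_mul_norm {p q : ℝ} (hpq : p.HolderConjugate q) {f : α → E} {g : α → F}
    (hf : MemLp f (ENNReal.ofReal p) μ) (hg : MemLp g (ENNReal.ofReal q) μ) :
    Integrable (fun x => ‖f x‖ * ‖g x‖) μ := by
  have := hpq.ennrealOfReal
  exact hf.norm.integrable_mul hg.norm

lemma integral_norm_mul_norm_le {p q : ℝ} (hpq : p.HolderConjugate q) {f : α → E} {g : α → F}
    (hf : MemLp f (ENNReal.ofReal p) μ) (hg : MemLp g (ENNReal.ofReal q) μ) :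
    ∫ x, ‖f x‖ * ‖g x‖ ∂μ ≤ lrNorm p μ f * lrNorm q μ g := by
  have := integral_mul_norm_le_Lp_mul_Lq hpq hf.norm hg.norm
  simp only [norm_norm] at this
  rwa [lrNorm_eq hpq.pos hf, lrNorm_eq hpq.symm.pos hg, ← one_div, ← one_div]

variable [InnerProductSpace ℝ E]

lemma integrable_inner_of_memLp {p q : ℝ} (hpq : p.HolderConjugate q) {f g : α → E}
    (hf : MemLp f (ENNReal.ofReal p) μ) (hg : MemLp g (ENNReal.ofReal q) μ) :
    Integrable (fun x => (inner ℝ (f x) (g x) : ℝ)) μ := by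
  refine (integrable_norm_mul_norm hpq hf hg).mono' (hf.1.inner hg.1) ?_
  exact .of_forall fun x => norm_inner_le_norm _ _

lemma abs_integral_inner_le {p q : ℝ} (hpq : p.HolderConjugate q) {f g : α → E}
    (hf : MemLp f (ENNReal.ofReal p) μ) (hg : MemLp g (ENNReal.ofReal q) μ) :
    |∫ x, (inner ℝ (f x) (g x) : ℝ) ∂μ| ≤ lrNorm p μ f * lrNorm q μ g := by
  refine le_trans ?_ (integral_norm_mul_norm_le hpq hf hg)
  rw [← Real.norm_eq_abs]
  refine (norm_integral_le_integral_norm _).trans ?_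
  refine integral_mono (integrable_inner_of_memLp hpq hf hg).norm
    (integrable_norm_mul_norm hpq hf hg) fun x => norm_inner_le_norm _ _

end RealLpNorm

section TransMul

variable {α : Type*} [MeasurableSpace α] {μ : Measure α} {n : ℕ}

lemma aestronglyMeasurable_transMul {σ : α → Vec n} {A : α → Mat n}
    (hσ : AEStronglyMeasurable σ μ) (hA : AEStronglyMeasurable A μ) :
    AEStronglyMeasurable (fun x => transMul (σ x) (A x)) μ :=
  (measurable_transMul.comp_aemeasurable
    (hσ.aemeasurable.prodMk hA.aemeasurable)).aestronglyMeasurable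

lemma memLp_transMul {σ : α → Vec n} {A : α → Mat n} {S : ℝ} {r : ℝ≥0∞}
    (hσ : AEStronglyMeasurable σ μ) (hS : ∀ᵐ x ∂μ, ‖σ x‖ ≤ S) (hA : MemLp A r μ) :
    MemLp (fun x => transMul (σ x) (A x)) r μ := by
  refine hA.of_le_mul (c := S) (aestronglyMeasurable_transMul hσ hA.1) ?_
  filter_upwards [hS] with x hx
  exact (norm_transMul_le _ _).trans (by gcongr)

lemma lrNorm_transMul_le {σ : α → Vec n} {A : α → Mat n} {S r : ℝ} (hS0 : 0 ≤ S)
    (hS : ∀ᵐ x ∂μ, ‖σ x‖ ≤ S) (hA : MemLp A (ENNReal.ofReal r) μ) :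
    lrNorm r μ (fun x => transMul (σ x) (A x)) ≤ S * lrNorm r μ A := by
  refine lrNorm_le_of_ae_le_mul hS0 hA ?_
  filter_upwards [hS] with x hx
  exact (norm_transMul_le _ _).trans (by gcongr)

end TransMul

section StressIntegral

variable {α : Type*} [MeasurableSpace α] {μ : Measure α} {n : ℕ} {κ p : ℝ} {A G : α → Mat n}

/-- The identity (p − 1)p' = p: the stress of a field in L^p lies in L^{p'}. -/
lemma norm_stress_rpow_conj_le (hκ : 0 ≤ κ) (hp : 1 < p) (B : Mat n) :
    ‖stress κ p B‖ ^ p.conjExponent ≤ (√κ + ‖B‖) ^ p := by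
  have hc := Real.HolderConjugate.conjExponent hp
  refine (Real.rpow_le_rpow (norm_nonneg _) (norm_stress_le hκ hp B) hc.symm.nonneg).trans ?_
  rw [← Real.rpow_mul (by positivity), hc.sub_one_mul_conj]

lemma aestronglyMeasurable_stress (hA : AEStronglyMeasurable A μ) :
    AEStronglyMeasurable (fun x => stress κ p (A x)) μ :=
  (measurable_stress.comp_aemeasurable hA.aemeasurable).aestronglyMeasurable

lemma memLp_stress [IsFiniteMeasure μ] (hκ : 0 ≤ κ) (hp : 1 < p)
    (hA : MemLp A (ENNReal.ofReal p) μ) :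
    MemLp (fun x => stress κ p (A x)) (ENNReal.ofReal p.conjExponent) μ := by
  have hc := Real.HolderConjugate.conjExponent hp
  have hm := aestronglyMeasurable_stress (κ := κ) (p := p) hA.1
  rw [← integrable_norm_rpow_iff hm (by simpa using hc.symm.pos) ENNReal.ofReal_ne_top,
    ENNReal.toReal_ofReal hc.symm.nonneg]
  have hh : MemLp (fun x => √κ + ‖A x‖) (ENNReal.ofReal p) μ := (memLp_const √κ).add hA.norm
  refine (integrable_norm_rpow_of_memLp hc.pos hh).mono' ?_ ?_
  · exact (hm.norm.aemeasurable.pow_const _).aestronglyMeasurable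
  · refine .of_forall fun x => ?_
    rw [Real.norm_of_nonneg (by positivity), Real.norm_of_nonneg (by positivity)]
    exact norm_stress_rpow_conj_le hκ hp _

lemma lrNorm_stress_le [IsFiniteMeasure μ] (hκ : 0 ≤ κ) (hp : 1 < p)
    (hA : MemLp A (ENNReal.ofReal p) μ) :
    lrNorm p.conjExponent μ (fun x => stress κ p (A x))
      ≤ lrNorm p μ (fun x => √κ + ‖A x‖) ^ (p - 1) := by
  have hc := Real.HolderConjugate.conjExponent hp
  have hS := memLp_stress hκ hp hA
  have hh : MemLp (fun x => √κ + ‖A x‖) (ENNReal.ofReal p) μ := (memLp_const √κ).add hA.norm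
  have h1 : ∫ x, ‖stress κ p (A x)‖ ^ p.conjExponent ∂μ ≤ lrNorm p μ (fun x => √κ + ‖A x‖) ^ p := by
    rw [lrNorm_rpow hc.pos hh]
    refine integral_mono (integrable_norm_rpow_of_memLp hc.symm.pos hS)
      (integrable_norm_rpow_of_memLp hc.pos hh) fun x => ?_
    simp only
    rw [Real.norm_of_nonneg (by positivity : 0 ≤ √κ + ‖A x‖)]
    exact norm_stress_rpow_conj_le hκ hp _
  rw [lrNorm_eq hc.symm.pos hS]
  refine (Real.rpow_le_rpow (by positivity) h1 (by simpa using hc.symm.nonneg)).trans ?_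
  rw [← Real.rpow_mul (lrNorm_nonneg _ _)]
  apply le_of_eq
  congr 1
  rw [← div_eq_mul_inv, div_eq_iff hc.symm.ne_zero, hc.sub_one_mul_conj]

lemma lrNorm_stress_add_le [IsFiniteMeasure μ] {V : ℝ≥0} (hV : μ Set.univ = V) (hκ : 0 ≤ κ)
    (hp : 1 < p) (hA : MemLp A (ENNReal.ofReal p) μ) (hG : AEStronglyMeasurable G μ) {K : ℝ}
    (hK : ∀ᵐ x ∂μ, √κ + ‖G x‖ ≤ K) (hK0 : 0 ≤ K) :
    lrNorm p.conjExponent μ (fun x => stress κ p (A x + G x))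
      ≤ (lrNorm p μ A + V ^ p⁻¹ * K) ^ (p - 1) := by
  have hGp : MemLp G (ENNReal.ofReal p) μ := .of_bound hG K <| by
    filter_upwards [hK] with x hx
    linarith [Real.sqrt_nonneg κ]
  refine (lrNorm_stress_le hκ hp (hA.add hGp)).trans ?_
  refine Real.rpow_le_rpow (lrNorm_nonneg _ _) ?_ (by linarith)
  have hg' : MemLp (fun x => √κ + ‖G x‖) (ENNReal.ofReal p) μ := (memLp_const √κ).add hGp.norm
  calc lrNorm p μ (fun x => √κ + ‖(A + G) x‖)
      ≤ 1 * lrNorm p μ (fun x => ‖A x‖ + (√κ + ‖G x‖)) := by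
        refine lrNorm_le_of_ae_le_mul zero_le_one (hA.norm.add hg') (.of_forall fun x => ?_)
        rw [Real.norm_of_nonneg (by positivity), Real.norm_of_nonneg (by positivity)]
        simp only [Pi.add_apply]
        linarith [norm_add_le (A x) (G x)]
    _ ≤ lrNorm p μ (fun x => ‖A x‖) + lrNorm p μ (fun x => √κ + ‖G x‖) := by
        rw [one_mul]
        exact lrNorm_add_le hp.le hA.norm hg'
    _ ≤ _ := by
        gcongr
        · apply le_of_eq
          simp only [lrNorm, eLpNorm_norm]
        · refine lrNorm_le_of_bound hV (by linarith) hK0 ?_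
          filter_upwards [hK] with x hx
          rwa [Real.norm_of_nonneg (by positivity)]

lemma integral_stress_coercive [IsFiniteMeasure μ] {V : ℝ≥0} (hV : μ Set.univ = V) (hκ : 0 ≤ κ)
    (hp : 1 < p) (hA : MemLp A (ENNReal.ofReal p) μ) (hG : AEStronglyMeasurable G μ) {K : ℝ}
    (hK : ∀ᵐ x ∂μ, √κ + ‖G x‖ ≤ K) :
    (2 ^ p)⁻¹ / 2 * lrNorm p μ A ^ p - 2 * (2 * K) ^ p * V
      ≤ ∫ x, (inner ℝ (stress κ p (A x + G x)) (A x) : ℝ) ∂μ := by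
  have hc := Real.HolderConjugate.conjExponent hp
  have hGp : MemLp G (ENNReal.ofReal p) μ := .of_bound hG K <| by
    filter_upwards [hK] with x hx
    linarith [Real.sqrt_nonneg κ]
  have hi := integrable_norm_rpow_of_memLp hc.pos hA
  have h1 : ∫ x, ((2 ^ p)⁻¹ / 2 * ‖A x‖ ^ p - 2 * (2 * K) ^ p) ∂μ
      = (2 ^ p)⁻¹ / 2 * lrNorm p μ A ^ p - 2 * (2 * K) ^ p * V := by
    rw [integral_sub (hi.const_mul _) (integrable_const _), integral_const_mul,
      lrNorm_rpow hc.pos hA,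
      integral_const, measureReal_def, hV, ENNReal.coe_toReal, smul_eq_mul]
    ring
  rw [← h1]
  refine integral_mono_ae ((hi.const_mul _).sub (integrable_const _))
    (integrable_inner_of_memLp hc.symm (memLp_stress hκ hp (hA.add hGp)) hA) ?_
  filter_upwards [hK] with x hx
  exact stress_coercive hκ hp _ _ hx

end StressIntegral

/-! ### Weak derivatives: uniqueness and the product rule. -/

section WeakDerivatives

variable {n : ℕ} {O : Set (Vec n)} {f h h₁ h₂ : Vec n → ℝ} {l : List (Fin n)}

/-- Test functions on `O`. -/
structure IsTestOn (O : Set (Vec n)) (φ : Vec n → ℝ) : Prop where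
  contDiff : ContDiff ℝ (⊤ : ℕ∞) φ
  hasCompactSupport : HasCompactSupport φ
  tsupport_subset : tsupport φ ⊆ O

lemma IsTestOn.iterPartial {φ : Vec n → ℝ} (hφ : IsTestOn O φ) (l : List (Fin n)) :
    IsTestOn O (iterPartial l φ) := by
  induction l with
  | nil => exact hφ
  | cons j l ih =>
    refine ⟨?_, ih.2.fderiv_apply ℝ _, (tsupport_fderiv_apply_subset ℝ _).trans ih.3⟩
    exact (ih.1.fderiv_right (m := (⊤ : ℕ∞)) (by norm_num)).clm_apply contDiff_const

lemma IsTestOn.integrableOn_mul {φ : Vec n → ℝ} (hφ : IsTestOn O φ)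
    (hf : LocallyIntegrableOn f O) : IntegrableOn (fun x => f x * φ x) O := by
  have h1 : IntegrableOn (fun x => f x * φ x) (tsupport φ) :=
    (hf.integrableOn_compact_subset hφ.3 hφ.2.isCompact).mul_continuousOn
      hφ.1.continuous.continuousOn hφ.2.isCompact
  refine Integrable.integrableOn ((integrableOn_iff_integrable_of_support_subset ?_).1 h1)
  exact (Function.support_mul_subset_right _ _).trans (subset_tsupport _)

lemma weakDeriv_spec (h : ∃ w, IsWeakDeriv O l f w) : IsWeakDeriv O l f (weakDeriv O l f) := by
  rw [weakDeriv, dif_pos h]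
  exact h.choose_spec

/-- The fundamental lemma of the calculus of variations. It identifies the chosen representative
`weakDeriv` with explicitly computed derivatives. -/
lemma IsWeakDeriv.ae_eq (hO : IsOpen O) (H₁ : IsWeakDeriv O l f h₁) (H₂ : IsWeakDeriv O l f h₂) :
    h₁ =ᵐ[leb O] h₂ := by
  have := hO.ae_eq_zero_of_integral_contDiff_smul_eq_zero (H₁.2.1.sub H₂.2.1) ?_
  · rw [Filter.EventuallyEq, ae_restrict_iff' hO.measurableSet]
    filter_upwards [this] with x hx hxO
    simpa [sub_eq_zero] using hx hxO
  · intro φ h1 h2 h3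
    have hφ : IsTestOn O φ := ⟨h1, h2, h3⟩
    rw [← setIntegral_eq_integral_of_forall_compl_eq_zero (s := O)]
    · have e1 := H₁.2.2 φ h1 h2 h3
      rw [H₂.2.2 φ h1 h2 h3] at e1
      have e2 := mul_left_cancel₀ (pow_ne_zero _ (by norm_num)) e1
      have : ∀ x, φ x • (h₁ - h₂) x = h₁ x * φ x - h₂ x * φ x := fun x => by
        simp only [Pi.sub_apply, smul_eq_mul]
        ring
      simp_rw [this]
      rw [integral_sub (hφ.integrableOn_mul H₁.2.1) (hφ.integrableOn_mul H₂.2.1), ← e2, sub_self]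
    · intro x hx
      simp [image_eq_zero_of_notMem_tsupport (fun h => hx (h3 h))]

lemma isWeakDeriv_nil (hf : LocallyIntegrableOn f O) : IsWeakDeriv O [] f f :=
  ⟨hf, hf, fun φ _ _ _ => by simp [iterPartial]⟩

lemma isWeakDeriv_sum {ι : Type*} (s : Finset ι) {u w : ι → Vec n → ℝ}
    (h : ∀ i ∈ s, IsWeakDeriv O l (u i) (w i)) :
    IsWeakDeriv O l (fun x => ∑ i ∈ s, u i x) (fun x => ∑ i ∈ s, w i x) := by
  have hli {v : ι → Vec n → ℝ} (hv : ∀ i ∈ s, LocallyIntegrableOn (v i) O) :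
      LocallyIntegrableOn (fun x => ∑ i ∈ s, v i x) O := by
    intro x hx
    choose! t ht using fun i hi => hv i hi x hx
    refine ⟨⋂ i ∈ s, t i, ?_, ?_⟩
    · rw [Filter.biInter_finset_mem]
      exact fun i hi => (ht i hi).1
    · refine integrable_finsetSum _ fun i hi => (ht i hi).2.mono_set (Set.biInter_subset_of_mem hi)
  refine ⟨hli fun i hi => (h i hi).1, hli fun i hi => (h i hi).2.1, fun φ h1 h2 h3 => ?_⟩
  have hφ : IsTestOn O φ := ⟨h1, h2, h3⟩
  simp_rw [Finset.sum_mul]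
  rw [integral_finsetSum _ fun i hi => (hφ.iterPartial l).integrableOn_mul (h i hi).1,
    integral_finsetSum _ fun i hi => hφ.integrableOn_mul (h i hi).2.1, Finset.mul_sum]
  exact Finset.sum_congr rfl fun i hi => (h i hi).2.2 φ h1 h2 h3

/-- The definition of w is applied to the test function ∂ₖφ. This makes second derivatives of g weak
derivatives of its first ones. -/
lemma IsWeakDeriv.of_cons {j : Fin n} {k : Fin n} {w : Vec n → ℝ}
    (H : IsWeakDeriv O [j] f w) (H' : IsWeakDeriv O [j, k] f h) : IsWeakDeriv O [k] w h := by
  refine ⟨H.2.1, H'.2.1, fun φ h1 h2 h3 => ?_⟩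
  have hφ : IsTestOn O φ := ⟨h1, h2, h3⟩
  have hk := hφ.iterPartial [k]
  have e1 := H.2.2 _ hk.1 hk.2 hk.3
  have e2 := H'.2.2 φ h1 h2 h3
  simp only [iterPartial, List.length_cons, List.length_nil] at e1 e2 ⊢
  rw [e1] at e2
  norm_num at e2 ⊢
  linarith

/-- Nothing is known about φ outside O, but the product vanishes near every point off the support of
η. -/
lemma IsTestOn.mul_contDiffOn (hO : IsOpen O) {φ η : Vec n → ℝ} (hη : IsTestOn O η)
    (hφ : ContDiffOn ℝ (⊤ : ℕ∞) φ O) : IsTestOn O (fun x => φ x * η x) := by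
  refine ⟨?_, hη.2.mul_left, (tsupport_mul_subset_right).trans hη.3⟩
  rw [contDiff_iff_contDiffAt]
  intro x
  by_cases hx : x ∈ tsupport η
  · exact (hφ.contDiffAt (hO.mem_nhds (hη.3 hx))).mul hη.1.contDiffAt
  · rw [notMem_tsupport_iff_eventuallyEq] at hx
    refine (contDiffAt_const (c := (0 : ℝ))).congr_of_eventuallyEq ?_
    filter_upwards [hx] with y hy
    simp [hy]

lemma IsTestOn.memLp_top {φ : Vec n → ℝ} (hφ : IsTestOn O φ) : MemLp φ ∞ (leb O) := by
  obtain ⟨C, hC⟩ := hφ.2.exists_bound_of_continuous hφ.1.continuous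
  exact memLp_top_of_bound hφ.1.continuous.aestronglyMeasurable C (.of_forall hC)

lemma ae_norm_le_of_eLpNorm_top_le {α E : Type*} [MeasurableSpace α] {μ : Measure α}
    [NormedAddCommGroup E] {F : α → E} {C : ℝ} (hC : 0 ≤ C)
    (hF : eLpNorm F ∞ μ ≤ ENNReal.ofReal C) : ∀ᵐ x ∂μ, ‖F x‖ ≤ C := by
  filter_upwards [ae_le_eLpNormEssSup (f := F) (μ := μ)] with x hx
  rw [eLpNorm_exponent_top] at hF
  have := hx.trans hF
  rwa [← ofReal_norm, ENNReal.ofReal_le_ofReal_iff hC] at this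

/-- The product rule for `u w`, where `u` is approximated in `W^{1,∞}` by functions smooth
in `O`. -/
lemma IsWeakDeriv.mul_of_approx (hO : IsOpen O) [IsFiniteMeasure (leb O)] {k : Fin n}
    {u u' w w' : Vec n → ℝ} (hu : MemLp u ∞ (leb O)) (hu' : MemLp u' ∞ (leb O))
    (hw : MemLp w ∞ (leb O)) (hw' : MemLp w' ∞ (leb O)) (H : IsWeakDeriv O [k] w w')
    (happ : ∀ δ : ℝ, 0 < δ → ∃ φ : Vec n → ℝ, ContDiffOn ℝ (⊤ : ℕ∞) φ O ∧
      (∀ᵐ x ∂leb O, |u x - φ x| ≤ δ) ∧ ∀ᵐ x ∂leb O, |u' x - iterPartial [k] φ x| ≤ δ) :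
    IsWeakDeriv O [k] (fun x => u x * w x) (fun x => u' x * w x + u x * w' x) := by
  have hmul {a b : Vec n → ℝ} (ha : MemLp a ∞ (leb O)) (hb : MemLp b ∞ (leb O)) :
    MemLp (fun x => a x * b x) ∞ (leb O) := hb.mul ha
  have hloc {a : Vec n → ℝ} (ha : MemLp a ∞ (leb O)) : LocallyIntegrableOn a O :=
    IntegrableOn.locallyIntegrableOn (ha.integrable le_top)
  refine ⟨hloc (hmul hu hw), hloc ((hmul hu' hw).add (hmul hu hw')), fun η h1 h2 h3 => ?_⟩
  have hη : IsTestOn O η := ⟨h1, h2, h3⟩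
  set η' := iterPartial [k] η with hη'
  have hηt : MemLp η ∞ (leb O) := hη.memLp_top
  have hηt' : MemLp η' ∞ (leb O) := (hη.iterPartial [k]).memLp_top
  set D : Vec n → ℝ := fun x => |w x * η' x + w' x * η x| + |w x * η x| with hD
  have hDi : Integrable D (leb O) :=
    ((((hmul hw hηt').add (hmul hw' hηt)).integrable le_top).abs).add
      (((hmul hw hηt).integrable le_top).abs)
  -- The integral on the left is the defect in the product rule. It vanishes when u is replaced by a
  -- smooth φ, and the replacement costs at most δ ∫ D.
  have key : ∀ δ : ℝ, 0 < δ →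
      |∫ x in O, (u x * (w x * η' x + w' x * η x) + u' x * (w x * η x))|
        ≤ δ * ∫ x in O, D x := by
    intro δ hδ
    obtain ⟨φ, hφ, ha, hb⟩ := happ δ hδ
    have hφη := hη.mul_contDiffOn hO hφ
    set φ' := iterPartial [k] φ with hφ'
    have hφm : AEStronglyMeasurable φ (leb O) :=
      hφ.continuousOn.aestronglyMeasurable hO.measurableSet
    have hφm' : AEStronglyMeasurable φ' (leb O) := by
      refine ContinuousOn.aestronglyMeasurable ?_ hO.measurableSet
      exact ((hφ.fderiv_of_isOpen (m := (⊤ : ℕ∞)) hO (by norm_num)).clm_apply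
        contDiffOn_const).continuousOn
    have hd : MemLp (fun x => u x - φ x) ∞ (leb O) :=
      memLp_top_of_bound (hu.1.sub hφm) δ ha
    have hd' : MemLp (fun x => u' x - φ' x) ∞ (leb O) :=
      memLp_top_of_bound (hu'.1.sub hφm') δ hb
    have hφt : MemLp φ ∞ (leb O) := by
      convert hu.sub hd using 1
      ext x
      simp
    have hφt' : MemLp φ' ∞ (leb O) := by
      convert hu'.sub hd' using 1
      ext x
      simp
    -- For smooth φ, the product φη is itself a test function for the weak derivative of w, and the
    -- classical product rule applies to it.
    have e0 : ∫ x in O, (φ x * (w x * η' x + w' x * η x) + φ' x * (w x * η x)) = 0 := by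
      have e1 := H.2.2 _ hφη.1 hφη.2 hφη.3
      have e2 : ∀ x ∈ O, iterPartial [k] (fun x => φ x * η x) x = φ' x * η x + φ x * η' x := by
        intro x hx
        simp only [hφ', hη', iterPartial]
        have hdφ : DifferentiableAt ℝ φ x :=
          ((hφ.contDiffAt (hO.mem_nhds hx)).differentiableAt (by norm_num))
        have hdη : DifferentiableAt ℝ η x := (h1.differentiable (by norm_num)).differentiableAt
        rw [fderiv_fun_mul hdφ hdη]
        simp only [add_apply, FunLike.coe_smul, Pi.smul_apply, smul_eq_mul]
        ring
      rw [setIntegral_congr_fun (g := fun x => φ x * (w x * η' x) + φ' x * (w x * η x))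
        hO.measurableSet (fun x hx => by simp only; rw [e2 x hx]; ring)] at e1
      have e3 : ∫ x in O, w' x * (φ x * η x) = ∫ x in O, φ x * (w' x * η x) :=
        integral_congr_ae (.of_forall fun x => by ring)
      rw [e3] at e1
      have e4 : ∀ x, φ x * (w x * η' x + w' x * η x) + φ' x * (w x * η x)
          = (φ x * (w x * η' x) + φ' x * (w x * η x)) + φ x * (w' x * η x) := fun x => by ring
      simp_rw [e4]
      rw [integral_add, e1]
      · simp
      · exact ((hmul hφt (hmul hw hηt')).add (hmul hφt' (hmul hw hηt))).integrable le_top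
      · exact (hmul hφt (hmul hw' hηt)).integrable le_top
    have e5 : ∫ x in O, (u x * (w x * η' x + w' x * η x) + u' x * (w x * η x))
        = ∫ x in O, ((u x - φ x) * (w x * η' x + w' x * η x)
          + (u' x - φ' x) * (w x * η x)) := by
      rw [← sub_zero (∫ x in O, (u x * (w x * η' x + w' x * η x) + u' x * (w x * η x))), ← e0,
        ← integral_sub]
      · exact integral_congr_ae (.of_forall fun x => by simp only; ring)
      · exact ((hmul hu ((hmul hw hηt').add (hmul hw' hηt))).add
          (hmul hu' (hmul hw hηt))).integrable le_top
      · exact ((hmul hφt ((hmul hw hηt').add (hmul hw' hηt))).add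
          (hmul hφt' (hmul hw hηt))).integrable le_top
    rw [e5, ← integral_const_mul, ← Real.norm_eq_abs]
    refine norm_integral_le_of_norm_le (hDi.const_mul δ) ?_
    filter_upwards [ha, hb] with x hx hx'
    rw [Real.norm_eq_abs]
    refine (abs_add_le _ _).trans ?_
    rw [abs_mul, abs_mul, mul_add]
    gcongr
  have hz : ∫ x in O, (u x * (w x * η' x + w' x * η x) + u' x * (w x * η x)) = 0 := by
    have hD0 : 0 ≤ ∫ x in O, D x := integral_nonneg fun x => by positivity
    by_contra hne
    have hpos := abs_pos.2 hne
    set I := |∫ x in O, (u x * (w x * η' x + w' x * η x) + u' x * (w x * η x))|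
    -- This δ makes the bound at most I / 2; the summand 1 guards against ∫ D = 0.
    have h5 := key (I / (2 * ((∫ x in O, D x) + 1))) (by positivity)
    have h6 : I / (2 * ((∫ x in O, D x) + 1)) * (∫ x in O, D x) ≤ I / 2 := by
      rw [div_mul_eq_mul_div, div_le_div_iff₀ (by positivity) (by norm_num)]
      nlinarith
    linarith
  have e6 : ∀ x, u x * (w x * η' x + w' x * η x) + u' x * (w x * η x)
      = u x * w x * η' x + (u' x * w x + u x * w' x) * η x := fun x => by ring
  simp_rw [e6] at hz
  rw [integral_add] at hz
  · norm_num
    linarith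
  · exact (hmul (hmul hu hw) hηt').integrable le_top
  · exact (hmul ((hmul hu' hw).add (hmul hu hw')) hηt).integrable le_top

lemma euclidean_norm_le_of_forall {ι : Type*} [Fintype ι] {C : ℝ} (hC : 0 ≤ C)
    {x : EuclideanSpace ℝ ι}
    (h : ∀ i, |x i| ≤ C) : ‖x‖ ≤ Fintype.card ι * C := by
  rw [EuclideanSpace.norm_eq, Real.sqrt_le_left (by positivity)]
  calc ∑ i, ‖x i‖ ^ 2 ≤ ∑ i : ι, C ^ 2 :=
        Finset.sum_le_sum fun i _ => pow_le_pow_left₀ (norm_nonneg _) (h i) 2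
    _ = Fintype.card ι * C ^ 2 := by simp
    _ ≤ _ := by
      rw [mul_pow]
      gcongr
      exact_mod_cast Nat.le_self_pow (by norm_num) _

end WeakDerivatives

/-! ### The source (σ·∇)g: pointwise bounds and membership in W^{1,r}. -/

section SobolevTop

variable {n : ℕ} {O : Set (Vec n)} {M : ℝ} {u : Vec n → Vec n} {k : ℕ}

lemma MemSobolev.weakDeriv_spec {r : ℝ≥0∞} (hu : MemSobolev O k r u) {l : List (Fin n)}
    (hl : l.length ≤ k) (i : Fin n) :
    IsWeakDeriv O l (fun x => u x i) (weakDeriv O l fun x => u x i) :=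
  _root_.weakDeriv_spec ((hu l hl i).imp fun _ h => h.1)

lemma ae_abs_weakDeriv_le (hM : sobolevNormTop O k u ≤ ENNReal.ofReal M) {l : List (Fin n)}
    (hl : l.length ≤ k) (i : Fin n) :
    ∀ᵐ x ∂leb O, |weakDeriv O l (fun x => u x i) x| ≤ max M 0 := by
  refine ae_norm_le_of_eLpNorm_top_le (F := weakDeriv O l fun x => u x i) (le_max_right _ _) ?_
  rw [ENNReal.ofReal_max, ENNReal.ofReal_zero]
  refine le_max_of_le_left (le_trans ?_ hM)
  exact le_iSup_of_le l (le_iSup_of_le hl (le_iSup_of_le i le_rfl))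

lemma MemSobolev.memLp_top_weakDeriv {r : ℝ≥0∞} (hu : MemSobolev O k r u)
    (hM : sobolevNormTop O k u ≤ ENNReal.ofReal M) {l : List (Fin n)}
    (hl : l.length ≤ k) (i : Fin n) : MemLp (weakDeriv O l fun x => u x i) ∞ (leb O) :=
  memLp_top_of_bound (hu.weakDeriv_spec hl i).2.1.aestronglyMeasurable _
    (ae_abs_weakDeriv_le hM hl i)

lemma MemSobolev.weakDeriv_nil_ae_eq {r : ℝ≥0∞} (hO : IsOpen O) (hu : MemSobolev O k r u)
    (i : Fin n) : (weakDeriv O [] fun x => u x i) =ᵐ[leb O] fun x => u x i :=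
  have h := hu.weakDeriv_spec (l := []) (by simp) i
  h.ae_eq hO (isWeakDeriv_nil h.1)

lemma MemSobolev.ae_abs_le {r : ℝ≥0∞} (hO : IsOpen O) (hu : MemSobolev O k r u)
    (hM : sobolevNormTop O k u ≤ ENNReal.ofReal M) (i : Fin n) :
    ∀ᵐ x ∂leb O, |u x i| ≤ max M 0 := by
  filter_upwards [ae_abs_weakDeriv_le hM (l := []) (by simp) i, hu.weakDeriv_nil_ae_eq hO i]
    with x h1 h2
  rwa [← h2]

lemma aestronglyMeasurable_euclidean {ι : Type*} [Fintype ι] {α : Type*} [MeasurableSpace α]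
    {μ : Measure α} {v : α → EuclideanSpace ℝ ι}
    (h : ∀ i, AEStronglyMeasurable (fun x => v x i) μ) :
    AEStronglyMeasurable v μ := by
  have h1 : AEMeasurable (fun x => (v x).ofLp) μ :=
    aemeasurable_pi_lambda _ fun i => (h i).aemeasurable
  exact ((WithLp.measurable_toLp 2 _).comp_aemeasurable h1).aestronglyMeasurable

lemma MemSobolev.aestronglyMeasurable {r : ℝ≥0∞} (hu : MemSobolev O k r u) :
    AEStronglyMeasurable u (leb O) :=
  aestronglyMeasurable_euclidean fun i =>
    (hu.weakDeriv_spec (l := []) (by simp) i).1.aestronglyMeasurable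

lemma MemSobolev.ae_norm_le {r : ℝ≥0∞} (hO : IsOpen O) (hu : MemSobolev O k r u)
    (hM : sobolevNormTop O k u ≤ ENNReal.ofReal M) : ∀ᵐ x ∂leb O, ‖u x‖ ≤ n * max M 0 := by
  filter_upwards [ae_all_iff.2 fun i => hu.ae_abs_le hO hM i] with x hx
  simpa using euclidean_norm_le_of_forall (le_max_right _ _) hx

lemma MemSobolev.aestronglyMeasurable_weakGrad {r : ℝ≥0∞} (hu : MemSobolev O k r u) (hk : 1 ≤ k) :
    AEStronglyMeasurable (weakGrad O u) (leb O) :=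
  aestronglyMeasurable_euclidean fun ji =>
    (hu.weakDeriv_spec (l := [ji.1]) (by simpa using hk) ji.2).2.1.aestronglyMeasurable

lemma ae_norm_weakGrad_le (hM : sobolevNormTop O k u ≤ ENNReal.ofReal M) (hk : 1 ≤ k) :
    ∀ᵐ x ∂leb O, ‖weakGrad O u x‖ ≤ (n * n : ℕ) * max M 0 := by
  filter_upwards [ae_all_iff.2 fun ji : Fin n × Fin n =>
    ae_abs_weakDeriv_le hM (l := [ji.1]) (by simpa using hk) ji.2] with x hx
  simpa using euclidean_norm_le_of_forall (x := weakGrad O u x) (le_max_right _ _) hx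

variable {σ g : Vec n → Vec n}

/-- The weak partial derivatives of `(σ ⋅ ∇) g`. -/
lemma isWeakDeriv_transMul_weakGrad (hO : IsOpen O) [IsFiniteMeasure (leb O)]
    (hσ : MemSobolevDivTop O 1 σ) (hσM : sobolevNormTop O 1 σ ≤ ENNReal.ofReal M)
    (hg : MemSobolev O 2 ∞ g) (hgM : sobolevNormTop O 2 g ≤ ENNReal.ofReal M) (k i : Fin n) :
    IsWeakDeriv O [k] (fun x => transMul (σ x) (weakGrad O g x) i) (fun x => ∑ j,
      (weakDeriv O [k] (fun y => σ y j) x * weakDeriv O [j] (fun y => g y i) x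
        + σ x j * weakDeriv O [j, k] (fun y => g y i) x)) := by
  refine isWeakDeriv_sum (u := fun j x => σ x j * weakDeriv O [j] (fun y => g y i) x)
    Finset.univ fun j _ => ?_
  have hσj : MemLp (fun x => σ x j) ∞ (leb O) :=
    (hσ.1.memLp_top_weakDeriv hσM (l := []) (by simp) j).ae_eq (hσ.1.weakDeriv_nil_ae_eq hO j)
  refine IsWeakDeriv.mul_of_approx hO hσj (hσ.1.memLp_top_weakDeriv hσM (by simp) j)
    (hg.memLp_top_weakDeriv hgM (by simp) i) (hg.memLp_top_weakDeriv hgM (by simp) i)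
    ((hg.weakDeriv_spec (by simp) i).of_cons (hg.weakDeriv_spec (by simp) i)) ?_
  intro δ hδ
  obtain ⟨φ, h1, -, h3⟩ := hσ.2 δ hδ
  refine ⟨fun y => φ y j, ?_, ?_, ?_⟩
  · exact (contDiff_euclidean.1 contDiff_id j).comp_contDiffOn h1
  · filter_upwards [ae_norm_le_of_eLpNorm_top_le hδ.le (h3 [] (by simp) j),
      hσ.1.weakDeriv_nil_ae_eq hO j] with x hx hx'
    rwa [hx'] at hx
  · exact ae_norm_le_of_eLpNorm_top_le hδ.le (h3 [k] (by simp) j)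

lemma ae_norm_transMul_weakGrad_le (hO : IsOpen O)
    (hσ : MemSobolev O 1 ∞ σ) (hσM : sobolevNormTop O 1 σ ≤ ENNReal.ofReal M)
    (hgM : sobolevNormTop O 2 g ≤ ENNReal.ofReal M) :
    ∀ᵐ x ∂leb O, ‖transMul (σ x) (weakGrad O g x)‖
      ≤ (n * max M 0) * ((n * n : ℕ) * max M 0) := by
  filter_upwards [hσ.ae_norm_le hO hσM, ae_norm_weakGrad_le hgM one_le_two] with x h1 h2
  exact (norm_transMul_le _ _).trans (mul_le_mul h1 h2 (norm_nonneg _) (by positivity))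

lemma aestronglyMeasurable_transMul_weakGrad (hσ : MemSobolev O 1 ∞ σ) (hg : MemSobolev O 2 ∞ g) :
    AEStronglyMeasurable (fun x => transMul (σ x) (weakGrad O g x)) (leb O) :=
  aestronglyMeasurable_transMul hσ.aestronglyMeasurable
    (hg.aestronglyMeasurable_weakGrad one_le_two)

/-- Pointwise bound for the weak partial derivatives of `(σ ⋅ ∇) g`. -/
lemma ae_abs_deriv_transMul_weakGrad_le (hO : IsOpen O)
    (hσ : MemSobolev O 1 ∞ σ) (hσM : sobolevNormTop O 1 σ ≤ ENNReal.ofReal M)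
    (hgM : sobolevNormTop O 2 g ≤ ENNReal.ofReal M) (k i : Fin n) :
    ∀ᵐ x ∂leb O, |∑ j, (weakDeriv O [k] (fun y => σ y j) x * weakDeriv O [j] (fun y => g y i) x
        + σ x j * weakDeriv O [j, k] (fun y => g y i) x)|
      ≤ n * (2 * max M 0 ^ 2) := by
  filter_upwards [ae_all_iff.2 fun j => hσ.ae_abs_le hO hσM j,
    ae_all_iff.2 fun j => ae_abs_weakDeriv_le hσM (l := [k]) (by simp) j,
    ae_all_iff.2 fun j : Fin n => ae_abs_weakDeriv_le hgM (l := [j]) (by simp) i,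
    ae_all_iff.2 fun j : Fin n => ae_abs_weakDeriv_le hgM (l := [j, k]) (by simp) i]
    with x h1 h2 h3 h4
  calc _ ≤ ∑ j : Fin n, 2 * max M 0 ^ 2 := by
        refine (Finset.abs_sum_le_sum_abs _ _).trans (Finset.sum_le_sum fun j _ => ?_)
        refine (abs_add_le _ _).trans ?_
        rw [abs_mul, abs_mul]
        have h0 := le_max_right M 0
        nlinarith [mul_le_mul (h2 j) (h3 j) (abs_nonneg _) h0,
          mul_le_mul (h1 j) (h4 j) (abs_nonneg _) h0]
    _ = _ := by simp

lemma memSobolev_transMul_weakGrad (hO : IsOpen O) [IsFiniteMeasure (leb O)]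
    (hσ : MemSobolevDivTop O 1 σ) (hσM : sobolevNormTop O 1 σ ≤ ENNReal.ofReal M)
    (hg : MemSobolev O 2 ∞ g) (hgM : sobolevNormTop O 2 g ≤ ENNReal.ofReal M) (r : ℝ≥0∞) :
    MemSobolev O 1 r (fun x => transMul (σ x) (weakGrad O g x)) := by
  intro l hl i
  have hm := aestronglyMeasurable_transMul_weakGrad hσ.1 hg
  have hb := ae_norm_transMul_weakGrad_le hO hσ.1 hσM hgM
  have hf : MemLp (fun x => transMul (σ x) (weakGrad O g x)) ∞ (leb O) :=
    memLp_top_of_bound hm _ hb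
  match l, hl with
  | [], _ =>
    have hfi : MemLp (fun x => transMul (σ x) (weakGrad O g x) i) ∞ (leb O) :=
      hf.mono (Continuous.comp_aestronglyMeasurable (g := fun v : Vec n => v i) (by fun_prop) hm)
        (.of_forall fun x => PiLp.norm_apply_le _ i)
    exact ⟨_, isWeakDeriv_nil (IntegrableOn.locallyIntegrableOn (hfi.integrable le_top)),
      hfi.mono_exponent le_top⟩
  | [k], _ =>
    have H := isWeakDeriv_transMul_weakGrad hO hσ hσM hg hgM k i
    exact ⟨_, H, .of_bound H.2.1.aestronglyMeasurable _
      (ae_abs_deriv_transMul_weakGrad_le hO hσ.1 hσM hgM k i)⟩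

lemma ae_norm_weakGrad_transMul_weakGrad_le (hO : IsOpen O) [IsFiniteMeasure (leb O)]
    (hσ : MemSobolevDivTop O 1 σ) (hσM : sobolevNormTop O 1 σ ≤ ENNReal.ofReal M)
    (hg : MemSobolev O 2 ∞ g) (hgM : sobolevNormTop O 2 g ≤ ENNReal.ofReal M) :
    ∀ᵐ x ∂leb O, ‖weakGrad O (fun y => transMul (σ y) (weakGrad O g y)) x‖
      ≤ (n * n : ℕ) * (n * (2 * max M 0 ^ 2)) := by
  have h1 (ki : Fin n × Fin n) : ∀ᵐ x ∂leb O,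
      |weakGrad O (fun y => transMul (σ y) (weakGrad O g y)) x ki| ≤ n * (2 * max M 0 ^ 2) := by
    have H := isWeakDeriv_transMul_weakGrad hO hσ hσM hg hgM ki.1 ki.2
    filter_upwards [(weakDeriv_spec ⟨_, H⟩).ae_eq hO H,
      ae_abs_deriv_transMul_weakGrad_le hO hσ.1 hσM hgM ki.1 ki.2] with x hx hx'
    rw [← hx] at hx'
    exact hx'
  filter_upwards [ae_all_iff.2 h1] with x hx
  simpa using euclidean_norm_le_of_forall (by positivity) hx

/-- The `W^{1,r}`-norm of `(σ ⋅ ∇) g` is bounded in terms of `M` and `|O|`. -/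
lemma exists_sobolevNormOne_transMul_weakGrad_le (n : ℕ) (M r : ℝ) (V : ℝ≥0) (hr : 0 < r) :
    ∃ K : ℝ, 0 ≤ K ∧ ∀ O : Set (Vec n), IsOpen O → volume O = V → ∀ σ g : Vec n → Vec n,
      MemSobolevDivTop O 1 σ → sobolevNormTop O 1 σ ≤ ENNReal.ofReal M →
      MemSobolev O 2 ∞ g → sobolevNormTop O 2 g ≤ ENNReal.ofReal M →
      sobolevNormOne O r (fun x => transMul (σ x) (weakGrad O g x)) ≤ ENNReal.ofReal K := by
  set a := (V : ℝ) ^ r⁻¹ * ((n * max M 0) * ((n * n : ℕ) * max M 0)) with ha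
  set b := (V : ℝ) ^ r⁻¹ * ((n * n : ℕ) * (n * (2 * max M 0 ^ 2))) with hb
  have ha0 : 0 ≤ a := by positivity
  have hb0 : 0 ≤ b := by positivity
  refine ⟨(a ^ r + b ^ r) ^ (1 / r), by positivity, fun O hO hV σ g hσ hσM hg hgM => ?_⟩
  have hV' : leb O Set.univ = V := by simpa using hV
  have : IsFiniteMeasure (leb O) := ⟨by rw [hV']; exact ENNReal.coe_lt_top⟩
  have key {E : Type} [NormedAddCommGroup E] {F : Vec n → E} {C : ℝ} (hC : 0 ≤ C)
      (hF : ∀ᵐ x ∂leb O, ‖F x‖ ≤ C) :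
      eLpNorm F (ENNReal.ofReal r) (leb O) ≤ ENNReal.ofReal ((V : ℝ) ^ r⁻¹ * C) := by
    refine (eLpNorm_le_of_ae_bound hF).trans (le_of_eq ?_)
    rw [hV', ENNReal.toReal_ofReal hr.le, ENNReal.ofReal_mul (by positivity),
      ← ENNReal.ofReal_rpow_of_nonneg (by positivity) (by positivity), ENNReal.ofReal_coe_nnreal]
  rw [← ENNReal.ofReal_rpow_of_nonneg (by positivity) (by positivity),
    ENNReal.ofReal_add (by positivity) (by positivity),
    ← ENNReal.ofReal_rpow_of_nonneg ha0 hr.le, ← ENNReal.ofReal_rpow_of_nonneg hb0 hr.le,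
    sobolevNormOne]
  gcongr
  · exact key (by positivity) (ae_norm_transMul_weakGrad_le hO hσ.1 hσM hgM)
  · exact key (by positivity) (ae_norm_weakGrad_transMul_weakGrad_le hO hσ hσM hg hgM)

end SobolevTop

/-! ### Consequences of stability: norm bounds, the L²-projection, the noise form. -/

namespace GradientDiscretisation

variable {n : ℕ} {O : Set (Vec n)} {p Γ : ℝ} {X Y : Type*}
    [AddCommGroup X] [Module ℝ X] [AddCommGroup Y] [Module ℝ Y]
    {D : GradientDiscretisation n O p X Y}

lemma IsStable.coercivity_le_ofReal (h : D.IsStable Γ) {r : ℝ} (hr : r = p ∨ r = p.conjExponent) :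
    D.coercivity r ≤ ENNReal.ofReal Γ := by
  rcases hr with rfl | rfl
  · exact le_self_add.trans h.coercivity_le
  · exact le_add_self.trans h.coercivity_le

lemma IsStable.sobolevStability_le_ofReal (h : D.IsStable Γ) {r : ℝ}
    (hr : r = p ∨ r = p.conjExponent) : D.sobolevStability r ≤ ENNReal.ofReal Γ := by
  rcases hr with rfl | rfl
  · exact le_self_add.trans h.sobolev_le
  · exact le_add_self.trans h.sobolev_le

/-- Finiteness of εv in L^r comes from the branch of `coercivity` with value ∞. A zero denominator
is harmless: a nonzero numerator would make the quotient ∞. -/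
lemma IsStable.eLpNorm_le (h : D.IsStable Γ) {r : ℝ} (hr : r = p ∨ r = p.conjExponent) (v : X) :
    eLpNorm (D.eps v) (ENNReal.ofReal r) (leb O) ≠ ∞ ∧
      eLpNorm (D.recon v) (ENNReal.ofReal r) (leb O)
        + eLpNorm (D.dvg v) (ENNReal.ofReal r) (leb O)
        + eLpNorm (D.grad v) (ENNReal.ofReal r) (leb O)
      ≤ ENNReal.ofReal Γ * eLpNorm (D.eps v) (ENNReal.ofReal r) (leb O) := by
  have h1 := (le_iSup _ v).trans (h.coercivity_le_ofReal hr)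
  split_ifs at h1 with h2
  · simp at h1
  · exact ⟨h2, (ENNReal.div_le_iff_le_mul (.inr ENNReal.ofReal_ne_top) (.inl h2)).1 h1⟩

section Norms

variable (h : D.IsStable Γ) {r : ℝ} (hr : r = p ∨ r = p.conjExponent) (v : X)
include h hr

lemma IsStable.memLp_eps : MemLp (D.eps v) (ENNReal.ofReal r) (leb O) :=
  ⟨(Lp.aestronglyMeasurable _), (h.eLpNorm_le hr v).1.lt_top⟩

lemma IsStable.rhs_ne_top :
    ENNReal.ofReal Γ * eLpNorm (D.eps v) (ENNReal.ofReal r) (leb O) ≠ ∞ :=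
  ENNReal.mul_ne_top ENNReal.ofReal_ne_top (h.eLpNorm_le hr v).1

lemma IsStable.eLpNorm_recon_le : eLpNorm (D.recon v) (ENNReal.ofReal r) (leb O)
    ≤ ENNReal.ofReal Γ * eLpNorm (D.eps v) (ENNReal.ofReal r) (leb O) :=
  (le_self_add.trans le_self_add).trans (h.eLpNorm_le hr v).2

lemma IsStable.eLpNorm_dvg_le : eLpNorm (D.dvg v) (ENNReal.ofReal r) (leb O)
    ≤ ENNReal.ofReal Γ * eLpNorm (D.eps v) (ENNReal.ofReal r) (leb O) :=
  (le_add_self.trans le_self_add).trans (h.eLpNorm_le hr v).2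

lemma IsStable.eLpNorm_grad_le : eLpNorm (D.grad v) (ENNReal.ofReal r) (leb O)
    ≤ ENNReal.ofReal Γ * eLpNorm (D.eps v) (ENNReal.ofReal r) (leb O) :=
  le_add_self.trans (h.eLpNorm_le hr v).2

lemma IsStable.memLp_recon : MemLp (D.recon v) (ENNReal.ofReal r) (leb O) :=
  ⟨Lp.aestronglyMeasurable _, (h.eLpNorm_recon_le hr v).trans_lt (h.rhs_ne_top hr v).lt_top⟩

lemma IsStable.memLp_dvg : MemLp (D.dvg v) (ENNReal.ofReal r) (leb O) :=
  ⟨Lp.aestronglyMeasurable _, (h.eLpNorm_dvg_le hr v).trans_lt (h.rhs_ne_top hr v).lt_top⟩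

lemma IsStable.memLp_grad : MemLp (D.grad v) (ENNReal.ofReal r) (leb O) :=
  ⟨Lp.aestronglyMeasurable _, (h.eLpNorm_grad_le hr v).trans_lt (h.rhs_ne_top hr v).lt_top⟩

lemma IsStable.lrNorm_recon_le (hΓ : 0 ≤ Γ) :
    lrNorm r (leb O) (D.recon v) ≤ Γ * lrNorm r (leb O) (D.eps v) := by
  have := ENNReal.toReal_mono (h.rhs_ne_top hr v) (h.eLpNorm_recon_le hr v)
  rwa [ENNReal.toReal_mul, ENNReal.toReal_ofReal hΓ] at this

lemma IsStable.lrNorm_grad_le (hΓ : 0 ≤ Γ) :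
    lrNorm r (leb O) (D.grad v) ≤ Γ * lrNorm r (leb O) (D.eps v) := by
  have := ENNReal.toReal_mono (h.rhs_ne_top hr v) (h.eLpNorm_grad_le hr v)
  rwa [ENNReal.toReal_mul, ENNReal.toReal_ofReal hΓ] at this

lemma IsStable.lrNorm_eps_l2Projection_le (hΓ : 0 ≤ Γ) {z : Vec n → Vec n} {K : ℝ} (hK : 0 ≤ K)
    (hz : MemLp z 2 (leb O)) (hz' : MemSobolev O 1 (ENNReal.ofReal r) z)
    (hzK : sobolevNormOne O r z ≤ ENNReal.ofReal K) :
    lrNorm r (leb O) (D.eps (D.l2Projection z)) ≤ Γ * K := by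
  have h1 := (le_iSup₂ (f := fun (z : Vec n → Vec n)
    (_ : MemLp z 2 (leb O) ∧ MemSobolev O 1 (ENNReal.ofReal r) z) =>
    eLpNorm (D.eps (D.l2Projection z)) (ENNReal.ofReal r) (leb O) / sobolevNormOne O r z)
    z ⟨hz, hz'⟩).trans (h.sobolevStability_le_ofReal hr)
  rw [ENNReal.div_le_iff_le_mul (.inr ENNReal.ofReal_ne_top)
    (.inl (hzK.trans_lt ENNReal.ofReal_lt_top).ne)] at h1
  have h2 : eLpNorm (D.eps (D.l2Projection z)) (ENNReal.ofReal r) (leb O)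
      ≤ ENNReal.ofReal (Γ * K) := by
    rw [ENNReal.ofReal_mul hΓ]
    exact h1.trans (by gcongr)
  have := ENNReal.toReal_mono ENNReal.ofReal_ne_top h2
  rwa [ENNReal.toReal_ofReal (by positivity)] at this

end Norms

lemma integrable_chi [IsFiniteMeasure (leb O)] (hp : 1 < p) (q : Y) :
    Integrable (D.chi q) (leb O) := by
  refine (Lp.memLp (D.chi q)).integrable ?_
  rw [ENNReal.one_le_ofReal]
  exact le_min_iff.2 ⟨hp.le, (Real.HolderConjugate.conjExponent hp).symm.lt.le⟩

lemma meanFree_sub [IsFiniteMeasure (leb O)] (hp : 1 < p) {q r : Y} (hq : D.MeanFree q)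
    (hr : D.MeanFree r) : D.MeanFree (q - r) := by
  have e : D.chi (q - r) =ᵐ[leb O] fun x => D.chi q x - D.chi r x := by
    rw [map_sub]
    exact Lp.coeFn_sub _ _
  rw [GDData.MeanFree, integral_congr_ae e,
    integral_sub (integrable_chi hp q) (integrable_chi hp r),
    hq, hr, sub_zero]

/-- The pressure lies only in L^{p ∧ p'}, but stability puts the discrete divergence in both L^p and
L^{p'}, hence in the dual exponent in either case. -/
lemma IsStable.integrable_chi_mul_dvg (h : D.IsStable Γ) (hp : 1 < p) (q : Y) (v : X) :
    Integrable (fun x => D.chi q x * D.dvg v x) (leb O) := by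
  have hc := Real.HolderConjugate.conjExponent hp
  have h1 := Lp.memLp (D.chi q)
  generalize (D.chi q : Vec n → ℝ) = f at h1 ⊢
  rcases min_choice p p.conjExponent with hm | hm
  · rw [minExp, hm] at h1
    have := hc.ennrealOfReal
    exact h1.integrable_mul (h.memLp_dvg (.inr rfl) v)
  · rw [minExp, hm] at h1
    have := hc.symm.ennrealOfReal
    exact h1.integrable_mul (h.memLp_dvg (.inl rfl) v)

/-- The space `E_{D,0}` of discretely divergence-free velocities. -/
def IsStable.divFree (h : D.IsStable Γ) (hp : 1 < p) : Submodule ℝ X where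
  carrier := {v | D.DivFree v}
  zero_mem' := fun q _ => by
    rw [map_zero]
    have : (fun x => D.chi q x * (0 : Lp ℝ (ENNReal.ofReal p) (leb O)) x) =ᵐ[leb O] 0 := by
      filter_upwards [Lp.coeFn_zero ℝ (ENNReal.ofReal p) (leb O)] with x hx
      rw [hx, Pi.zero_apply, mul_zero]
    rw [integral_congr_ae this]
    exact integral_zero _ _
  add_mem' := fun {v w} hv hw q hq => by
    have : (fun x => D.chi q x * D.dvg (v + w) x)
        =ᵐ[leb O] fun x => D.chi q x * D.dvg v x + D.chi q x * D.dvg w x := by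
      rw [map_add]
      filter_upwards [Lp.coeFn_add (D.dvg v) (D.dvg w)] with x hx
      rw [hx, Pi.add_apply, mul_add]
    rw [integral_congr_ae this, integral_add (h.integrable_chi_mul_dvg hp q v)
      (h.integrable_chi_mul_dvg hp q w), hv q hq, hw q hq, add_zero]
  smul_mem' := fun c v hv q hq => by
    have : (fun x => D.chi q x * D.dvg (c • v) x)
        =ᵐ[leb O] fun x => c * (D.chi q x * D.dvg v x) := by
      rw [map_smul]
      filter_upwards [Lp.coeFn_smul c (D.dvg v)] with x hx
      rw [hx, Pi.smul_apply, smul_eq_mul, mul_left_comm]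
    rw [integral_congr_ae this, integral_const_mul, hv q hq, mul_zero]

section Projection

variable [FiniteDimensional ℝ X]

/-- A projection exists because the image of the discretely divergence-free velocities is
finite-dimensional, so the orthogonal projection of L² onto it is available. -/
lemma IsStable.isL2Projection_l2Projection (h : D.IsStable Γ) (hp : 1 < p) {u : Vec n → Vec n}
    (hu : MemLp u 2 (leb O)) : D.IsL2Projection u (D.l2Projection u) := by
  have hex : ∃ w, D.IsL2Projection u w := by
    set K : Submodule ℝ (Lp (Vec n) 2 (leb O)) := (h.divFree hp).map D.recon with hK
    obtain ⟨w, hw, hw'⟩ := K.starProjection_apply_mem (hu.toLp u)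
    refine ⟨w, hw, fun ξ hξ => ?_⟩
    have h1 := K.starProjection_inner_eq_zero (hu.toLp u) (D.recon ξ) ⟨ξ, hξ, rfl⟩
    rw [← hw', L2.inner_def] at h1
    rw [← h1]
    refine integral_congr_ae ?_
    filter_upwards [hu.coeFn_toLp, Lp.coeFn_sub (hu.toLp u) (D.recon w)] with x h2 h3
    rw [h3, Pi.sub_apply, h2]
  rw [l2Projection, dif_pos hex]
  exact hex.choose_spec

lemma IsStable.inner_recon_l2Projection (h : D.IsStable Γ) (hp : 1 < p) {u : Vec n → Vec n}
    (hu : MemLp u 2 (leb O)) {ξ : X} (hξ : D.DivFree ξ) :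
    inner ℝ (D.recon (D.l2Projection u)) (D.recon ξ) = inner ℝ (hu.toLp u) (D.recon ξ) := by
  have h1 := (h.isL2Projection_l2Projection hp hu).2 ξ hξ
  have h2 : inner ℝ (hu.toLp u - D.recon (D.l2Projection u)) (D.recon ξ) = (0 : ℝ) := by
    rw [← h1, L2.inner_def]
    refine integral_congr_ae ?_
    filter_upwards [hu.coeFn_toLp, Lp.coeFn_sub (hu.toLp u) (D.recon (D.l2Projection u))]
      with x h2 h3
    rw [h3, Pi.sub_apply, h2]
  rw [inner_sub_left, sub_eq_zero] at h2
  exact h2.symm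

lemma IsStable.norm_recon_l2Projection_le (h : D.IsStable Γ) (hp : 1 < p) {u : Vec n → Vec n}
    (hu : MemLp u 2 (leb O)) : ‖D.recon (D.l2Projection u)‖ ≤ ‖hu.toLp u‖ := by
  have h1 := h.inner_recon_l2Projection hp hu (h.isL2Projection_l2Projection hp hu).1
  rw [real_inner_self_eq_norm_sq] at h1
  have h2 := real_inner_le_norm (hu.toLp u) (D.recon (D.l2Projection u))
  rw [← h1] at h2
  nlinarith [norm_nonneg (D.recon (D.l2Projection u)), norm_nonneg (hu.toLp u)]

end Projection

section Noise

variable {σ : Vec n → Vec n} {S : ℝ}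

/-- Skew-symmetry: multiplicative noise does no work on the midpoint velocity. -/
lemma noise_self (v : X) : D.noise σ v v = 0 := by
  simp only [noise, real_inner_comm (D.recon v _)]
  ring

variable (hσ : AEStronglyMeasurable σ (leb O)) (hS : ∀ᵐ x ∂leb O, ‖σ x‖ ≤ S)
include hσ hS

lemma IsStable.integrable_noise_left (h : D.IsStable Γ) (hp : 1 < p) (v ξ : X) : Integrable
    (fun x => (inner ℝ (transMul (σ x) (D.grad v x)) (D.recon ξ x) : ℝ)) (leb O) :=
  integrable_inner_of_memLp (Real.HolderConjugate.conjExponent hp)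
    (memLp_transMul hσ hS (h.memLp_grad (.inl rfl) v)) (h.memLp_recon (.inr rfl) ξ)

lemma IsStable.integrable_noise_right (h : D.IsStable Γ) (hp : 1 < p) (v ξ : X) : Integrable
    (fun x => (inner ℝ (D.recon v x) (transMul (σ x) (D.grad ξ x)) : ℝ)) (leb O) :=
  integrable_inner_of_memLp (Real.HolderConjugate.conjExponent hp)
    (h.memLp_recon (.inl rfl) v) (memLp_transMul hσ hS (h.memLp_grad (.inr rfl) ξ))

lemma IsStable.noise_sub_left (h : D.IsStable Γ) (hp : 1 < p) (v w ξ : X) :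
    D.noise σ (v - w) ξ = D.noise σ v ξ - D.noise σ w ξ := by
  have e1 : (fun x => (inner ℝ (transMul (σ x) (D.grad (v - w) x)) (D.recon ξ x) : ℝ))
      =ᵐ[leb O] fun x => (inner ℝ (transMul (σ x) (D.grad v x)) (D.recon ξ x) : ℝ)
        - inner ℝ (transMul (σ x) (D.grad w x)) (D.recon ξ x) := by
    rw [map_sub]
    filter_upwards [Lp.coeFn_sub (D.grad v) (D.grad w)] with x hx
    rw [hx, Pi.sub_apply, sub_eq_add_neg, transMul_add, ← neg_one_smul ℝ, transMul_smul,
      inner_add_left, real_inner_smul_left]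
    ring
  have e2 : (fun x => (inner ℝ (D.recon (v - w) x) (transMul (σ x) (D.grad ξ x)) : ℝ))
      =ᵐ[leb O] fun x => (inner ℝ (D.recon v x) (transMul (σ x) (D.grad ξ x)) : ℝ)
        - inner ℝ (D.recon w x) (transMul (σ x) (D.grad ξ x)) := by
    rw [map_sub]
    filter_upwards [Lp.coeFn_sub (D.recon v) (D.recon w)] with x hx
    rw [hx, Pi.sub_apply, inner_sub_left]
  rw [noise, integral_congr_ae e1, integral_congr_ae e2,
    integral_sub (h.integrable_noise_left hσ hS hp v ξ) (h.integrable_noise_left hσ hS hp w ξ),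
    integral_sub (h.integrable_noise_right hσ hS hp v ξ) (h.integrable_noise_right hσ hS hp w ξ),
    noise, noise]
  ring

/-- In both halves of the form Hölder places v in L^p and ξ in L^{p'}; the gradient and the
reconstruction are each controlled by ε in both exponents, whence Γ². -/
lemma IsStable.abs_noise_le (h : D.IsStable Γ) (hp : 1 < p) (hΓ : 0 ≤ Γ) (hS0 : 0 ≤ S) (v ξ : X) :
    |D.noise σ v ξ| ≤ S * Γ ^ 2 *
      (lrNorm p (leb O) (D.eps v) * lrNorm p.conjExponent (leb O) (D.eps ξ)) := by
  have hc := Real.HolderConjugate.conjExponent hp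
  have h1 := abs_integral_inner_le hc (memLp_transMul hσ hS (h.memLp_grad (.inl rfl) v))
    (h.memLp_recon (.inr rfl) ξ)
  have h2 := abs_integral_inner_le hc (h.memLp_recon (.inl rfl) v)
    (memLp_transMul hσ hS (h.memLp_grad (.inr rfl) ξ))
  have h3 := lrNorm_transMul_le hS0 hS (h.memLp_grad (.inl rfl) v)
  have h4 := lrNorm_transMul_le hS0 hS (h.memLp_grad (.inr rfl) ξ)
  have h5 := h.lrNorm_grad_le (.inl rfl) v hΓ
  have h6 := h.lrNorm_grad_le (.inr rfl) ξ hΓ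
  have h7 := h.lrNorm_recon_le (.inl rfl) v hΓ
  have h8 := h.lrNorm_recon_le (.inr rfl) ξ hΓ
  set a := lrNorm p (leb O) (D.eps v)
  set b := lrNorm p.conjExponent (leb O) (D.eps ξ)
  have ha : 0 ≤ a := lrNorm_nonneg _ _
  have hb : 0 ≤ b := lrNorm_nonneg _ _
  have h9 := mul_le_mul (h3.trans (mul_le_mul_of_nonneg_left h5 hS0)) h8 (lrNorm_nonneg _ _)
    (by positivity)
  have h10 := mul_le_mul h7 (h4.trans (mul_le_mul_of_nonneg_left h6 hS0)) (lrNorm_nonneg _ _)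
    (by positivity)
  rw [noise]
  have h11 := h1.trans h9
  have h12 := h2.trans h10
  rw [abs_le] at h11 h12 ⊢
  constructor <;> nlinarith

end Noise

end GradientDiscretisation

/-! ### The energy estimate for one time step. -/

/-- Young's inequality with a small factor. -/
lemma exists_young {p q δ K : ℝ} (hpq : p.HolderConjugate q) (hδ : 0 < δ) (hK : 0 ≤ K) :
    ∃ C : ℝ, 0 ≤ C ∧ ∀ a y : ℝ, 0 ≤ a → 0 ≤ y → K * a * y ≤ δ * a ^ p + C * y ^ q := by
  have hp := hpq.pos
  -- Chosen so that (aε) ^ p / p = δ a ^ p in Young's inequality for the product (aε)(K y / ε).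
  set ε := (δ * p) ^ p⁻¹ with hε
  have hε0 : 0 < ε := by positivity
  have hεp : ε ^ p = δ * p := Real.rpow_inv_rpow (by positivity) hp.ne'
  refine ⟨(K / ε) ^ q / q, div_nonneg (by positivity) hpq.symm.nonneg, fun a y ha hy => ?_⟩
  have h1 := Real.young_inequality_of_nonneg (mul_nonneg ha hε0.le)
    (by positivity : 0 ≤ K / ε * y) hpq
  rw [Real.mul_rpow ha hε0.le, hεp, Real.mul_rpow (by positivity) hy] at h1
  calc K * a * y = a * ε * (K / ε * y) := by field_simp
    _ ≤ _ := h1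
    _ = _ := by field_simp

/-- An exponent that dominates all powers of the noise increments in the energy estimate. -/
noncomputable def noiseExponent (p : ℝ) : ℕ := ⌈p⌉₊ + ⌈2 * p.conjExponent⌉₊ + 2

lemma rpow_le_noise {ζ r : ℝ} {m : ℕ} (hζ : 0 ≤ ζ) (hr : 0 ≤ r) (hm : r ≤ m) :
    ζ ^ r ≤ (1 + ζ) ^ m := by
  rw [← Real.rpow_natCast]
  exact (Real.rpow_le_rpow hζ (by linarith) hr).trans
    (Real.rpow_le_rpow_of_exponent_le (by linarith) hm)

/-- The scalar part of the energy estimate for one time step. -/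
lemma exists_energy_scalar {p c₁ K₁ K₂ K₃ K₄ K₅ K₆ : ℝ} (hp : 1 < p) (hc₁ : 0 < c₁)
    (hK₁ : 0 ≤ K₁) (hK₂ : 0 ≤ K₂) (hK₃ : 0 ≤ K₃) (hK₄ : 0 ≤ K₄) (hK₅ : 0 ≤ K₅) (hK₆ : 0 ≤ K₆) :
    ∃ C : ℝ, 0 < C ∧ ∀ τ s a E₀ E₁ I L l₀ I₂ B Z : ℝ, 0 < τ → 0 ≤ a →
      E₁ - E₀ + 2 * (τ * I) = 2 * (L * s) → c₁ * a ^ p - K₁ ≤ I → |L| ≤ K₂ * a →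
      2 * L = 2 * l₀ + (-(τ * I₂) + (B + Z) * s) → |I₂| ≤ K₃ * (a + K₄) ^ (p - 1) →
      |B| ≤ K₅ * a → |Z| ≤ K₆ →
      E₁ + c₁ * (τ * a ^ p) ≤ E₀ + 2 * ((if τ ≤ 1 then l₀ else 0) * s)
        + C * τ * (1 + |s| / √τ) ^ noiseExponent p := by
  have hc := Real.HolderConjugate.conjExponent hp
  set q := p.conjExponent with hq
  -- The dissipation available is 2c₁τa ^ p, of which c₁τa ^ p must survive. For τ > 1 the first
  -- application spends the rest; for τ ≤ 1 the other two spend one half of it each, with 2 ^ p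
  -- compensating for (a + K₄) ^ p.
  obtain ⟨C₁, hC₁, H₁⟩ := exists_young hc hc₁ (by positivity : 0 ≤ 2 * K₂)
  obtain ⟨C₂, hC₂, H₂⟩ := exists_young hc (by positivity : 0 < c₁ / 2) hK₅
  obtain ⟨C₃, hC₃, H₃⟩ := exists_young hc.symm (by positivity : 0 < c₁ / 2 / 2 ^ p) hK₃
  refine ⟨2 * K₁ + C₁ + C₂ + C₃ + c₁ / 2 * K₄ ^ p + K₆ + 1, by positivity, ?_⟩
  -- In the application a = ‖εw‖ in L^p, E₀ and E₁ are the old and new energies, I and I₂ pair the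
  -- stress with εw and εz, L = (F, Πw), l₀ = (F, Πv), B is the noise form at (w, z), Z = ‖Πz‖², and
  -- s is the noise increment.
  intro τ s a E₀ E₁ I L l₀ I₂ B Z hτ ha hE hI hL hLl hI₂ hB hZ
  set ζ := |s| / √τ with hζ
  have hτ' : 0 < √τ := Real.sqrt_pos.2 hτ
  have hζ0 : 0 ≤ ζ := by positivity
  have hsζ : |s| = ζ * √τ := by rw [hζ, div_mul_cancel₀ _ hτ'.ne']
  have hττ : √τ * √τ = τ := Real.mul_self_sqrt hτ.le
  set R := (1 + ζ) ^ noiseExponent p with hR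
  have hq0 := hc.symm.pos
  have hm1 : p ≤ noiseExponent p := by
    have := Nat.le_ceil p
    rw [noiseExponent]; push_cast; linarith [(Nat.cast_nonneg ⌈2 * q⌉₊ : (0 : ℝ) ≤ _)]
  have hm2 : 2 * q ≤ noiseExponent p := by
    have := Nat.le_ceil (2 * q)
    rw [noiseExponent]; push_cast; linarith [(Nat.cast_nonneg ⌈p⌉₊ : (0 : ℝ) ≤ _)]
  have hR1 : 1 ≤ R := one_le_pow₀ (by linarith)
  have hRp : ζ ^ p ≤ R := rpow_le_noise hζ0 hc.nonneg hm1
  have hRq : ζ ^ q ≤ R := rpow_le_noise hζ0 hq0.le (by linarith)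
  have hR2q : (ζ ^ 2) ^ q ≤ R := by
    rw [← Real.rpow_natCast, ← Real.rpow_mul hζ0]
    exact rpow_le_noise hζ0 (by positivity) (by exact_mod_cast hm2)
  have hR2 : ζ ^ 2 ≤ R := by
    have := rpow_le_noise (r := 2) (m := noiseExponent p) hζ0 (by norm_num)
      (by rw [noiseExponent]; push_cast; linarith [(Nat.cast_nonneg ⌈p⌉₊ : (0 : ℝ) ≤ _),
        (Nat.cast_nonneg ⌈2 * q⌉₊ : (0 : ℝ) ≤ _)])
    simpa using this
  have hτI := mul_le_mul_of_nonneg_left hI hτ.le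
  have hap : 0 ≤ a ^ p := by positivity
  have hK4p : 0 ≤ K₄ ^ p := by positivity
  -- For small τ the term L s is of order √τ, so its martingale part must be split off. For large τ
  -- the splitting would produce τ|I₂||s|, of order τ^{3/2}, while L s is already of order at most
  -- τ.
  by_cases hτ1 : τ ≤ 1
  · rw [if_pos hτ1]
    have hs1 : |s| ≤ ζ := by
      rw [hsζ]
      exact mul_le_of_le_one_right hζ0 (Real.sqrt_le_iff.2 ⟨zero_le_one, by simpa using hτ1⟩)
    have hs2 : s ^ 2 = τ * ζ ^ 2 := by rw [← sq_abs, hsζ, mul_pow, sq √τ, hττ]; ring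
    have e2 : 2 * (L * s) = 2 * (l₀ * s) + (-(τ * I₂) * s + B * s ^ 2 + Z * s ^ 2) := by
      linear_combination s * hLl
    have t1 : -(τ * I₂) * s ≤ τ * (c₁ / 2 * a ^ p + c₁ / 2 * K₄ ^ p + C₃ * R) := by
      have h1 : -(τ * I₂) * s ≤ τ * (|I₂| * |s|) := by
        rw [← abs_mul]; nlinarith [neg_abs_le (I₂ * s)]
      have h2 : |I₂| * |s| ≤ K₃ * (a + K₄) ^ (p - 1) * ζ :=
        mul_le_mul hI₂ hs1 (abs_nonneg _) (by positivity)
      -- Young with the exponents exchanged: the p'-th power of (a + K₄) ^ (p − 1) is (a + K₄) ^ p.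
      have h3 := H₃ ((a + K₄) ^ (p - 1)) ζ (by positivity) hζ0
      rw [← Real.rpow_mul (by positivity), hc.sub_one_mul_conj] at h3
      have h4 := add_rpow_le_two_rpow_mul ha hK₄ hc.nonneg
      have h5 : c₁ / 2 / 2 ^ p * (a + K₄) ^ p ≤ c₁ / 2 * (a ^ p + K₄ ^ p) := by
        rw [div_mul_eq_mul_div, div_le_iff₀ (by positivity)]
        calc c₁ / 2 * (a + K₄) ^ p ≤ c₁ / 2 * (2 ^ p * (a ^ p + K₄ ^ p)) := by gcongr
          _ = _ := by ring
      have h6 : C₃ * ζ ^ p ≤ C₃ * R := by gcongr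
      refine h1.trans (mul_le_mul_of_nonneg_left ?_ hτ.le)
      linarith only [h2, h3, h5, h6]
    have t2 : B * s ^ 2 ≤ τ * (c₁ / 2 * a ^ p + C₂ * R) := by
      have h1 : B * ζ ^ 2 ≤ K₅ * a * ζ ^ 2 :=
        mul_le_mul_of_nonneg_right ((le_abs_self B).trans hB) (by positivity)
      have h2 := H₂ a (ζ ^ 2) ha (by positivity)
      have h3 : C₂ * (ζ ^ 2) ^ q ≤ C₂ * R := by gcongr
      rw [hs2]
      calc B * (τ * ζ ^ 2) = τ * (B * ζ ^ 2) := by ring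
        _ ≤ _ := mul_le_mul_of_nonneg_left (by linarith only [h1, h2, h3]) hτ.le
    have t3 : Z * s ^ 2 ≤ τ * (K₆ * R) := by
      rw [hs2]
      have h1 : Z * ζ ^ 2 ≤ K₆ * R :=
        mul_le_mul ((le_abs_self Z).trans hZ) hR2 (by positivity) hK₆
      calc Z * (τ * ζ ^ 2) = τ * (Z * ζ ^ 2) := by ring
        _ ≤ _ := mul_le_mul_of_nonneg_left h1 hτ.le
    have t4 : 0 ≤ τ * ((2 * K₁ + c₁ / 2 * K₄ ^ p) * (R - 1)) := by
      have : 0 ≤ R - 1 := by linarith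
      positivity
    have t5 : 0 ≤ τ * ((C₁ + 1) * R) := by positivity
    linarith only [t1, t2, t3, t4, t5, hE, e2, hτI]
  -- No martingale term is kept here: √τ ≤ τ gives |s| ≤ τζ, and Young applies to aζ.
  · rw [if_neg hτ1]
    have hτ2 : 1 ≤ √τ := Real.one_le_sqrt.2 (by linarith)
    have h1 : L * s ≤ K₂ * a * |s| := by
      calc L * s ≤ |L * s| := le_abs_self _
        _ = |L| * |s| := abs_mul _ _
        _ ≤ _ := by gcongr
    have h2 : |s| ≤ τ * ζ := by
      rw [hsζ, mul_comm]
      refine mul_le_mul_of_nonneg_right ?_ hζ0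
      nlinarith only [hτ2, hττ]
    have h3 := H₁ a ζ ha hζ0
    have h4 : 2 * (L * s) ≤ τ * (c₁ * a ^ p + C₁ * R) := by
      calc 2 * (L * s) ≤ 2 * (K₂ * a * (τ * ζ)) := by
            have := mul_le_mul_of_nonneg_left h2 (by positivity : 0 ≤ K₂ * a)
            linarith only [this, h1]
        _ = τ * (2 * K₂ * a * ζ) := by ring
        _ ≤ _ := by
          refine mul_le_mul_of_nonneg_left (h3.trans ?_) hτ.le
          gcongr
    have t4 : 0 ≤ τ * (2 * K₁ * (R - 1)) := by
      have : 0 ≤ R - 1 := by linarith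
      positivity
    have t5 : 0 ≤ τ * ((C₂ + C₃ + c₁ / 2 * K₄ ^ p + K₆ + 1) * R) := by positivity
    linarith only [h4, t4, t5, hE, hτI]

namespace GradientDiscretisation

variable {n : ℕ} {O : Set (Vec n)} {p Γ κ τ dW S : ℝ} {X Y : Type*}
    [AddCommGroup X] [Module ℝ X] [AddCommGroup Y] [Module ℝ Y]
    {D : GradientDiscretisation n O p X Y} {σ g : Vec n → Vec n} {v v₁ : X} {π π₁ : Y}

/-- The form of a time step in which the pressure has been eliminated by discretely
divergence-free test functions. `F` is the projection datum `(σ ⋅ ∇) g ∈ L²(O)`. -/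
structure IsDivFreeStep (D : GradientDiscretisation n O p X Y) (κ : ℝ) (σ g : Vec n → Vec n)
    (F : Lp (Vec n) 2 (leb O)) (τ dW : ℝ) (v v₁ : X) : Prop where
  divFree_left : D.DivFree v
  divFree_right : D.DivFree v₁
  momentum : ∀ ξ : X, D.DivFree ξ →
    inner ℝ (D.recon v₁ - D.recon v) (D.recon ξ)
      + τ * (∫ x in O, inner ℝ
          (stress κ p (D.eps ((1 / 2 : ℝ) • (v₁ + v)) x + symPart (weakGrad O g x))) (D.eps ξ x))
    = (D.noise σ ((1 / 2 : ℝ) • (v₁ + v)) ξ + inner ℝ F (D.recon ξ)) * dW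

/-- The pressure increment has zero mean, so it is orthogonal to the divergence of every discretely
divergence-free test function. -/
lemma IsStep.isDivFreeStep [IsFiniteMeasure (leb O)] (h : D.IsStable Γ) (hp : 1 < p)
    (hf : MemLp (fun x => transMul (σ x) (weakGrad O g x)) 2 (leb O))
    (hv : D.DivFree v) (hπ : D.MeanFree π)
    (hs : D.IsStep κ σ g τ dW v π v₁ π₁) : D.IsDivFreeStep κ σ g (hf.toLp _) τ dW v v₁ := by
  have hmid : (1 / 2 : ℝ) • (v₁ + v) ∈ h.divFree hp := fun q hq => by
    rw [← hs.divergence q hq]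
    exact integral_congr_ae (.of_forall fun x => mul_comm _ _)
  refine ⟨hv, ?_, fun ξ hξ => ?_⟩
  -- The scheme constrains only the midpoint; the new velocity inherits the constraint from the
  -- midpoint and the old velocity.
  · have : v₁ = (2 : ℝ) • ((1 / 2 : ℝ) • (v₁ + v)) - v := by
      rw [smul_smul]; norm_num
    rw [this]
    exact (h.divFree hp).sub_mem ((h.divFree hp).smul_mem _ hmid) hv
  · have e1 := hs.momentum ξ
    have e2 : ∫ x in O, (D.chi π₁ x - D.chi π x) * D.dvg ξ x = 0 := by
      rw [← hξ _ (meanFree_sub hp hs.meanFree hπ)]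
      refine integral_congr_ae ?_
      rw [map_sub]
      filter_upwards [Lp.coeFn_sub (D.chi π₁) (D.chi π)] with x hx
      rw [hx, Pi.sub_apply]
    have e3 : ∫ x in O, inner ℝ (transMul (σ x) (weakGrad O g x)) (D.recon ξ x)
        = (inner ℝ (hf.toLp _) (D.recon ξ) : ℝ) := by
      rw [L2.inner_def]
      refine integral_congr_ae ?_
      filter_upwards [hf.coeFn_toLp] with x hx
      rw [hx]
    rw [e2, e3, sub_zero] at e1
    exact e1

/-- The bounds on the data that enter the energy estimate. -/
structure DataBounds (D : GradientDiscretisation n O p X Y) (κ : ℝ) (σ g : Vec n → Vec n)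
    (Γ S K Cf Ce : ℝ) (V : ℝ≥0) : Prop where
  stable : D.IsStable Γ
  volume_eq : volume O = V
  sigma_meas : AEStronglyMeasurable σ (leb O)
  sigma_le : ∀ᵐ x ∂leb O, ‖σ x‖ ≤ S
  grad_meas : AEStronglyMeasurable (fun x => symPart (weakGrad O g x)) (leb O)
  grad_le : ∀ᵐ x ∂leb O, √κ + ‖symPart (weakGrad O g x)‖ ≤ K
  source_meas : AEStronglyMeasurable (fun x => transMul (σ x) (weakGrad O g x)) (leb O)
  source_le : ∀ᵐ x ∂leb O, ‖transMul (σ x) (weakGrad O g x)‖ ≤ Cf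
  eps_le : ∀ r, r = p ∨ r = p.conjExponent → lrNorm r (leb O)
    (D.eps (D.l2Projection fun x => transMul (σ x) (weakGrad O g x))) ≤ Ce

variable {K Cf Ce : ℝ} {V : ℝ≥0}

lemma DataBounds.leb_univ (H : D.DataBounds κ σ g Γ S K Cf Ce V) : leb O Set.univ = V := by
  simpa using H.volume_eq

lemma DataBounds.isFiniteMeasure (H : D.DataBounds κ σ g Γ S K Cf Ce V) :
    IsFiniteMeasure (leb O) := ⟨by rw [H.leb_univ]; exact ENNReal.coe_lt_top⟩

lemma DataBounds.memLp_source (H : D.DataBounds κ σ g Γ S K Cf Ce V) (r : ℝ≥0∞) :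
    MemLp (fun x => transMul (σ x) (weakGrad O g x)) r (leb O) := by
  have := H.isFiniteMeasure
  exact .of_bound H.source_meas _ H.source_le

/-- The field `(σ ⋅ ∇) g` as an element of `L²(O)`. -/
noncomputable def DataBounds.source (H : D.DataBounds κ σ g Γ S K Cf Ce V) : Lp (Vec n) 2 (leb O) :=
  (H.memLp_source 2).toLp _

lemma DataBounds.norm_source_le (H : D.DataBounds κ σ g Γ S K Cf Ce V) (hCf : 0 ≤ Cf) :
    ‖H.source‖ ≤ (V : ℝ) ^ (2 : ℝ)⁻¹ * Cf := by
  have h2 : lrNorm 2 (leb O) (fun x => transMul (σ x) (weakGrad O g x))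
      ≤ (V : ℝ) ^ (2 : ℝ)⁻¹ * Cf :=
    lrNorm_le_of_bound H.leb_univ (by norm_num) hCf H.source_le
  rw [DataBounds.source, Lp.norm_toLp]
  convert h2
  simp [lrNorm]

/-- Bounds the source term by the dissipated quantity; this is what handles τ > 1. -/
lemma DataBounds.abs_inner_source_le (H : D.DataBounds κ σ g Γ S K Cf Ce V) (hp : 1 < p)
    (hΓ : 0 ≤ Γ) (hCf : 0 ≤ Cf) (w : X) : |(inner ℝ H.source (D.recon w) : ℝ)|
      ≤ (V : ℝ) ^ p.conjExponent⁻¹ * Cf * Γ * lrNorm p (leb O) (D.eps w) := by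
  have hc := Real.HolderConjugate.conjExponent hp
  have e : (inner ℝ H.source (D.recon w) : ℝ)
      = ∫ x in O, inner ℝ (transMul (σ x) (weakGrad O g x)) (D.recon w x) := by
    rw [L2.inner_def]
    refine integral_congr_ae ?_
    filter_upwards [(H.memLp_source 2).coeFn_toLp] with x hx
    rw [DataBounds.source, hx]
  rw [e]
  refine (abs_integral_inner_le hc.symm (H.memLp_source _)
    (H.stable.memLp_recon (.inl rfl) w)).trans ?_
  have h1 := lrNorm_le_of_bound H.leb_univ hc.symm.pos hCf H.source_le
  have h2 := H.stable.lrNorm_recon_le (.inl rfl) w hΓ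
  calc _ ≤ ((V : ℝ) ^ p.conjExponent⁻¹ * Cf) * (Γ * lrNorm p (leb O) (D.eps w)) :=
        mul_le_mul h1 h2 (lrNorm_nonneg _ _) (by positivity)
    _ = _ := by ring

/-- The energy estimate for one time step. -/
lemma exists_energy_le (hp : 1 < p) (hκ : 0 ≤ κ) (hΓ : 0 ≤ Γ) (hS : 0 ≤ S) (hK : 0 ≤ K)
    (hCf : 0 ≤ Cf) (hCe : 0 ≤ Ce) (V : ℝ≥0) :
    ∃ C : ℝ, 0 < C ∧ ∀ (n : ℕ) (O : Set (Vec n)) (X Y : Type*) [AddCommGroup X] [Module ℝ X]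
      [AddCommGroup Y] [Module ℝ Y] [FiniteDimensional ℝ X] (D : GradientDiscretisation n O p X Y)
      (σ g : Vec n → Vec n) (H : D.DataBounds κ σ g Γ S K Cf Ce V) (τ dW : ℝ) (v v₁ : X),
      0 < τ → D.IsDivFreeStep κ σ g H.source τ dW v v₁ →
      ‖D.recon v₁‖ ^ 2 + (2 ^ p)⁻¹ / 2 * (τ * ‖D.eps ((1 / 2 : ℝ) • (v₁ + v))‖ ^ p)
        ≤ ‖D.recon v‖ ^ 2 + 2 * ((if τ ≤ 1 then inner ℝ H.source (D.recon v) else 0) * dW)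
          + C * τ * (1 + |dW| / √τ) ^ noiseExponent p := by
  have hc := Real.HolderConjugate.conjExponent hp
  obtain ⟨C, hC, hC'⟩ := exists_energy_scalar (p := p) (c₁ := (2 ^ p)⁻¹ / 2)
    (K₁ := 2 * (2 * K) ^ p * V) (K₂ := (V : ℝ) ^ p.conjExponent⁻¹ * Cf * Γ) (K₃ := Ce)
    (K₄ := V ^ p⁻¹ * K) (K₅ := S * Γ ^ 2 * Ce) (K₆ := ((V : ℝ) ^ (2 : ℝ)⁻¹ * Cf) ^ 2) hp
    (by positivity) (by positivity) (by positivity) hCe (by positivity) (by positivity)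
    (by positivity)
  refine ⟨C, hC, ?_⟩
  intro n O X Y _ _ _ _ _ D σ g H τ dW v v₁ hτ hs
  have hfin := H.isFiniteMeasure
  have h := H.stable
  set w := (1 / 2 : ℝ) • (v₁ + v) with hw
  have hwE : w ∈ h.divFree hp :=
    (h.divFree hp).smul_mem _ ((h.divFree hp).add_mem hs.divFree_right hs.divFree_left)
  set z := D.l2Projection fun x => transMul (σ x) (weakGrad O g x) with hz
  have hzE : D.DivFree z := (h.isL2Projection_l2Projection hp (H.memLp_source 2)).1
  have ha : lrNorm p (leb O) (D.eps w) = ‖D.eps w‖ := (Lp.norm_def _).symm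
  rw [← ha]
  have hεw := h.memLp_eps (.inl rfl) w
  have hεz := h.memLp_eps (.inl rfl) z
  have hG := H.grad_meas
  have hGp : MemLp (fun x => symPart (weakGrad O g x)) (ENNReal.ofReal p) (leb O) :=
    .of_bound hG K <| by
      filter_upwards [H.grad_le] with x hx
      linarith [Real.sqrt_nonneg κ]
  -- Testing with the midpoint gives the energy balance; testing with z = K_D F gives the equation
  -- for (F, Π(v₁ − v)).
  have tw := hs.momentum w hwE
  have tz := hs.momentum z hzE
  rw [noise_self] at tw
  have erec : D.recon w = (1 / 2 : ℝ) • (D.recon v₁ + D.recon v) := by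
    rw [hw, map_smul, map_add]
  have e1 : (inner ℝ (D.recon v₁ - D.recon v) (D.recon w) : ℝ)
      = (‖D.recon v₁‖ ^ 2 - ‖D.recon v‖ ^ 2) / 2 := by
    rw [erec, inner_smul_right, inner_add_right, inner_sub_left, inner_sub_left,
      real_inner_self_eq_norm_sq, real_inner_self_eq_norm_sq, real_inner_comm (D.recon v₁)]
    simp
    ring
  have ez (ξ : X) (hξ : D.DivFree ξ) :
      (inner ℝ (D.recon z) (D.recon ξ) : ℝ) = inner ℝ H.source (D.recon ξ) :=
    h.inner_recon_l2Projection hp (H.memLp_source 2) hξ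
  have hzn : ‖D.recon z‖ ≤ (V : ℝ) ^ (2 : ℝ)⁻¹ * Cf :=
    (h.norm_recon_l2Projection_le hp (H.memLp_source 2)).trans (H.norm_source_le hCf)
  -- On discretely divergence-free functions Πz and F have the same inner products, so the z-test
  -- now reads as an identity for (F, Πv₁) − (F, Πv), with (F, Πz) = ‖Πz‖².
  rw [← ez z hzE, real_inner_self_eq_norm_sq, inner_sub_left, real_inner_comm (D.recon z),
    real_inner_comm (D.recon z) (D.recon v), ez _ hs.divFree_right, ez _ hs.divFree_left] at tz
  refine hC' τ dW _ _ _ _ (inner ℝ H.source (D.recon w)) (inner ℝ H.source (D.recon v))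
    (D.noise σ w z) (‖D.recon z‖ ^ 2) hτ (lrNorm_nonneg _ _) ?_
    (integral_stress_coercive H.leb_univ hκ hp hεw hG H.grad_le)
    (H.abs_inner_source_le hp hΓ hCf w) ?_ (I₂ := ∫ x in O, inner ℝ
      (stress κ p (D.eps w x + symPart (weakGrad O g x))) (D.eps z x)) ?_ ?_ ?_
  · rw [e1] at tw
    linarith
  · have : (inner ℝ H.source (D.recon w) : ℝ)
        = (inner ℝ H.source (D.recon v₁) + inner ℝ H.source (D.recon v)) / 2 := by
      rw [erec, inner_smul_right, inner_add_right]
      ring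
    rw [this]
    linarith
  · refine (abs_integral_inner_le hc.symm (memLp_stress hκ hp (hεw.add hGp)) hεz).trans ?_
    rw [mul_comm Ce]
    refine mul_le_mul ?_ (H.eps_le p (.inl rfl)) (lrNorm_nonneg _ _)
      (Real.rpow_nonneg (add_nonneg (lrNorm_nonneg _ _) (by positivity)) _)
    exact lrNorm_stress_add_le H.leb_univ hκ hp hεw hG H.grad_le hK
  · refine (h.abs_noise_le H.sigma_meas H.sigma_le hp hΓ hS w z).trans ?_
    have h1 := H.eps_le _ (.inr rfl)
    have h2 := lrNorm_nonneg p (μ := leb O) (D.eps w)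
    calc _ ≤ S * Γ ^ 2 * (lrNorm p (leb O) (D.eps w) * Ce) := by gcongr
      _ = _ := by ring
  · rw [abs_of_nonneg (by positivity)]
    gcongr

end GradientDiscretisation

/-! ### Measurable dependence of a time step on its data. -/

/-- A relation that is single-valued and Lipschitz continuous on bounded sets is contained in the
graph of a measurable function. -/
lemma exists_measurable_selector {Z E : Type*} [NormedAddCommGroup Z] [MeasurableSpace Z]
    [BorelSpace Z] [NormedAddCommGroup E] [NormedSpace ℝ E] [FiniteDimensional ℝ E]
    [MeasurableSpace E] [BorelSpace E] (R : Z → E → Prop)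
    (hR : ∀ r : ℕ, ∃ K : ℝ≥0, ∀ z z' y y', ‖z‖ ≤ r → ‖z'‖ ≤ r → R z y → R z' y' →
      ‖y - y'‖ ≤ K * ‖z - z'‖) :
    ∃ Ψ : Z → E, Measurable Ψ ∧ ∀ z y, R z y → Ψ z = y := by
  classical
  choose K hK using hR
  set f : Z → E := fun z => if h : ∃ y, R z y then h.choose else 0 with hf
  have hfR (z y) (h : R z y) : f z = y := by
    have hex : ∃ y, R z y := ⟨y, h⟩
    simp only [hf, dif_pos hex]
    obtain ⟨r, hr⟩ := exists_nat_ge ‖z‖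
    have := hK r z z _ _ hr hr hex.choose_spec h
    rw [sub_self, norm_zero, mul_zero] at this
    exact sub_eq_zero.1 (norm_le_zero_iff.1 this)
  have hL (r : ℕ) : LipschitzOnWith (K r) f {z | ‖z‖ ≤ r ∧ ∃ y, R z y} := by
    refine LipschitzOnWith.of_dist_le_mul ?_
    rintro z ⟨hz, y, hy⟩ z' ⟨hz', y', hy'⟩
    rw [hfR z y hy, hfR z' y' hy', dist_eq_norm, dist_eq_norm]
    exact hK r z z' y y' hz hz' hy hy'
  -- The domain of the relation need not be measurable. Extending from its part in each ball to a
  -- globally continuous map avoids the question; the extensions are then glued along the integer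
  -- ⌈‖z‖⌉₊.
  choose G hG hGf using fun r => (hL r).extend_finite_dimension
  refine ⟨fun z => G ⌈‖z‖⌉₊ z, ?_, fun z y h => ?_⟩
  · have hm : Measurable fun q : Z × ℕ => G q.2 q.1 :=
      measurable_from_prod_countable_left fun r => (hG r).continuous.measurable
    exact hm.comp (measurable_id.prodMk (Nat.measurable_ceil.comp measurable_norm))
  · change G ⌈‖z‖⌉₊ z = y
    rw [← hGf _ ⟨Nat.le_ceil _, y, h⟩, hfR z y h]

namespace GradientDiscretisation

variable {n : ℕ} {O : Set (Vec n)} {p Γ κ S K Cf Ce : ℝ} {V : ℝ≥0} {X Y : Type*}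
    [AddCommGroup X] [Module ℝ X] [AddCommGroup Y] [Module ℝ Y]
    {D : GradientDiscretisation n O p X Y} {σ g : Vec n → Vec n}

/-- The symmetric gradient with values in `L^r`, for the exponents covered by stability. -/
noncomputable def IsStable.epsLp (h : D.IsStable Γ) {r : ℝ} (hr : r = p ∨ r = p.conjExponent) :
    X →ₗ[ℝ] Lp (Mat n) (ENNReal.ofReal r) (leb O) where
  toFun v := (h.memLp_eps hr v).toLp _
  map_add' v w := by
    rw [← MemLp.toLp_add]
    refine MemLp.toLp_congr _ _ ?_
    rw [map_add]
    exact Lp.coeFn_add _ _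
  map_smul' c v := by
    rw [RingHom.id_apply, ← MemLp.toLp_const_smul]
    refine MemLp.toLp_congr _ _ ?_
    rw [map_smul]
    exact Lp.coeFn_smul _ _

lemma IsStable.norm_epsLp (h : D.IsStable Γ) {r : ℝ} (hr : r = p ∨ r = p.conjExponent) (v : X) :
    ‖h.epsLp hr v‖ = lrNorm r (leb O) (D.eps v) := by
  rw [epsLp, LinearMap.coe_mk, AddHom.coe_mk, Lp.norm_toLp, lrNorm]

/-- The reconstructions of the discretely divergence-free velocities. -/
noncomputable def IsStable.reconSpace (h : D.IsStable Γ) (hp : 1 < p) :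
    Submodule ℝ (Lp (Vec n) 2 (leb O)) :=
  (h.divFree hp).map D.recon

/-- `Π_D` as an isomorphism onto its image. -/
noncomputable def IsStable.reconEquiv (h : D.IsStable Γ) (hp : 1 < p) :
    h.divFree hp ≃ₗ[ℝ] h.reconSpace hp :=
  LinearEquiv.ofBijective (D.recon.submoduleMap (h.divFree hp))
    ⟨fun v w hvw => Subtype.ext (D.recon_injOn v.2 w.2 (congrArg Subtype.val hvw)),
      LinearMap.submoduleMap_surjective _ _⟩

lemma IsStable.coe_reconEquiv (h : D.IsStable Γ) (hp : 1 < p) (v : h.divFree hp) :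
    (h.reconEquiv hp v : Lp (Vec n) 2 (leb O)) = D.recon v := rfl

/-- The discretely divergence-free velocity with a given reconstruction. -/
noncomputable def IsStable.lift (h : D.IsStable Γ) (hp : 1 < p) : h.reconSpace hp →ₗ[ℝ] X :=
  (h.divFree hp).subtype ∘ₗ (h.reconEquiv hp).symm.toLinearMap

lemma IsStable.recon_lift (h : D.IsStable Γ) (hp : 1 < p) (y : h.reconSpace hp) :
    D.recon (h.lift hp y) = y := by
  have := h.coe_reconEquiv hp ((h.reconEquiv hp).symm y)
  rw [LinearEquiv.apply_symm_apply] at this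
  exact this.symm

lemma IsStable.divFree_lift (h : D.IsStable Γ) (hp : 1 < p) (y : h.reconSpace hp) :
    D.DivFree (h.lift hp y) := ((h.reconEquiv hp).symm y).2

lemma IsStable.lift_eq (h : D.IsStable Γ) (hp : 1 < p) {v : X} (hv : D.DivFree v)
    {y : h.reconSpace hp} (hy : (y : Lp (Vec n) 2 (leb O)) = D.recon v) : h.lift hp y = v :=
  D.recon_injOn (h.divFree_lift hp y) hv ((h.recon_lift hp y).trans hy)

variable [FiniteDimensional ℝ X]

instance (h : D.IsStable Γ) (hp : 1 < p) : FiniteDimensional ℝ (h.reconSpace hp) :=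
  inferInstanceAs (FiniteDimensional ℝ ((h.divFree hp).map D.recon))

/-- Π is injective on a finite-dimensional space, so ε is bounded in terms of Π there. The constant
depends on D and is used for measurability only, never in the final bound. -/
lemma IsStable.exists_lrNorm_eps_le (h : D.IsStable Γ) (hp : 1 < p) {r : ℝ}
    (hr : r = p ∨ r = p.conjExponent) :
    ∃ C : ℝ, 0 ≤ C ∧ ∀ v, D.DivFree v → lrNorm r (leb O) (D.eps v) ≤ C * ‖D.recon v‖ := by
  have h1r : Fact (1 ≤ ENNReal.ofReal r) := ⟨by
    rw [ENNReal.one_le_ofReal]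
    rcases hr with rfl | rfl
    · exact hp.le
    · exact (Real.HolderConjugate.conjExponent hp).symm.lt.le⟩
  set T := LinearMap.toContinuousLinearMap (h.epsLp hr ∘ₗ h.lift hp)
  refine ⟨‖T‖, T.opNorm_nonneg, fun v hv => ?_⟩
  have h1 := T.le_opNorm ⟨D.recon v, ⟨v, hv, rfl⟩⟩
  rw [LinearMap.coe_toContinuousLinearMap', LinearMap.comp_apply, h.lift_eq hp hv rfl,
    h.norm_epsLp] at h1
  exact h1

/-- Continuous dependence of a time step on the previous velocity and on the increment of the
noise. -/
lemma DataBounds.exists_norm_sub_le (H : D.DataBounds κ σ g Γ S K Cf Ce V) (hp : 1 < p) (hκ : 0 ≤ κ)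
    (hΓ : 0 ≤ Γ) (hS : 0 ≤ S) :
    ∃ C : ℝ, 0 ≤ C ∧ ∀ τ s s' : ℝ, ∀ v v₁ v' v₁' : X, 0 < τ →
      D.IsDivFreeStep κ σ g H.source τ s v v₁ → D.IsDivFreeStep κ σ g H.source τ s' v' v₁' →
      ‖D.recon v₁ - D.recon v₁'‖ ≤ 3 * ‖D.recon v - D.recon v'‖
        + C * (1 + ‖D.recon v'‖ + ‖D.recon v₁'‖) * |s - s'| := by
  have hfin := H.isFiniteMeasure
  have hc := Real.HolderConjugate.conjExponent hp
  have h := H.stable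
  obtain ⟨c, hc0, hcb⟩ := h.exists_lrNorm_eps_le hp (.inl rfl)
  obtain ⟨d, hd0, hdb⟩ := h.exists_lrNorm_eps_le hp (.inr rfl)
  refine ⟨S * Γ ^ 2 * c * d + ‖H.source‖, by positivity, ?_⟩
  intro τ s s' v v₁ v' v₁' hτ hs hs'
  set w := (1 / 2 : ℝ) • (v₁ + v) with hw
  set w' := (1 / 2 : ℝ) • (v₁' + v') with hw'
  have hwE : w ∈ h.divFree hp :=
    (h.divFree hp).smul_mem _ ((h.divFree hp).add_mem hs.divFree_right hs.divFree_left)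
  have hwE' : w' ∈ h.divFree hp :=
    (h.divFree hp).smul_mem _ ((h.divFree hp).add_mem hs'.divFree_right hs'.divFree_left)
  have hdE : D.DivFree (w - w') := (h.divFree hp).sub_mem hwE hwE'
  have hGp : MemLp (fun x => symPart (weakGrad O g x)) (ENNReal.ofReal p) (leb O) :=
    .of_bound H.grad_meas K <| by
      filter_upwards [H.grad_le] with x hx
      linarith [Real.sqrt_nonneg κ]
  have t := hs.momentum _ hdE
  have t' := hs'.momentum _ hdE
  rw [← hw] at t
  rw [← hw'] at t'
  -- By skew-symmetry the noise forms of the two steps agree on the difference of the midpoints, so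
  -- the noise enters only through s − s'.
  have eB : D.noise σ w (w - w') = D.noise σ w' (w - w') := by
    have := h.noise_sub_left H.sigma_meas H.sigma_le hp w w' (w - w')
    rw [noise_self] at this
    linarith
  -- Monotonicity of the stress: the dissipative difference has a good sign and is dropped, for any
  -- τ > 0.
  have eS : 0 ≤ (∫ x in O, inner ℝ
        (stress κ p (D.eps w x + symPart (weakGrad O g x))) (D.eps (w - w') x))
      - ∫ x in O, inner ℝ
        (stress κ p (D.eps w' x + symPart (weakGrad O g x))) (D.eps (w - w') x) := by
    have i1 (u : X) := integrable_inner_of_memLp hc.symm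
      (memLp_stress hκ hp ((h.memLp_eps (.inl rfl) u).add hGp)) (h.memLp_eps (.inl rfl) (w - w'))
    refine le_of_le_of_eq ?_ (integral_sub (i1 w) (i1 w'))
    refine integral_nonneg_of_ae ?_
    rw [map_sub]
    filter_upwards [Lp.coeFn_sub (D.eps w) (D.eps w')] with x hx
    simp only [Pi.zero_apply]
    rw [← inner_sub_left, hx, Pi.sub_apply]
    have := stress_monotone hκ hp (D.eps w x + symPart (weakGrad O g x))
      (D.eps w' x + symPart (weakGrad O g x))
    rwa [add_sub_add_right_eq_sub] at this
  set x₀ := D.recon v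
  set x₁ := D.recon v₁
  set y₀ := D.recon v'
  set y₁ := D.recon v₁'
  set e := D.recon (w - w') with he
  have ee : e = (1 / 2 : ℝ) • ((x₁ - y₁) + (x₀ - y₀)) := by
    rw [he, map_sub, hw, hw', map_smul, map_smul, map_add, map_add, ← smul_sub]
    congr 1
    abel
  -- The bound obtained for 2‖e‖ contains 2‖x₀ − y₀‖, and returning from midpoints to endpoints adds
  -- one more: the factor 3.
  have e1 : x₁ - y₁ = (2 : ℝ) • e - (x₀ - y₀) := by
    rw [ee, smul_smul]
    norm_num
  have e2 : (x₁ - x₀) - (y₁ - y₀) = (2 : ℝ) • (e - (x₀ - y₀)) := by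
    rw [smul_sub, two_smul ℝ (x₀ - y₀), ← sub_sub, ← e1]
    abel
  have e3 : (inner ℝ (x₁ - x₀) e - inner ℝ (y₁ - y₀) e : ℝ)
      = 2 * (‖e‖ ^ 2 - inner ℝ (x₀ - y₀) e) := by
    rw [← inner_sub_left, e2, real_inner_smul_left, inner_sub_left, real_inner_self_eq_norm_sq]
  have e4 : (inner ℝ (x₀ - y₀) e : ℝ) ≤ ‖x₀ - y₀‖ * ‖e‖ := real_inner_le_norm _ _
  have e5 : |(inner ℝ H.source e : ℝ)| ≤ ‖H.source‖ * ‖e‖ := abs_real_inner_le_norm _ _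
  have hwn : ‖D.recon w'‖ ≤ (‖y₀‖ + ‖y₁‖) / 2 := by
    rw [hw', map_smul, map_add, norm_smul, Real.norm_of_nonneg (by norm_num)]
    linarith [norm_add_le y₁ y₀]
  have e6 : |D.noise σ w' (w - w')| ≤ S * Γ ^ 2 * c * d * ((‖y₀‖ + ‖y₁‖) / 2) * ‖e‖ := by
    refine (h.abs_noise_le H.sigma_meas H.sigma_le hp hΓ hS w' (w - w')).trans ?_
    calc _ ≤ S * Γ ^ 2 * ((c * ‖D.recon w'‖) * (d * ‖e‖)) := by
          have h1 := hcb w' hwE'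
          have h2 := hdb _ hdE
          have h3 := lrNorm_nonneg p.conjExponent (μ := leb O) (D.eps (w - w'))
          gcongr
      _ = S * Γ ^ 2 * c * d * ‖D.recon w'‖ * ‖e‖ := by ring
      _ ≤ _ := by gcongr
  have key : 2 * ‖e‖ ^ 2 ≤ 2 * (‖x₀ - y₀‖ * ‖e‖)
      + (S * Γ ^ 2 * c * d + ‖H.source‖) * (1 + ‖y₀‖ + ‖y₁‖) * |s - s'| * ‖e‖ := by
    have r1 : (D.noise σ w' (w - w') + inner ℝ H.source e) * (s - s')
        ≤ ((S * Γ ^ 2 * c * d + ‖H.source‖) * (1 + ‖y₀‖ + ‖y₁‖) * ‖e‖) * |s - s'| := by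
      refine (le_abs_self _).trans ?_
      rw [abs_mul]
      refine mul_le_mul_of_nonneg_right ((abs_add_le _ _).trans ((add_le_add e6 e5).trans ?_))
        (abs_nonneg _)
      rw [← add_mul]
      refine mul_le_mul_of_nonneg_right ?_ (norm_nonneg _)
      have q1 : 0 ≤ S * Γ ^ 2 * c * d * (1 + ‖y₀‖ / 2 + ‖y₁‖ / 2) := by positivity
      have q2 : 0 ≤ ‖H.source‖ * (‖y₀‖ + ‖y₁‖) := by positivity
      linarith
    have r2 := mul_nonneg hτ.le eS
    rw [eB] at t
    linarith
  have key2 : 2 * ‖e‖ ≤ 2 * ‖x₀ - y₀‖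
      + (S * Γ ^ 2 * c * d + ‖H.source‖) * (1 + ‖y₀‖ + ‖y₁‖) * |s - s'| := by
    rcases (norm_nonneg e).eq_or_lt with h0 | h0
    · rw [← h0, mul_zero]
      positivity
    · refine le_of_mul_le_mul_right ?_ h0
      linarith
  rw [e1]
  refine (norm_sub_le _ _).trans ?_
  rw [norm_smul, Real.norm_of_nonneg (by norm_num)]
  linarith

end GradientDiscretisation

/-! ### Random variables with all moments, a class closed under the operations used below. -/

section AllMoments

variable {Ω : Type*} [MeasurableSpace Ω] {P : Measure Ω} {f g : Ω → ℝ}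

/-- Real random variables with finite absolute moments of all orders. -/
structure HasAllMoments (P : Measure Ω) (f : Ω → ℝ) : Prop where
  aestronglyMeasurable : AEStronglyMeasurable f P
  integrable_abs_pow : ∀ k : ℕ, Integrable (fun ω => |f ω| ^ k) P

lemma HasAllMoments.of_le (hf : AEStronglyMeasurable f P) {G : ℕ → Ω → ℝ}
    (hG : ∀ k, Integrable (G k) P) (h : ∀ k, ∀ᵐ ω ∂P, |f ω| ^ k ≤ G k ω) : HasAllMoments P f := by
  refine ⟨hf, fun k => (hG k).mono' ?_ ?_⟩
  · exact (continuous_abs.pow k).comp_aestronglyMeasurable hf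
  · filter_upwards [h k] with ω hω
    rwa [Real.norm_of_nonneg (by positivity)]

lemma HasAllMoments.mono (hg : HasAllMoments P g) (hf : AEStronglyMeasurable f P)
    (h : ∀ᵐ ω ∂P, |f ω| ≤ |g ω|) : HasAllMoments P f :=
  .of_le hf hg.2 fun k => by
    filter_upwards [h] with ω hω
    gcongr

lemma HasAllMoments.add (hf : HasAllMoments P f) (hg : HasAllMoments P g) :
    HasAllMoments P (fun ω => f ω + g ω) :=
  .of_le (hf.1.add hg.1) (fun k => ((hf.2 k).add (hg.2 k)).const_mul (2 ^ (k - 1))) fun k =>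
    .of_forall fun _ => (pow_le_pow_left₀ (abs_nonneg _) (abs_add_le _ _) k).trans
      (add_pow_le (abs_nonneg _) (abs_nonneg _) k)

lemma HasAllMoments.mul (hf : HasAllMoments P f) (hg : HasAllMoments P g) :
    HasAllMoments P (fun ω => f ω * g ω) :=
  .of_le (hf.1.mul hg.1) (fun k => (hf.2 (k * 2)).add (hg.2 (k * 2))) fun k =>
    .of_forall fun ω => by
      simp only [Pi.add_apply]
      rw [abs_mul, mul_pow, pow_mul, pow_mul]
      nlinarith [sq_nonneg (|f ω| ^ k - |g ω| ^ k), sq_nonneg (|f ω| ^ k + |g ω| ^ k)]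

lemma HasAllMoments.sup (hf : HasAllMoments P f) (hg : HasAllMoments P g) :
    HasAllMoments P (fun ω => f ω ⊔ g ω) :=
  .of_le (hf.1.sup hg.1) (fun k => (hf.2 k).add (hg.2 k)) fun k =>
    .of_forall fun ω => by
      have h1 : 0 ≤ |f ω| ^ k := by positivity
      have h2 : 0 ≤ |g ω| ^ k := by positivity
      simp only [Pi.add_apply]
      rcases max_choice (f ω) (g ω) with h | h <;> rw [h] <;> linarith

lemma HasAllMoments.abs (hf : HasAllMoments P f) : HasAllMoments P (fun ω => |f ω|) :=
  hf.mono (continuous_abs.comp_aestronglyMeasurable hf.1) (.of_forall fun ω => by simp)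

lemma hasAllMoments_const [IsFiniteMeasure P] (c : ℝ) : HasAllMoments P (fun _ => c) :=
  ⟨aestronglyMeasurable_const, fun _ => integrable_const _⟩

lemma HasAllMoments.pow [IsFiniteMeasure P] (hf : HasAllMoments P f) (m : ℕ) :
    HasAllMoments P (fun ω => f ω ^ m) := by
  induction m with
  | zero => simpa using hasAllMoments_const (P := P) 1
  | succ m ih => simpa only [pow_succ] using ih.mul hf

lemma HasAllMoments.integrable (hf : HasAllMoments P f) : Integrable f P :=
  (hf.2 1).mono' hf.1 (.of_forall fun ω => by simp)

lemma hasAllMoments_of_hasLaw_gaussianReal (h : HasLaw f (gaussianReal 0 1) P) :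
    HasAllMoments P f := by
  refine ⟨h.aemeasurable.aestronglyMeasurable, fun k => ?_⟩
  have h1 : Integrable (fun x : ℝ => |x| ^ k) (gaussianReal 0 1) :=
    (memLp_id_gaussianReal (μ := 0) (v := 1) (k : ℝ≥0)).integrable_norm_pow'
  rw [← h.map_eq] at h1
  exact h1.comp_aemeasurable h.aemeasurable

end AllMoments

/-! ### Pathwise inequalities: powers of one increment, and Doob's inequality. -/

section Moments

/-- One step of the discrete Itô-type inequality for powers. -/
lemma exists_pow_step_le {B R : ℝ} (hB : 0 ≤ B) (hR : 0 ≤ R) (a m : ℕ) :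
    ∃ (A : ℝ) (L : ℕ), 0 ≤ A ∧ ∀ τ u b z : ℝ, 0 < τ → 0 ≤ u → b ^ 2 ≤ B * u →
      0 ≤ u + √τ * b * z + τ * (R * (1 + |z|) ^ a) →
      (u + √τ * b * z + τ * (R * (1 + |z|) ^ a)) ^ (m + 1) ≤
        u ^ (m + 1) + (m + 1) * (√τ * (u ^ m * b * z))
          + (τ * u ^ m + τ ^ (m + 1)) * (A * (1 + |z|) ^ L) := by
  induction m with
  | zero =>
    refine ⟨R, a, hR, fun τ u b z hτ hu hb _ => ?_⟩
    have : 0 ≤ τ * (R * (1 + |z|) ^ a) := by positivity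
    simp only [zero_add, pow_one, pow_zero, Nat.cast_zero]
    linarith
  | succ m ih =>
    obtain ⟨A, L, hA, H⟩ := ih
    -- The induction multiplies the inequality for m by u' ≥ 0. The summands of the constant bound,
    -- in turn, the drift, the quadratic variation, the product of noise and drift, and the old
    -- remainder times u'.
    refine ⟨R + (m + 1) * B + 2 * (m + 1) * (B + 1) * R + 3 * A * (B + 2 + R), L + a + 2,
      by positivity, fun τ u b z hτ hu hb hu' => ?_⟩
    set ζ := 1 + |z| with hζ
    have hζ1 : 1 ≤ ζ := by simp [hζ]
    have hζ0 : 0 ≤ ζ := by linarith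
    set β := √τ * b with hβ
    set u' := u + β * z + τ * (R * ζ ^ a) with hu'def
    -- All error terms are homogeneous in (u, τ) of degree m + 2 and carry a factor τ; comparing u
    -- with τ bounds each of them by Q. This homogeneity is what later excludes exponential growth
    -- in time.
    set Q := τ * u ^ (m + 1) + τ ^ (m + 2) with hQ
    have hQ0 : 0 ≤ Q := by positivity
    have hzζ : |z| ≤ ζ := by simp [hζ]
    have hβ2 : β ^ 2 ≤ B * τ * u := by
      rw [hβ, mul_pow, Real.sq_sqrt hτ.le]
      nlinarith
    have hβz : |β * z| ≤ (B + 1) * (u + τ) * ζ := by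
      rw [abs_mul]
      refine mul_le_mul ?_ hzζ (abs_nonneg _) (by positivity)
      apply abs_le_of_sq_le_sq _ (by positivity)
      have q1 : B * τ * u ≤ B * (u + τ) ^ 2 := by
        have : 0 ≤ B * (u ^ 2 + τ * u + τ ^ 2) := by positivity
        linarith
      have q2 : B * (u + τ) ^ 2 ≤ ((B + 1) * (u + τ)) ^ 2 := by
        rw [mul_pow]
        refine mul_le_mul_of_nonneg_right ?_ (sq_nonneg _)
        nlinarith
      linarith
    have i1 : τ ^ 2 * u ^ m ≤ Q := by
      rcases le_total u τ with h | h
      · have : u ^ m ≤ τ ^ m := by gcongr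
        calc τ ^ 2 * u ^ m ≤ τ ^ 2 * τ ^ m := by gcongr
          _ = τ ^ (m + 2) := by ring
          _ ≤ Q := by rw [hQ]; linarith [(by positivity : 0 ≤ τ * u ^ (m + 1))]
      · calc τ ^ 2 * u ^ m = τ * (τ * u ^ m) := by ring
          _ ≤ τ * (u * u ^ m) := by gcongr
          _ = τ * u ^ (m + 1) := by ring
          _ ≤ Q := by rw [hQ]; linarith [(by positivity : 0 ≤ τ ^ (m + 2))]
    have i2 : τ ^ (m + 1) * u ≤ Q := by
      rcases le_total u τ with h | h
      · calc τ ^ (m + 1) * u ≤ τ ^ (m + 1) * τ := by gcongr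
          _ = τ ^ (m + 2) := by ring
          _ ≤ Q := by rw [hQ]; linarith [(by positivity : 0 ≤ τ * u ^ (m + 1))]
      · have : τ ^ m ≤ u ^ m := by gcongr
        calc τ ^ (m + 1) * u = τ * u * τ ^ m := by ring
          _ ≤ τ * u * u ^ m := by gcongr
          _ = τ * u ^ (m + 1) := by ring
          _ ≤ Q := by rw [hQ]; linarith [(by positivity : 0 ≤ τ ^ (m + 2))]
    have i0 : τ * u ^ (m + 1) ≤ Q := by rw [hQ]; linarith [(by positivity : 0 ≤ τ ^ (m + 2))]
    have i3 : τ ^ (m + 2) ≤ Q := by rw [hQ]; linarith [(by positivity : 0 ≤ τ * u ^ (m + 1))]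
    set T := ζ ^ (L + a + 2) with hT
    have hle (k : ℕ) (hk : k ≤ L + a + 2) : ζ ^ k ≤ T := pow_le_pow_right₀ hζ1 hk
    have hT0 : 0 ≤ T := by positivity
    have j1 : u ^ (m + 1) * (τ * (R * ζ ^ a)) ≤ Q * (R * T) := by
      calc _ = (τ * u ^ (m + 1)) * (R * ζ ^ a) := by ring
        _ ≤ _ := by gcongr; exact hle a (by omega)
    -- The one place where the term of order √τ is squared: b² ≤ Bu restores the missing power of u.
    have j2 : u ^ m * (β * z) ^ 2 ≤ Q * (B * T) := by
      calc u ^ m * (β * z) ^ 2 = u ^ m * (β ^ 2 * |z| ^ 2) := by rw [sq_abs]; ring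
        _ ≤ u ^ m * (B * τ * u * ζ ^ 2) := by gcongr
        _ = (τ * u ^ (m + 1)) * (B * ζ ^ 2) := by ring
        _ ≤ _ := by gcongr; exact hle 2 (by omega)
    have j3 : u ^ m * (β * z) * (τ * (R * ζ ^ a)) ≤ Q * (2 * (B + 1) * R * T) := by
      calc _ ≤ u ^ m * ((B + 1) * (u + τ) * ζ) * (τ * (R * ζ ^ a)) := by
            exact mul_le_mul_of_nonneg_right (mul_le_mul_of_nonneg_left
              ((le_abs_self _).trans hβz) (by positivity)) (by positivity)
        _ = (τ * u ^ (m + 1) + τ ^ 2 * u ^ m) * ((B + 1) * R * ζ ^ (a + 1)) := by ring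
        _ ≤ (Q + Q) * ((B + 1) * R * T) := by
            gcongr
            exact hle (a + 1) (by omega)
        _ = _ := by ring
    have j4 : (τ * u ^ m + τ ^ (m + 1)) * (A * ζ ^ L) * u' ≤ Q * (3 * A * (B + 2 + R) * T) := by
      have k1 : u' ≤ (u + τ) * ((B + 2 + R) * ζ ^ (a + 1)) := by
        have l1 : u ≤ (u + τ) * ζ ^ (a + 1) := by
          have : 1 ≤ ζ ^ (a + 1) := one_le_pow₀ hζ1
          nlinarith
        have l2 : β * z ≤ (B + 1) * ((u + τ) * ζ ^ (a + 1)) := by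
          have : ζ ≤ ζ ^ (a + 1) := le_self_pow₀ hζ1 (by omega)
          calc β * z ≤ (B + 1) * (u + τ) * ζ := (le_abs_self _).trans hβz
            _ ≤ (B + 1) * (u + τ) * ζ ^ (a + 1) := by gcongr
            _ = _ := by ring
        have l3 : τ * (R * ζ ^ a) ≤ R * ((u + τ) * ζ ^ (a + 1)) := by
          have : ζ ^ a ≤ ζ ^ (a + 1) := pow_le_pow_right₀ hζ1 (by omega)
          calc τ * (R * ζ ^ a) ≤ (u + τ) * (R * ζ ^ (a + 1)) := by
                gcongr
                linarith
            _ = _ := by ring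
        rw [hu'def]
        linarith
      have i4 : τ * u ^ (m + 1) + τ ^ 2 * u ^ m + τ ^ (m + 1) * u + τ ^ (m + 2) ≤ Q + Q + Q := by
        linarith only [i1, i2, hQ]
      calc _ ≤ (τ * u ^ m + τ ^ (m + 1)) * (A * ζ ^ L)
              * ((u + τ) * ((B + 2 + R) * ζ ^ (a + 1))) := by
            gcongr
        _ = (τ * u ^ (m + 1) + τ ^ 2 * u ^ m + τ ^ (m + 1) * u + τ ^ (m + 2))
              * (A * (B + 2 + R) * ζ ^ (L + a + 1)) := by ring
        _ ≤ (Q + Q + Q) * (A * (B + 2 + R) * T) := by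
            refine mul_le_mul i4 ?_ (by positivity) (by positivity)
            gcongr
            exact hle _ (by omega)
        _ = _ := by ring
    have h1 := mul_le_mul_of_nonneg_right (H τ u b z hτ hu hb hu') hu'
    have e1 : (u ^ (m + 1) + (m + 1) * (√τ * (u ^ m * b * z))
          + (τ * u ^ m + τ ^ (m + 1)) * (A * ζ ^ L)) * u'
        = u ^ (m + 2) + (m + 2) * (√τ * (u ^ (m + 1) * b * z)) + u ^ (m + 1) * (τ * (R * ζ ^ a))
          + (m + 1) * (u ^ m * (β * z) ^ 2) + (m + 1) * (u ^ m * (β * z) * (τ * (R * ζ ^ a)))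
          + (τ * u ^ m + τ ^ (m + 1)) * (A * ζ ^ L) * u' := by
      have : (u ^ (m + 1) + (m + 1) * (√τ * (u ^ m * b * z))) * u'
        = u ^ (m + 2) + (m + 2) * (√τ * (u ^ (m + 1) * b * z)) + u ^ (m + 1) * (τ * (R * ζ ^ a))
          + (m + 1) * (u ^ m * (β * z) ^ 2) + (m + 1) * (u ^ m * (β * z) * (τ * (R * ζ ^ a))) := by
        rw [hu'def, hβ]
        ring
      rw [add_mul, this]
    have hm0 : (0 : ℝ) ≤ m + 1 := by positivity
    have j2' := mul_le_mul_of_nonneg_left j2 hm0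
    have j3' := mul_le_mul_of_nonneg_left j3 hm0
    rw [e1] at h1
    rw [pow_succ u' (m + 1)]
    push_cast
    linarith only [h1, j1, j2', j3', j4]

/-- A pathwise version of Doob's maximal inequality in `L²`. -/
lemma partialSups_sq_add_le (Y : ℕ → ℝ) (N : ℕ) :
    partialSups Y N ^ 2 + 4 * ∑ i ∈ Finset.range N, partialSups Y i * (Y (i + 1) - Y i)
      ≤ 4 * Y N ^ 2 := by
  -- When the maximum M is unchanged the two sides gain equally; when it jumps to Y (N + 1), the
  -- right side gains an extra 2(Y (N + 1) − M)².
  have key : ∀ N, 4 * ∑ i ∈ Finset.range N, partialSups Y i * (Y (i + 1) - Y i)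
      ≤ 4 * (partialSups Y N * Y N) - 2 * partialSups Y N ^ 2 := by
    intro N
    induction N with
    | zero => simp; nlinarith [sq_nonneg (Y 0)]
    | succ N ih =>
      rw [Finset.sum_range_succ, ← Nat.succ_eq_add_one, ← Nat.succ_eq_succ, partialSups_succ,
        Nat.succ_eq_succ, Nat.succ_eq_add_one]
      rcases max_choice (partialSups Y N) (Y (N + 1)) with h | h <;> rw [h]
      · linarith
      · nlinarith [sq_nonneg (Y (N + 1) - partialSups Y N)]
  -- It remains to see that 4MY − M² ≤ 4Y², which is (2Y − M)² ≥ 0.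
  nlinarith [key N, sq_nonneg (2 * Y N - partialSups Y N)]

/-- The tangent-line inequality for the convex function x ↦ x ^ (m + 1). -/
lemma pow_sub_pow_ge {x y : ℝ} (hx : 0 ≤ x) (hy : 0 ≤ y) (m : ℕ) :
    (m + 1) * x ^ m * (y - x) ≤ y ^ (m + 1) - x ^ (m + 1) := by
  induction m with
  | zero => simp
  | succ m ih =>
    have h1 : 0 ≤ (y ^ (m + 1) - x ^ (m + 1)) * (y - x) := by
      rcases le_total x y with h | h
      · exact mul_nonneg (by linarith [pow_le_pow_left₀ hx h (m + 1)]) (by linarith)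
      · exact mul_nonneg_of_nonpos_of_nonpos (by linarith [pow_le_pow_left₀ hy h (m + 1)])
          (by linarith)
    have h2 := mul_le_mul_of_nonneg_left ih hx
    push_cast
    have e : y ^ (m + 1 + 1) - x ^ (m + 1 + 1)
        = (y ^ (m + 1) - x ^ (m + 1)) * (y - x) + x * (y ^ (m + 1) - x ^ (m + 1))
          + x ^ (m + 1) * (y - x) := by ring
    rw [e]
    have e2 : (m + 1 + 1 : ℝ) * x ^ (m + 1) * (y - x)
        = x * ((m + 1) * x ^ m * (y - x)) + x ^ (m + 1) * (y - x) := by ring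
    rw [e2]
    linarith

end Moments

/-! ### Energy majorants and the moments of their running maxima. -/

/-- A process driven by independent standard Gaussian variables `Z`, whose squared noise
coefficient is controlled by the process. It will dominate the kinetic energy of the scheme. -/
structure IsEnergyMajorant {Ω : Type*} [mΩ : MeasurableSpace Ω] (P : Measure Ω)
    (𝓖 : Filtration ℕ mΩ) (Z U b : ℕ → Ω → ℝ) (u₀ τ B R : ℝ) (a : ℕ) : Prop where
  noise_adapted : ∀ k, Measurable[𝓖 (k + 1)] (Z k)
  noise_law : ∀ k, HasLaw (Z k) (gaussianReal 0 1) P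
  noise_indep : ∀ k, Indep (MeasurableSpace.comap (Z k) inferInstance) (𝓖 k) P
  coeff_adapted : ∀ k, Measurable[𝓖 k] (b k)
  zero : ∀ ω, U 0 ω = u₀
  succ : ∀ k ω, U (k + 1) ω = U k ω + √τ * b k ω * Z k ω + τ * (R * (1 + |Z k ω|) ^ a)
  ae_nonneg : ∀ᵐ ω ∂P, ∀ k, 0 ≤ U k ω ∧ b k ω ^ 2 ≤ B * U k ω

/-- The moments `E (1 + |Z|)^L` of a standard Gaussian variable `Z`. -/
noncomputable def gaussianMoment (L : ℕ) : ℝ := ∫ x, (1 + |x|) ^ L ∂gaussianReal 0 1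

lemma gaussianMoment_nonneg (L : ℕ) : 0 ≤ gaussianMoment L :=
  integral_nonneg fun x => by positivity

namespace IsEnergyMajorant

variable {Ω : Type*} [mΩ : MeasurableSpace Ω] {P : Measure Ω}
    {𝓖 : Filtration ℕ mΩ} {Z U b : ℕ → Ω → ℝ} {u₀ τ B R : ℝ} {a : ℕ}

lemma adapted (h : IsEnergyMajorant P 𝓖 Z U b u₀ τ B R a) (k : ℕ) : Measurable[𝓖 k] (U k) := by
  induction k with
  | zero =>
    have : U 0 = fun _ => u₀ := funext h.zero
    rw [this]
    exact measurable_const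
  | succ k ih =>
    have : U (k + 1) = fun ω => U k ω + √τ * b k ω * Z k ω + τ * (R * (1 + |Z k ω|) ^ a) :=
      funext (h.succ k)
    rw [this]
    have h1 : Measurable[𝓖 (k + 1)] (U k) := ih.mono (𝓖.mono k.le_succ) le_rfl
    have h2 : Measurable[𝓖 (k + 1)] (b k) := (h.coeff_adapted k).mono (𝓖.mono k.le_succ) le_rfl
    have h3 := h.noise_adapted k
    have h4 : Measurable fun x : ℝ => τ * (R * (1 + |x|) ^ a) := by fun_prop
    exact (h1.add ((h2.const_mul _).mul h3)).add (h4.comp h3)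

lemma hasAllMoments_noise (h : IsEnergyMajorant P 𝓖 Z U b u₀ τ B R a) (k : ℕ) :
    HasAllMoments P (Z k) := hasAllMoments_of_hasLaw_gaussianReal (h.noise_law k)

lemma integral_mul_noise (h : IsEnergyMajorant P 𝓖 Z U b u₀ τ B R a) {k : ℕ} {f : Ω → ℝ}
    (hf : Measurable[𝓖 k] f) {φ : ℝ → ℝ} (hφ : Measurable φ) :
    ∫ ω, f ω * φ (Z k ω) ∂P = (∫ ω, f ω ∂P) * ∫ x, φ x ∂gaussianReal 0 1 := by
  have hZm : Measurable (Z k) := (h.noise_adapted k).mono (𝓖.le _) le_rfl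
  have hi : f ⟂ᵢ[P] (φ ∘ Z k) := by
    rw [IndepFun_iff_Indep]
    refine indep_of_indep_of_le_left (indep_of_indep_of_le_right (h.noise_indep k).symm ?_)
      hf.comap_le
    rw [← MeasurableSpace.comap_comp]
    exact MeasurableSpace.comap_mono hφ.comap_le
  have := hi.integral_mul_eq_mul_integral (hf.mono (𝓖.le k) le_rfl).aestronglyMeasurable
    (hφ.comp hZm).aestronglyMeasurable
  rw [(h.noise_law k).integral_comp hφ.aestronglyMeasurable] at this
  exact this

lemma integral_mul_noise_eq_zero (h : IsEnergyMajorant P 𝓖 Z U b u₀ τ B R a) {k : ℕ} {f : Ω → ℝ}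
    (hf : Measurable[𝓖 k] f) : ∫ ω, f ω * Z k ω ∂P = 0 := by
  have := h.integral_mul_noise hf measurable_id
  simpa [integral_id_gaussianReal] using this

variable [IsProbabilityMeasure P]

/-- From b² ≤ BU follows |b| ≤ 1 + BU, so b inherits the moments of U. -/
lemma hasAllMoments_coeff_of (h : IsEnergyMajorant P 𝓖 Z U b u₀ τ B R a) {k : ℕ}
    (hU : HasAllMoments P (U k)) : HasAllMoments P (b k) := by
  have h1 : HasAllMoments P (fun ω => 1 + B * U k ω) :=
    (hasAllMoments_const 1).add ((hasAllMoments_const B).mul hU)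
  refine h1.mono ((h.coeff_adapted k).mono (𝓖.le k) le_rfl).aestronglyMeasurable ?_
  filter_upwards [h.ae_nonneg] with ω hω
  have h2 := (hω k).2
  have h3 : 0 ≤ B * U k ω := (sq_nonneg _).trans h2
  rw [abs_of_nonneg (by linarith : 0 ≤ 1 + B * U k ω)]
  refine abs_le_of_sq_le_sq (by nlinarith) (by linarith)

lemma hasAllMoments (h : IsEnergyMajorant P 𝓖 Z U b u₀ τ B R a) (k : ℕ) :
    HasAllMoments P (U k) := by
  induction k with
  | zero =>
    have : U 0 = fun _ => u₀ := funext h.zero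
    rw [this]
    exact hasAllMoments_const _
  | succ k ih =>
    have : U (k + 1) = fun ω => U k ω + √τ * b k ω * Z k ω + τ * (R * (1 + |Z k ω|) ^ a) :=
      funext (h.succ k)
    rw [this]
    have hZ := h.hasAllMoments_noise k
    exact (ih.add (((hasAllMoments_const _).mul (h.hasAllMoments_coeff_of ih)).mul hZ)).add
      ((hasAllMoments_const _).mul ((hasAllMoments_const _).mul
        (((hasAllMoments_const _).add hZ.abs).pow a)))

lemma hasAllMoments_coeff (h : IsEnergyMajorant P 𝓖 Z U b u₀ τ B R a) (k : ℕ) :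
    HasAllMoments P (b k) := h.hasAllMoments_coeff_of (h.hasAllMoments k)

end IsEnergyMajorant

/-- Moment bounds for energy majorants that are polynomial in time. -/
lemma exists_integral_pow_le {B R : ℝ} (hB : 0 ≤ B) (hR : 0 ≤ R) (a m : ℕ) :
    ∃ K : ℝ, 0 ≤ K ∧ ∀ (Ω : Type*) [mΩ : MeasurableSpace Ω] (P : Measure Ω)
      [IsProbabilityMeasure P] (𝓖 : Filtration ℕ mΩ) (Z U b : ℕ → Ω → ℝ) (u₀ τ : ℝ), 0 < τ →
      0 ≤ u₀ → IsEnergyMajorant P 𝓖 Z U b u₀ τ B R a → ∀ k : ℕ,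
      ∫ ω, U k ω ^ m ∂P ≤ K * (u₀ + τ * k) ^ m := by
  induction m with
  | zero =>
    exact ⟨1, zero_le_one, fun Ω _ P _ 𝓖 Z U b u₀ τ _ _ _ k => by simp⟩
  | succ m ih =>
    obtain ⟨K, hK, H⟩ := ih
    obtain ⟨A, L, hA, hstep⟩ := exists_pow_step_le hB hR a m
    have hγ := gaussianMoment_nonneg L
    -- One step raises the expectation by at most Aγ(τKT ^ m + τ ^ (m + 1)), with γ the Gaussian
    -- moment and T the elapsed time plus u₀. This is at most Aγ(K + 1) times the increment of T ^
    -- (m + 1).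
    refine ⟨1 + A * gaussianMoment L * (K + 1), by positivity, ?_⟩
    intro Ω _ P _ 𝓖 Z U b u₀ τ hτ hu₀ h k
    induction k with
    | zero =>
      have : U 0 = fun _ => u₀ := funext h.zero
      simp only [this, Nat.cast_zero, mul_zero, add_zero, integral_const, probReal_univ, one_smul]
      have h1 : 0 ≤ u₀ ^ (m + 1) := by positivity
      have h2 : 0 ≤ A * gaussianMoment L * (K + 1) := by positivity
      nlinarith
    | succ k ihk =>
      have hU := h.hasAllMoments k
      have hb := h.hasAllMoments_coeff k
      have hZ := h.hasAllMoments_noise k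
      have hUm := h.adapted k
      have hbm := h.coeff_adapted k
      have hQ : HasAllMoments P (fun ω => A * (1 + |Z k ω|) ^ L) :=
        (hasAllMoments_const A).mul (((hasAllMoments_const 1).add hZ.abs).pow L)
      have hT : HasAllMoments P (fun ω => τ * U k ω ^ m + τ ^ (m + 1)) :=
        ((hasAllMoments_const τ).mul (hU.pow m)).add (hasAllMoments_const _)
      have hM : HasAllMoments P (fun ω => U k ω ^ m * b k ω * Z k ω) := ((hU.pow m).mul hb).mul hZ
      have e1 : ∫ ω, U (k + 1) ω ^ (m + 1) ∂P ≤ ∫ ω, (U k ω ^ (m + 1)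
          + (m + 1) * (√τ * (U k ω ^ m * b k ω * Z k ω))
          + (τ * U k ω ^ m + τ ^ (m + 1)) * (A * (1 + |Z k ω|) ^ L)) ∂P := by
        refine integral_mono_ae ((h.hasAllMoments (k + 1)).pow _).integrable
          (((hU.pow (m + 1)).add ((hasAllMoments_const _).mul
            ((hasAllMoments_const _).mul hM))).add (hT.mul hQ)).integrable ?_
        filter_upwards [h.ae_nonneg] with ω hω
        have h1 := (hω (k + 1)).1
        rw [h.succ] at h1 ⊢
        exact hstep τ _ _ _ hτ (hω k).1 (hω k).2 h1
      -- The coefficient is known at time k, and Z k is centred and independent of the past.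
      have e2 : ∫ ω, U k ω ^ m * b k ω * Z k ω ∂P = 0 :=
        h.integral_mul_noise_eq_zero ((hUm.pow_const m).mul hbm)
      have e3 : ∫ ω, (τ * U k ω ^ m + τ ^ (m + 1)) * (A * (1 + |Z k ω|) ^ L) ∂P
          = (τ * ∫ ω, U k ω ^ m ∂P + τ ^ (m + 1)) * (A * gaussianMoment L) := by
        rw [h.integral_mul_noise (f := fun ω => τ * U k ω ^ m + τ ^ (m + 1))
          (φ := fun x => A * (1 + |x|) ^ L)
          (((hUm.pow_const m).const_mul τ).add measurable_const) (by fun_prop),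
          integral_add ((hasAllMoments_const τ).mul (hU.pow m)).integrable (integrable_const _),
          integral_const_mul, integral_const_mul, gaussianMoment]
        simp
      rw [integral_add ((hU.pow (m + 1)).add ((hasAllMoments_const _).mul
            ((hasAllMoments_const _).mul hM))).integrable (hT.mul hQ).integrable,
        integral_add (hU.pow (m + 1)).integrable ((hasAllMoments_const _).mul
            ((hasAllMoments_const _).mul hM)).integrable, integral_const_mul, integral_const_mul,
        e2, e3] at e1
      have e4 := H Ω P 𝓖 Z U b u₀ τ hτ hu₀ h k
      set T := u₀ + τ * k with hTdef
      have hT0 : 0 ≤ T := by positivity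
      have eT : u₀ + τ * (k + 1 : ℕ) = T + τ := by
        rw [hTdef]; push_cast; ring
      have g1 : T ^ (m + 1) + τ * T ^ m ≤ (T + τ) ^ (m + 1) := by
        calc T ^ (m + 1) + τ * T ^ m = T ^ m * (T + τ) := by ring
          _ ≤ (T + τ) ^ m * (T + τ) := by gcongr; linarith
          _ = _ := by ring
      have g2 : T ^ (m + 1) + τ ^ (m + 1) ≤ (T + τ) ^ (m + 1) := by
        calc T ^ (m + 1) + τ ^ (m + 1) = T ^ m * T + τ ^ m * τ := by ring
          _ ≤ (T + τ) ^ m * T + (T + τ) ^ m * τ := by gcongr <;> linarith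
          _ = _ := by ring
      rw [eT]
      set Aγ := A * gaussianMoment L with hAγ
      have hAγ0 : 0 ≤ Aγ := by positivity
      have g3 : (τ * ∫ ω, U k ω ^ m ∂P + τ ^ (m + 1)) * Aγ
          ≤ Aγ * (K * ((T + τ) ^ (m + 1) - T ^ (m + 1)) + ((T + τ) ^ (m + 1) - T ^ (m + 1))) := by
        rw [mul_comm]
        refine mul_le_mul_of_nonneg_left (add_le_add ?_ (by linarith)) hAγ0
        calc _ ≤ τ * (K * T ^ m) := by gcongr
          _ = K * (τ * T ^ m) := by ring
          _ ≤ _ := by gcongr; linarith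
      have g4 : T ^ (m + 1) ≤ (T + τ) ^ (m + 1) := by gcongr; linarith
      linarith

/-- Moment bounds for the running maximum of energy majorants. -/
lemma exists_integral_partialSups_rpow_le {B R q : ℝ} (hB : 0 ≤ B) (hR : 0 ≤ R) (hq : 0 < q)
    (a : ℕ) :
    ∃ C : ℝ, 0 < C ∧ ∀ (Ω : Type*) [mΩ : MeasurableSpace Ω] (P : Measure Ω)
      [IsProbabilityMeasure P] (𝓖 : Filtration ℕ mΩ) (Z U b : ℕ → Ω → ℝ) (u₀ τ : ℝ), 0 < τ →
      0 ≤ u₀ → IsEnergyMajorant P 𝓖 Z U b u₀ τ B R a → ∀ N : ℕ,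
      Integrable (fun ω => (partialSups (fun j => U j ω) N) ^ q) P ∧
      ∫ ω, (partialSups (fun j => U j ω) N) ^ q ∂P ≤ C * (u₀ + τ * N) ^ q := by
  obtain ⟨m, hm⟩ := exists_nat_ge q
  -- The even exponent leaves room for Doob in L² applied to U ^ (m + 1), and it exceeds q.
  obtain ⟨K, hK, H⟩ := exists_integral_pow_le hB hR a ((m + 1) * 2)
  refine ⟨1 + 4 * K, by positivity, ?_⟩
  intro Ω _ P _ 𝓖 Z U b u₀ τ hτ hu₀ h N
  have hmq : q ≤ ((m + 1) * 2 : ℕ) := by push_cast; linarith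
  set Y : Ω → ℕ → ℝ := fun ω j => U j ω ^ (m + 1) with hY
  set S : ℕ → Ω → ℝ := fun i ω => partialSups (Y ω) i with hS
  set X : ℕ → Ω → ℝ := fun i ω => partialSups (fun j => U j ω) i with hX
  have hsucc (f : ℕ → ℝ) (i : ℕ) : partialSups f (i + 1) = partialSups f i ⊔ f (i + 1) :=
    partialSups_succ f i
  have hSm (i) : Measurable[𝓖 i] (S i) := by
    induction i with
    | zero => simpa [hS, hY] using (h.adapted 0).pow_const (m + 1)
    | succ i ih =>
      have : S (i + 1) = fun ω => S i ω ⊔ U (i + 1) ω ^ (m + 1) := funext fun ω => hsucc _ _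
      rw [this]
      exact (ih.mono (𝓖.mono i.le_succ) le_rfl).sup ((h.adapted (i + 1)).pow_const _)
  have hSa (i) : HasAllMoments P (S i) := by
    induction i with
    | zero => simpa [hS, hY] using (h.hasAllMoments 0).pow (m + 1)
    | succ i ih =>
      have : S (i + 1) = fun ω => S i ω ⊔ U (i + 1) ω ^ (m + 1) := funext fun ω => hsucc _ _
      rw [this]
      exact ih.sup ((h.hasAllMoments (i + 1)).pow _)
  have hXa (i) : HasAllMoments P (X i) := by
    induction i with
    | zero => simpa [hX] using h.hasAllMoments 0
    | succ i ih =>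
      have : X (i + 1) = fun ω => X i ω ⊔ U (i + 1) ω := funext fun ω => hsucc _ _
      rw [this]
      exact ih.sup (h.hasAllMoments (i + 1))
  have hXS (ω : Ω) (i) : X i ω ^ (m + 1) ≤ S i ω := by
    induction i with
    | zero => simp [hX, hS, hY]
    | succ i ih =>
      have e1 : X (i + 1) ω = X i ω ⊔ U (i + 1) ω := hsucc _ _
      have e2 : S (i + 1) ω = S i ω ⊔ U (i + 1) ω ^ (m + 1) := hsucc _ _
      rw [e1, e2]
      rcases max_choice (X i ω) (U (i + 1) ω) with hc | hc <;> rw [hc]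
      · exact ih.trans (le_max_left _ _)
      · exact le_max_right _ _
  have hX0 : ∀ᵐ ω ∂P, 0 ≤ X N ω := by
    filter_upwards [h.ae_nonneg] with ω hω
    exact (hω 0).1.trans (le_partialSups_of_le (fun j => U j ω) N.zero_le)
  -- The pathwise Doob inequality is integrated after its increments are bounded below: by
  -- convexity, and by dropping the nonnegative drift. The remaining sum has mean zero.
  have hdoob : ∫ ω, S N ω ^ 2 ∂P ≤ 4 * ∫ ω, U N ω ^ ((m + 1) * 2) ∂P := by
    have hG (i : ℕ) : HasAllMoments P (fun ω => S i ω * U i ω ^ m * b i ω * Z i ω) :=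
      (((hSa i).mul ((h.hasAllMoments i).pow m)).mul (h.hasAllMoments_coeff i)).mul
        (h.hasAllMoments_noise i)
    have h1 : ∫ ω, (S N ω ^ 2 + 4 * ∑ i ∈ Finset.range N,
        ((m + 1) * √τ) * (S i ω * U i ω ^ m * b i ω * Z i ω)) ∂P
        ≤ ∫ ω, 4 * U N ω ^ ((m + 1) * 2) ∂P := by
      refine integral_mono_ae (((hSa N).pow 2).integrable.add
        ((integrable_finsetSum _ fun i _ => (hG i).integrable.const_mul _).const_mul 4))
        (((h.hasAllMoments N).pow _).integrable.const_mul 4) ?_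
      filter_upwards [h.ae_nonneg] with ω hω
      have h2 := partialSups_sq_add_le (Y ω) N
      rw [pow_mul]
      refine le_trans ?_ h2
      refine add_le_add_right (mul_le_mul_of_nonneg_left (Finset.sum_le_sum fun i _ => ?_)
        (by norm_num)) _
      have h3 := pow_sub_pow_ge (hω i).1 (hω (i + 1)).1 m
      have h4 : 0 ≤ S i ω :=
        (pow_nonneg (hω 0).1 (m + 1)).trans (le_partialSups_of_le (Y ω) i.zero_le)
      have h5 : √τ * b i ω * Z i ω ≤ U (i + 1) ω - U i ω := by
        rw [h.succ]
        have : 0 ≤ τ * (R * (1 + |Z i ω|) ^ a) := by positivity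
        linarith
      have h6 : ((m : ℝ) + 1) * U i ω ^ m * (√τ * b i ω * Z i ω) ≤ Y ω (i + 1) - Y ω i := by
        refine le_trans (mul_le_mul_of_nonneg_left h5 ?_) h3
        have := (hω i).1
        positivity
      calc _ = S i ω * (((m : ℝ) + 1) * U i ω ^ m * (√τ * b i ω * Z i ω)) := by ring
        _ ≤ _ := mul_le_mul_of_nonneg_left h6 h4
    rw [integral_add ((hSa N).pow 2).integrable
      ((integrable_finsetSum _ fun i _ => (hG i).integrable.const_mul _).const_mul 4),
      integral_const_mul, integral_finsetSum _ fun i _ => (hG i).integrable.const_mul _,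
      integral_const_mul] at h1
    have h2 : ∑ i ∈ Finset.range N,
        ∫ ω, ((m + 1) * √τ) * (S i ω * U i ω ^ m * b i ω * Z i ω) ∂P = 0 := by
      refine Finset.sum_eq_zero fun i _ => ?_
      rw [integral_const_mul, h.integral_mul_noise_eq_zero
        (f := fun ω => S i ω * U i ω ^ m * b i ω)
        (((hSm i).mul ((h.adapted i).pow_const m)).mul (h.coeff_adapted i)), mul_zero]
    rw [h2] at h1
    linarith
  have hXint : ∫ ω, X N ω ^ ((m + 1) * 2) ∂P ≤ 4 * K * (u₀ + τ * N) ^ ((m + 1) * 2) := by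
    have h1 : ∫ ω, X N ω ^ ((m + 1) * 2) ∂P ≤ ∫ ω, S N ω ^ 2 ∂P := by
      refine integral_mono_ae ((hXa N).pow _).integrable ((hSa N).pow _).integrable ?_
      filter_upwards [hX0] with ω hω
      rw [pow_mul]
      exact pow_le_pow_left₀ (by positivity) (hXS ω N) 2
    have h2 := H Ω P 𝓖 Z U b u₀ τ hτ hu₀ h N
    linarith
  have hqm : AEStronglyMeasurable (fun ω => X N ω ^ q) P :=
    ((hXa N).1.aemeasurable.pow_const q).aestronglyMeasurable
  have hqi : Integrable (fun ω => X N ω ^ q) P := by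
    refine ((integrable_const 1).add ((hXa N).pow ((m + 1) * 2)).integrable).mono' hqm ?_
    filter_upwards [hX0] with ω hω
    rw [Real.norm_of_nonneg (by positivity)]
    simp only [Pi.add_apply]
    rcases le_total (X N ω) 1 with h1 | h1
    · exact (Real.rpow_le_one hω h1 hq.le).trans (by linarith [pow_nonneg hω ((m + 1) * 2)])
    · have := Real.rpow_le_rpow_of_exponent_le h1 hmq
      rw [Real.rpow_natCast] at this
      linarith
  refine ⟨hqi, ?_⟩
  -- At N = 0 the scale T = u₀ + τN may vanish, so this case precedes the division by powers of T.
  rcases Nat.eq_zero_or_pos N with rfl | hN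
  · have e : (fun ω => X 0 ω ^ q) = fun _ => u₀ ^ q := funext fun ω => by
      simp [hX, h.zero]
    change ∫ ω, X 0 ω ^ q ∂P ≤ _
    rw [e]
    simp only [integral_const, probReal_univ, one_smul, Nat.cast_zero, mul_zero, add_zero]
    have : 0 ≤ u₀ ^ q := by positivity
    nlinarith
  · set T := u₀ + τ * N with hT
    have hT0 : 0 < T := by
      have : (0 : ℝ) < N := by exact_mod_cast hN
      positivity
    -- Below T the q-th power is at most T ^ q; above T it is at most T ^ q (X / T) ^ (2(m + 1)).
    have h1 : ∫ ω, X N ω ^ q ∂P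
        ≤ ∫ ω, (T ^ q + T ^ q / T ^ ((m + 1) * 2) * X N ω ^ ((m + 1) * 2)) ∂P := by
      refine integral_mono_ae hqi ((integrable_const _).add
        (((hXa N).pow ((m + 1) * 2)).integrable.const_mul _)) ?_
      filter_upwards [hX0] with ω hω
      have hTq : 0 < T ^ q := by positivity
      rcases le_total (X N ω) T with h1 | h1
      · have := Real.rpow_le_rpow hω h1 hq.le
        have h2 : 0 ≤ T ^ q / T ^ ((m + 1) * 2) * X N ω ^ ((m + 1) * 2) := by positivity
        linarith
      · have h2 := Real.rpow_le_rpow_of_exponent_le ((one_le_div hT0).2 h1) hmq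
        rw [Real.rpow_natCast, Real.div_rpow hω hT0.le, div_pow,
          div_le_div_iff₀ hTq (by positivity)]
          at h2
        have h3 : X N ω ^ q ≤ T ^ q / T ^ ((m + 1) * 2) * X N ω ^ ((m + 1) * 2) := by
          rw [div_mul_eq_mul_div, le_div_iff₀ (by positivity)]
          linarith
        linarith
    rw [integral_add (integrable_const _) (((hXa N).pow ((m + 1) * 2)).integrable.const_mul _),
      integral_const_mul] at h1
    simp only [integral_const, probReal_univ, one_smul] at h1
    have h2 : T ^ q / T ^ ((m + 1) * 2) * ∫ ω, X N ω ^ ((m + 1) * 2) ∂P ≤ 4 * K * T ^ q := by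
      calc _ ≤ T ^ q / T ^ ((m + 1) * 2) * (4 * K * T ^ ((m + 1) * 2)) := by gcongr
        _ = _ := by field_simp
    change ∫ ω, X N ω ^ q ∂P ≤ _
    linarith

/-! ### The scheme: uniform data bounds, adapted velocities and the majorant of the energy. -/

namespace GradientDiscretisation

/-- Fixes the dependence of the constants: O enters through its volume, σ and g through M, the
discretisation through Γ. The last bound combines Sobolev stability with the W^{1,r} bounds on the
source for r = p and r = p'. -/
lemma exists_dataBounds (n : ℕ) (p κ Γ M : ℝ) (V : ℝ≥0) (hp : 1 < p) (hΓ : 0 ≤ Γ) :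
    ∃ S K Cf Ce : ℝ, 0 ≤ S ∧ 0 ≤ K ∧ 0 ≤ Cf ∧ 0 ≤ Ce ∧
      ∀ O : Set (Vec n), IsOpen O → volume O = V → ∀ σ g : Vec n → Vec n,
        MemSobolevDivTop O 1 σ → sobolevNormTop O 1 σ ≤ ENNReal.ofReal M →
        MemSobolevDivTop O 2 g → sobolevNormTop O 2 g ≤ ENNReal.ofReal M →
      ∀ (X Y : Type*) [AddCommGroup X] [Module ℝ X] [AddCommGroup Y] [Module ℝ Y]
        (D : GradientDiscretisation n O p X Y), D.IsStable Γ →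
        D.DataBounds κ σ g Γ S K Cf Ce V := by
  have hc := Real.HolderConjugate.conjExponent hp
  obtain ⟨K₁, hK₁, H₁⟩ := exists_sobolevNormOne_transMul_weakGrad_le n M p V hc.pos
  obtain ⟨K₂, hK₂, H₂⟩ :=
    exists_sobolevNormOne_transMul_weakGrad_le n M p.conjExponent V hc.symm.pos
  refine ⟨n * max M 0, √κ + (n * n : ℕ) * max M 0, (n * max M 0) * ((n * n : ℕ) * max M 0),
    Γ * max K₁ K₂, by positivity, by positivity, by positivity, by positivity, ?_⟩
  intro O hO hV σ g hσ hσM hg hgM X Y _ _ _ _ D h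
  have hfin : IsFiniteMeasure (leb O) :=
    ⟨by rw [Measure.restrict_apply_univ, hV]; exact ENNReal.coe_lt_top⟩
  have hgrad := hg.1.aestronglyMeasurable_weakGrad one_le_two
  have hsm := aestronglyMeasurable_transMul_weakGrad hσ.1 hg.1
  have hsb := ae_norm_transMul_weakGrad_le hO hσ.1 hσM hgM
  refine ⟨h, hV, hσ.1.aestronglyMeasurable, hσ.1.ae_norm_le hO hσM,
    (measurable_symPart.comp_aemeasurable hgrad.aemeasurable).aestronglyMeasurable, ?_, hsm, hsb,
    fun r hr => ?_⟩
  · filter_upwards [ae_norm_weakGrad_le hgM one_le_two] with x hx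
    have := norm_symPart_le (weakGrad O g x)
    linarith
  · refine h.lrNorm_eps_l2Projection_le hr hΓ (hK₁.trans (le_max_left _ _)) (.of_bound hsm _ hsb)
      (memSobolev_transMul_weakGrad hO hσ hσM hg.1 hgM _) ?_
    rcases hr with rfl | rfl
    · exact (H₁ O hO hV σ g hσ hσM hg.1 hgM).trans (ENNReal.ofReal_le_ofReal (le_max_left _ _))
    · exact (H₂ O hO hV σ g hσ hσM hg.1 hgM).trans (ENNReal.ofReal_le_ofReal (le_max_right _ _))

variable {n : ℕ} {O : Set (Vec n)} {p Γ κ S K Cf Ce : ℝ} {V : ℝ≥0} {X Y : Type*}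
    [AddCommGroup X] [Module ℝ X] [AddCommGroup Y] [Module ℝ Y]
    {D : GradientDiscretisation n O p X Y} {σ g : Vec n → Vec n}

noncomputable instance (h : D.IsStable Γ) (hp : 1 < p) : MeasurableSpace (h.reconSpace hp) :=
  borel _

instance (h : D.IsStable Γ) (hp : 1 < p) : BorelSpace (h.reconSpace hp) := ⟨rfl⟩

variable [FiniteDimensional ℝ X]

instance (h : D.IsStable Γ) (hp : 1 < p) : SecondCountableTopology (h.reconSpace hp) :=
  have := FiniteDimensional.proper ℝ (h.reconSpace hp)
  secondCountable_of_proper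

/-- The reconstruction of the new velocity is a measurable function of the reconstruction of the
old one and of the increment of the noise. -/
lemma DataBounds.exists_measurable_step (H : D.DataBounds κ σ g Γ S K Cf Ce V) (hp : 1 < p)
    (hκ : 0 ≤ κ) (hΓ : 0 ≤ Γ) (hS : 0 ≤ S) (hK : 0 ≤ K) (hCf : 0 ≤ Cf) (hCe : 0 ≤ Ce) {τ : ℝ}
    (hτ : 0 < τ) :
    ∃ Ψ : H.stable.reconSpace hp × ℝ → H.stable.reconSpace hp, Measurable Ψ ∧
      ∀ (y : H.stable.reconSpace hp) (s : ℝ) (v v₁ : X),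
        (y : Lp (Vec n) 2 (leb O)) = D.recon v → D.IsDivFreeStep κ σ g H.source τ s v v₁ →
        (Ψ (y, s) : Lp (Vec n) 2 (leb O)) = D.recon v₁ := by
  obtain ⟨C₁, hC₁, H₁⟩ := exists_energy_le hp hκ hΓ hS hK hCf hCe V
  obtain ⟨C₂, hC₂, H₂⟩ := H.exists_norm_sub_le hp hκ hΓ hS
  set R : H.stable.reconSpace hp × ℝ → H.stable.reconSpace hp → Prop := fun z y₁ =>
    ∃ v v₁ : X, (z.1 : Lp (Vec n) 2 (leb O)) = D.recon v ∧
      (y₁ : Lp (Vec n) 2 (leb O)) = D.recon v₁ ∧ D.IsDivFreeStep κ σ g H.source τ z.2 v v₁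
  have hR : ∀ r : ℕ, ∃ K : ℝ≥0, ∀ z z' y y', ‖z‖ ≤ r → ‖z'‖ ≤ r → R z y → R z' y' →
      ‖y - y'‖ ≤ K * ‖z - z'‖ := by
    intro r
    -- The Lipschitz estimate involves the norm of the new velocity; the energy estimate bounds it
    -- on data of norm at most r, through x ≤ 1 + x².
    set Br : ℝ := 1 + r ^ 2 + 2 * (‖H.source‖ * r * r) + C₁ * τ * (1 + r / √τ) ^ noiseExponent p
      with hBr
    refine ⟨(3 + C₂ * (1 + r + Br)).toNNReal, ?_⟩
    rw [Real.coe_toNNReal _ (by positivity)]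
    rintro ⟨y, s⟩ ⟨y', s'⟩ y₁ y₁' hz hz' ⟨v, v₁, hv, hv₁, hs⟩ ⟨v', v₁', hv', hv₁', hs'⟩
    simp only [Prod.norm_def, sup_le_iff] at hz hz'
    have q1 : ‖D.recon v'‖ ≤ r := by
      rw [← hv']
      exact hz'.1
    have q2 : ‖D.recon v₁'‖ ≤ Br := by
      have h1 := H₁ n O X Y D σ g H τ s' v' v₁' hτ hs'
      -- Without `Fact (1 ≤ ENNReal.ofReal p)` in scope, nonnegativity of this norm is read off its
      -- definition.
      have h2 : 0 ≤ (2 ^ p)⁻¹ / 2 * (τ * ‖D.eps ((1 / 2 : ℝ) • (v₁' + v'))‖ ^ p) := by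
        have : 0 ≤ ‖D.eps ((1 / 2 : ℝ) • (v₁' + v'))‖ := by
          rw [Lp.norm_def]; exact ENNReal.toReal_nonneg
        positivity
      have hs'r : |s'| ≤ r := hz'.2
      have h3 : ((if τ ≤ 1 then inner ℝ H.source (D.recon v') else 0) * s' : ℝ)
          ≤ ‖H.source‖ * r * r := by
        refine (le_abs_self _).trans ?_
        rw [abs_mul]
        refine mul_le_mul ?_ hs'r (abs_nonneg _) (by positivity)
        split_ifs
        · exact (abs_real_inner_le_norm _ _).trans (by gcongr)
        · rw [abs_zero]
          positivity
      have h4 : C₁ * τ * (1 + |s'| / √τ) ^ noiseExponent p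
          ≤ C₁ * τ * (1 + r / √τ) ^ noiseExponent p := by gcongr
      have h5 : ‖D.recon v'‖ ^ 2 ≤ r ^ 2 := by gcongr
      have h6 : ‖D.recon v₁'‖ ≤ 1 + ‖D.recon v₁'‖ ^ 2 := by
        nlinarith [sq_nonneg (‖D.recon v₁'‖ - 1)]
      linarith
    have h1 := H₂ τ s s' v v₁ v' v₁' hτ hs hs'
    rw [← hv, ← hv₁, ← hv', ← hv₁'] at h1
    rw [← hv'] at q1
    rw [← hv₁'] at q2
    have m1 : ‖(y : Lp (Vec n) 2 (leb O)) - y'‖ ≤ ‖(y, s) - (y', s')‖ :=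
      norm_fst_le ((y, s) - (y', s'))
    have m2 : |s - s'| ≤ ‖(y, s) - (y', s')‖ := norm_snd_le ((y, s) - (y', s'))
    have e : ‖y₁ - y₁'‖ = ‖(y₁ : Lp (Vec n) 2 (leb O)) - y₁'‖ := rfl
    rw [e]
    calc _ ≤ 3 * ‖(y, s) - (y', s')‖ + C₂ * (1 + r + Br) * ‖(y, s) - (y', s')‖ := by
          refine h1.trans ?_
          gcongr
      _ = _ := by ring
  obtain ⟨Ψ, hΨ, hΨ'⟩ := exists_measurable_selector R hR
  refine ⟨Ψ, hΨ, fun y s v v₁ hy hs => ?_⟩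
  have hmem : D.recon v₁ ∈ H.stable.reconSpace hp := ⟨v₁, hs.divFree_right, rfl⟩
  exact congrArg Subtype.val (hΨ' (y, s) ⟨D.recon v₁, hmem⟩ ⟨v, v₁, hy, rfl, hs⟩)

/-- The initial velocity is determined by the `L²`-projection of the initial datum. -/
lemma IsHelmholtz.recon_eq (h : D.IsStable Γ) (hp : 1 < p) {vin : Lp (Vec n) 2 (leb O)} {v : X}
    {π : Y} (hv : D.IsHelmholtz vin v π) :
    ((h.reconSpace hp).starProjection vin : Lp (Vec n) 2 (leb O)) = D.recon v := by
  have hdiv : D.DivFree v := fun q hq => by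
    rw [← hv.divergence q hq]
    exact integral_congr_ae (.of_forall fun x => mul_comm _ _)
  have hmem : D.recon v ∈ h.reconSpace hp := ⟨v, hdiv, rfl⟩
  refine Submodule.eq_starProjection_of_mem_of_inner_eq_zero hmem ?_
  rintro _ ⟨ξ, hξ, rfl⟩
  have h1 := hv.momentum ξ
  rw [(show D.DivFree ξ from hξ) π hv.meanFree, add_zero] at h1
  rw [inner_sub_left, h1, sub_self]

end GradientDiscretisation

/-- The increments of a Wiener process, scaled to unit variance. -/
lemma IsWienerProcess.hasLaw_increment {Ω : Type*} [mΩ : MeasurableSpace Ω] {P : Measure Ω}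
    {𝓕 : Filtration ℝ≥0 mΩ} {W : ℝ≥0 → Ω → ℝ} (hW : IsWienerProcess P 𝓕 W) {τ : ℝ≥0} (hτ : 0 < τ)
    (k : ℕ) :
    HasLaw (fun ω => (W ((k + 1) * τ) ω - W (k * τ) ω) / √(τ : ℝ)) (gaussianReal 0 1) P := by
  have h1 := hW.isBrownian.toIsPreBrownianReal.hasLaw_sub ((k + 1) * τ) (k * τ)
  have h2 := gaussianReal_div_const h1 (√(τ : ℝ))
  have e : nndist (((k + 1) * τ : ℝ≥0) : ℝ) ((k * τ : ℝ≥0) : ℝ)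
      / (NNReal.mk (√(τ : ℝ) ^ 2) (sq_nonneg _)) = 1 := by
    have e1 : nndist (((k + 1) * τ : ℝ≥0) : ℝ) ((k * τ : ℝ≥0) : ℝ) = τ := by
      ext
      rw [coe_nndist, Real.dist_eq]
      push_cast
      rw [add_mul, one_mul, add_sub_cancel_left, NNReal.abs_eq]
    have e2 : NNReal.mk (√(τ : ℝ) ^ 2) (sq_nonneg _) = τ := by
      ext
      simp
    rw [e1, e2, div_self hτ.ne']
  rw [zero_div] at h2
  have h3 := e ▸ h2
  exact h3

/-- The filtration observed at the times `k τ`. -/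
def MeasureTheory.Filtration.sampled {Ω : Type*} {mΩ : MeasurableSpace Ω} (𝓕 : Filtration ℝ≥0 mΩ)
    (τ : ℝ≥0) : Filtration ℕ mΩ where
  seq k := 𝓕 (k * τ)
  mono' i j hij := 𝓕.mono (by gcongr)
  le' k := 𝓕.le _

/-- The increment of a process over the `k`-th time interval. -/
def timeIncrement {Ω : Type*} (W : ℝ≥0 → Ω → ℝ) (τ : ℝ≥0) (k : ℕ) (ω : Ω) : ℝ :=
  W ((k + 1) * τ) ω - W (k * τ) ω

namespace IsWienerProcess

variable {Ω : Type*} [mΩ : MeasurableSpace Ω] {P : Measure Ω} {𝓕 : Filtration ℝ≥0 mΩ}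
    {W : ℝ≥0 → Ω → ℝ} {τ : ℝ≥0}

lemma measurable_timeIncrement (hW : IsWienerProcess P 𝓕 W) (k : ℕ) :
    Measurable[𝓕.sampled τ (k + 1)] (timeIncrement W τ k) := by
  have h1 : Measurable[𝓕.sampled τ (k + 1)] (W ((k + 1) * τ)) := by
    have := hW.adapted ((k + 1 : ℕ) * τ)
    rw [Nat.cast_succ] at this
    change Measurable[𝓕 ((k + 1 : ℕ) * τ)] _
    rw [Nat.cast_succ]
    exact this
  have h2 : Measurable[𝓕.sampled τ (k + 1)] (W (k * τ)) :=
    Measurable.mono (hW.adapted (k * τ)) ((𝓕.sampled τ).mono k.le_succ) le_rfl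
  exact h1.sub h2

lemma indep_timeIncrement_div (hW : IsWienerProcess P 𝓕 W) (k : ℕ) (c : ℝ) :
    Indep (MeasurableSpace.comap (fun ω => timeIncrement W τ k ω / c) inferInstance)
      (𝓕.sampled τ k) P := by
  refine indep_of_indep_of_le_left (hW.indep (k * τ) ((k + 1) * τ) (by gcongr; simp)) ?_
  have : (fun ω => timeIncrement W τ k ω / c)
      = (fun x : ℝ => x / c) ∘ fun ω => W ((k + 1) * τ) ω - W (k * τ) ω := rfl
  rw [this, ← MeasurableSpace.comap_comp]
  exact MeasurableSpace.comap_mono (measurable_id.div_const c).comap_le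

end IsWienerProcess

namespace GradientDiscretisation

variable {n : ℕ} {O : Set (Vec n)} {p Γ κ S K Cf Ce : ℝ} {V : ℝ≥0} {X Y : Type*}
    [AddCommGroup X] [Module ℝ X] [AddCommGroup Y] [Module ℝ Y]
    {D : GradientDiscretisation n O p X Y} {σ g : Vec n → Vec n} [FiniteDimensional ℝ X]
    {Ω : Type*} [mΩ : MeasurableSpace Ω] {P : Measure Ω} {𝓕 : Filtration ℝ≥0 mΩ}
    {W : ℝ≥0 → Ω → ℝ} {τ : ℝ≥0}

/-- The reconstructed velocities agree almost surely with an adapted process. -/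
lemma DataBounds.exists_adapted (H : D.DataBounds κ σ g Γ S K Cf Ce V) (hp : 1 < p)
    (hκ : 0 ≤ κ) (hΓ : 0 ≤ Γ) (hS : 0 ≤ S) (hK : 0 ≤ K) (hCf : 0 ≤ Cf) (hCe : 0 ≤ Ce)
    (hW : IsWienerProcess P 𝓕 W) (hτ : 0 < τ) {vin : Lp (Vec n) 2 (leb O)} {v : ℕ → Ω → X}
    {π : ℕ → Ω → Y} (h : IsCrankNicolson D κ σ g P W τ vin v π) :
    ∃ y : ℕ → Ω → H.stable.reconSpace hp, (∀ k, Measurable[𝓕.sampled τ k] (y k)) ∧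
      (∀ ω, ‖y 0 ω‖ ≤ ‖vin‖) ∧
      ∀ᵐ ω ∂P, ∀ k, (y k ω : Lp (Vec n) 2 (leb O)) = D.recon (v k ω) ∧
        D.IsDivFreeStep κ σ g H.source τ (timeIncrement W τ k ω) (v k ω) (v (k + 1) ω) := by
  have hfin := H.isFiniteMeasure
  obtain ⟨Ψ, hΨ, hΨ'⟩ := H.exists_measurable_step hp hκ hΓ hS hK hCf hCe (τ := τ) hτ
  -- The given velocities carry no measurability. Iterating Ψ from the deterministic projection of
  -- the initial datum defines, for every ω, an adapted process that coincides with Πv wherever the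
  -- scheme holds.
  set y : ℕ → Ω → H.stable.reconSpace hp := fun k => Nat.rec
    (fun _ => ⟨(H.stable.reconSpace hp).starProjection vin, Submodule.starProjection_apply_mem _ _⟩)
    (fun k yk ω => Ψ (yk ω, timeIncrement W τ k ω)) k with hy
  have hy1 (k : ℕ) (ω : Ω) : y (k + 1) ω = Ψ (y k ω, timeIncrement W τ k ω) := rfl
  refine ⟨y, fun k => ?_, fun ω => ?_, ?_⟩
  · induction k with
    | zero => exact measurable_const
    | succ k ih =>
      exact hΨ.comp ((ih.mono ((𝓕.sampled τ).mono k.le_succ) le_rfl).prodMk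
        (hW.measurable_timeIncrement k))
  · exact Submodule.norm_starProjection_apply_le (H.stable.reconSpace hp) vin
  · filter_upwards [h] with ω hω
    have key (k : ℕ) : D.DivFree (v k ω) ∧ D.MeanFree (π k ω) ∧
        (y k ω : Lp (Vec n) 2 (leb O)) = D.recon (v k ω) := by
      induction k with
      | zero =>
        refine ⟨fun q hq => ?_, hω.1.meanFree, IsHelmholtz.recon_eq H.stable hp hω.1⟩
        rw [← hω.1.divergence q hq]
        exact integral_congr_ae (.of_forall fun x => mul_comm _ _)
      | succ k ih =>
        have hs := (hω.2 k).isDivFreeStep H.stable hp (H.memLp_source 2) ih.1 ih.2.1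
        exact ⟨hs.divFree_right, (hω.2 k).meanFree, hΨ' _ _ _ _ ih.2.2 hs⟩
    exact fun k => ⟨(key k).2.2,
      (hω.2 k).isDivFreeStep H.stable hp (H.memLp_source 2) (key k).1 (key k).2.1⟩

/-- The kinetic energy and the dissipated energy are dominated by an energy majorant. -/
lemma exists_energyMajorant (hp : 1 < p) (hκ : 0 ≤ κ) (hΓ : 0 ≤ Γ) (hS : 0 ≤ S) (hK : 0 ≤ K)
    (hCf : 0 ≤ Cf) (hCe : 0 ≤ Ce) (V : ℝ≥0) :
    ∃ B R : ℝ, 0 ≤ B ∧ 0 ≤ R ∧ ∀ (n : ℕ) (O : Set (Vec n)) (X Y : Type*) [AddCommGroup X]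
      [Module ℝ X] [AddCommGroup Y] [Module ℝ Y] [FiniteDimensional ℝ X]
      (D : GradientDiscretisation n O p X Y) (σ g : Vec n → Vec n)
      (H : D.DataBounds κ σ g Γ S K Cf Ce V) (Ω : Type*) [mΩ : MeasurableSpace Ω] (P : Measure Ω)
      (𝓕 : Filtration ℝ≥0 mΩ) (W : ℝ≥0 → Ω → ℝ) (τ : ℝ≥0) (y : ℕ → Ω → H.stable.reconSpace hp)
      (v : ℕ → Ω → X) (u₀ : ℝ), IsWienerProcess P 𝓕 W → 0 < τ →
      (∀ k, Measurable[𝓕.sampled τ k] (y k)) → (∀ ω, ‖y 0 ω‖ ^ 2 ≤ u₀) →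
      (∀ᵐ ω ∂P, ∀ k, (y k ω : Lp (Vec n) 2 (leb O)) = D.recon (v k ω) ∧
        D.IsDivFreeStep κ σ g H.source τ (timeIncrement W τ k ω) (v k ω) (v (k + 1) ω)) →
      ∃ Z U b : ℕ → Ω → ℝ,
        IsEnergyMajorant P (𝓕.sampled τ) Z U b u₀ τ B R (noiseExponent p) ∧
        ∀ᵐ ω ∂P, ∀ k, ‖D.recon (v k ω)‖ ^ 2 + (2 ^ p)⁻¹ / 2 * (∑ j ∈ Finset.range k,
          τ * ‖D.eps ((1 / 2 : ℝ) • (v (j + 1) ω + v j ω))‖ ^ p) ≤ U k ω := by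
  obtain ⟨R, hR, hE⟩ := exists_energy_le hp hκ hΓ hS hK hCf hCe V
  -- With b = 2(F, Πv) or b = 0, one has b² ≤ 4‖F‖²‖Πv‖² ≤ 4‖F‖²U, and ‖F‖ ≤ V ^ (1/2) Cf.
  refine ⟨4 * ((V : ℝ) ^ (2 : ℝ)⁻¹ * Cf) ^ 2, R, by positivity, hR.le, ?_⟩
  intro n O X Y _ _ _ _ _ D σ g H Ω _ P 𝓕 W τ y v u₀ hW hτ hy hy0 hv
  have hτ' : 0 < (τ : ℝ) := hτ
  have hsτ : 0 < √(τ : ℝ) := Real.sqrt_pos.2 hτ'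
  set Z : ℕ → Ω → ℝ := fun k ω => timeIncrement W τ k ω / √(τ : ℝ) with hZ
  set b : ℕ → Ω → ℝ := fun k ω =>
    2 * (if (τ : ℝ) ≤ 1 then inner ℝ H.source (y k ω : Lp (Vec n) 2 (leb O)) else 0) with hb
  -- The energy inequality is iterated with equality, so that U has an exact martingale-plus-drift
  -- form and dominates the energy by induction.
  set U : ℕ → Ω → ℝ := fun k ω => Nat.rec u₀ (fun k u =>
    u + √(τ : ℝ) * b k ω * Z k ω + τ * (R * (1 + |Z k ω|) ^ noiseExponent p)) k with hU
  have hU1 (k : ℕ) (ω : Ω) : U (k + 1) ω = U k ω + √(τ : ℝ) * b k ω * Z k ω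
      + τ * (R * (1 + |Z k ω|) ^ noiseExponent p) := rfl
  have hdom : ∀ᵐ ω ∂P, ∀ k, ‖D.recon (v k ω)‖ ^ 2 + (2 ^ p)⁻¹ / 2 * (∑ j ∈ Finset.range k,
      τ * ‖D.eps ((1 / 2 : ℝ) • (v (j + 1) ω + v j ω))‖ ^ p) ≤ U k ω := by
    filter_upwards [hv] with ω hω k
    induction k with
    | zero =>
      rw [← (hω 0).1]
      rw [Finset.range_zero, Finset.sum_empty, mul_zero, add_zero]
      exact hy0 ω
    | succ k ih =>
      have h1 := hE n O X Y D σ g H τ _ _ _ hτ' (hω k).2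
      rw [Finset.sum_range_succ, hU1]
      have e1 : √(τ : ℝ) * Z k ω = timeIncrement W τ k ω := by
        simp only [hZ]
        field_simp
      have e2 : |Z k ω| = |timeIncrement W τ k ω| / √(τ : ℝ) := by
        simp only [hZ]
        rw [abs_div, abs_of_pos hsτ]
      have e3 : √(τ : ℝ) * b k ω * Z k ω = 2 * ((if (τ : ℝ) ≤ 1 then
          inner ℝ H.source (D.recon (v k ω)) else 0) * timeIncrement W τ k ω) := by
        rw [← e1]
        simp only [hb, (hω k).1]
        ring
      rw [e3, e2]
      linarith
  have hsum (ω : Ω) (k : ℕ) : 0 ≤ (2 ^ p : ℝ)⁻¹ / 2 * (∑ j ∈ Finset.range k,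
      τ * ‖D.eps ((1 / 2 : ℝ) • (v (j + 1) ω + v j ω))‖ ^ p) := by
    refine mul_nonneg (by positivity) (Finset.sum_nonneg fun j _ => ?_)
    have : 0 ≤ ‖D.eps ((1 / 2 : ℝ) • (v (j + 1) ω + v j ω))‖ := by
      rw [Lp.norm_def]; exact ENNReal.toReal_nonneg
    positivity
  refine ⟨Z, U, b, ⟨fun k => (hW.measurable_timeIncrement k).div_const _,
    fun k => hW.hasLaw_increment hτ k, fun k => hW.indep_timeIncrement_div k _, fun k => ?_,
    fun ω => rfl, hU1, ?_⟩, hdom⟩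
  · refine Measurable.const_mul ?_ 2
    split_ifs
    · have : Measurable fun z : H.stable.reconSpace hp =>
          inner ℝ H.source (z : Lp (Vec n) 2 (leb O)) := by
        have : Continuous fun z : H.stable.reconSpace hp =>
          inner ℝ H.source (z : Lp (Vec n) 2 (leb O)) := by fun_prop
        exact this.measurable
      exact this.comp (hy k)
    · exact measurable_const
  · filter_upwards [hdom, hv] with ω hω hv k
    have h1 := hω k
    have h2 := hsum ω k
    refine ⟨by linarith [sq_nonneg ‖D.recon (v k ω)‖], ?_⟩
    have h3 : |b k ω| ≤ 2 * ((V : ℝ) ^ (2 : ℝ)⁻¹ * Cf * ‖D.recon (v k ω)‖) := by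
      simp only [hb]
      rw [abs_mul, abs_two, (hv k).1]
      gcongr
      split_ifs
      · exact (abs_real_inner_le_norm _ _).trans (by gcongr; exact H.norm_source_le hCf)
      · rw [abs_zero]
        positivity
    calc b k ω ^ 2 = |b k ω| ^ 2 := (sq_abs _).symm
      _ ≤ (2 * ((V : ℝ) ^ (2 : ℝ)⁻¹ * Cf * ‖D.recon (v k ω)‖)) ^ 2 := by gcongr
      _ = 4 * ((V : ℝ) ^ (2 : ℝ)⁻¹ * Cf) ^ 2 * ‖D.recon (v k ω)‖ ^ 2 := by ring
      _ ≤ _ := by gcongr; linarith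

/-- Measurability of the norms that enter the energy estimate. -/
lemma DataBounds.aestronglyMeasurable_energy (H : D.DataBounds κ σ g Γ S K Cf Ce V) (hp : 1 < p)
    {y : ℕ → Ω → H.stable.reconSpace hp} (hy : ∀ k, Measurable (y k)) {v : ℕ → Ω → X}
    {dW : ℕ → Ω → ℝ}
    (hv : ∀ᵐ ω ∂P, ∀ k, (y k ω : Lp (Vec n) 2 (leb O)) = D.recon (v k ω) ∧
        D.IsDivFreeStep κ σ g H.source τ (dW k ω) (v k ω) (v (k + 1) ω)) (q : ℝ) (N : ℕ) :
    AEStronglyMeasurable (fun ω =>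
      (Finset.range (N + 1)).sup' Finset.nonempty_range_add_one
          (fun k => ‖D.recon (v k ω)‖ ^ (2 * q))
        + (∑ k ∈ Finset.range N,
            τ * ‖D.eps ((1 / 2 : ℝ) • (v (k + 1) ω + v k ω))‖ ^ p) ^ q) P := by
  have h1p : Fact (1 ≤ ENNReal.ofReal p) := ⟨by rw [ENNReal.one_le_ofReal]; exact hp.le⟩
  -- Inverting Π on its finite-dimensional image turns ε into a continuous function of the adapted
  -- process.
  set T := LinearMap.toContinuousLinearMap (D.eps ∘ₗ H.stable.lift hp)
  have hT (k : ℕ) : Measurable fun ω => ‖T ((1 / 2 : ℝ) • (y (k + 1) ω + y k ω))‖ := by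
    have : Continuous fun z : H.stable.reconSpace hp => ‖T ((1 / 2 : ℝ) • z)‖ := by fun_prop
    exact this.measurable.comp ((hy (k + 1)).add (hy k))
  have h1 : Measurable fun ω =>
      (Finset.range (N + 1)).sup' Finset.nonempty_range_add_one (fun k => ‖y k ω‖ ^ (2 * q))
        + (∑ k ∈ Finset.range N,
            τ * ‖T ((1 / 2 : ℝ) • (y (k + 1) ω + y k ω))‖ ^ p) ^ q := by
    refine .add ?_
      ((Finset.measurable_sum _ fun k _ => ((hT k).pow_const p).const_mul _).pow_const q)
    have := Finset.measurable_sup' (Finset.nonempty_range_add_one (n := N))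
      (f := fun k ω => ‖y k ω‖ ^ (2 * q)) fun k _ => (hy k).norm.pow_const _
    convert this using 2 with ω
    rw [Finset.sup'_apply]
  refine h1.aestronglyMeasurable.congr ?_
  filter_upwards [hv] with ω hω
  have e1 (k : ℕ) : ‖y k ω‖ = ‖D.recon (v k ω)‖ := by rw [← (hω k).1]; rfl
  have e2 (k : ℕ) : T ((1 / 2 : ℝ) • (y (k + 1) ω + y k ω))
      = D.eps ((1 / 2 : ℝ) • (v (k + 1) ω + v k ω)) := by
    rw [LinearMap.coe_toContinuousLinearMap', LinearMap.comp_apply, map_smul, map_add,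
      H.stable.lift_eq hp (hω k).2.divFree_left (hω k).1,
      H.stable.lift_eq hp (hω (k + 1)).2.divFree_left (hω (k + 1)).1]
  simp only [e1, e2]

end GradientDiscretisation

/-! ### Conclusion: both terms are controlled by the running maximum of the majorant. -/

theorem theorem3p7 (n : ℕ) (p κ q Γ M : ℝ) (V : ℝ≥0)
    (hp : 1 < p) (hκ : 0 ≤ κ) (hq : 0 < q) (hΓ : 1 ≤ Γ) :
    ∃ C : ℝ, 0 < C ∧
      ∀ O : Set (Vec n), IsOpen O → Bornology.IsBounded O → volume O = V →
      ∀ σ g : Vec n → Vec n,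
        MemSobolevDivTop O 1 σ → sobolevNormTop O 1 σ ≤ ENNReal.ofReal M →
        MemSobolevDivTop O 2 g → sobolevNormTop O 2 g ≤ ENNReal.ofReal M →
      ∀ (X Y : Type*) [AddCommGroup X] [Module ℝ X] [FiniteDimensional ℝ X]
        [AddCommGroup Y] [Module ℝ Y] [FiniteDimensional ℝ Y]
        (D : GradientDiscretisation n O p X Y), D.IsStable Γ →
      ∀ (Ω : Type*) [mΩ : MeasurableSpace Ω] (P : Measure Ω) [IsProbabilityMeasure P]
        (𝓕 : Filtration ℝ≥0 mΩ) (W : ℝ≥0 → Ω → ℝ), IsWienerProcess P 𝓕 W →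
      ∀ (τ : ℝ≥0), 0 < τ →
      ∀ (vin : Lp (Vec n) 2 (leb O)) (v : ℕ → Ω → X) (π : ℕ → Ω → Y),
        IsCrankNicolson D κ σ g P W τ vin v π →
      ∀ N : ℕ,
        Integrable (fun ω =>
          (Finset.range (N + 1)).sup' Finset.nonempty_range_add_one
              (fun k => ‖D.recon (v k ω)‖ ^ (2 * q))
            + (∑ k ∈ Finset.range N,
                τ * ‖D.eps ((1 / 2 : ℝ) • (v (k + 1) ω + v k ω))‖ ^ p) ^ q) P ∧
        ∫ ω, ((Finset.range (N + 1)).sup' Finset.nonempty_range_add_one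
              (fun k => ‖D.recon (v k ω)‖ ^ (2 * q))
            + (∑ k ∈ Finset.range N,
                τ * ‖D.eps ((1 / 2 : ℝ) • (v (k + 1) ω + v k ω))‖ ^ p) ^ q) ∂P
          ≤ C * (‖vin‖ ^ (2 * q) + (τ * N) ^ q) := by
  have hΓ0 : 0 ≤ Γ := zero_le_one.trans hΓ
  obtain ⟨S, K, Cf, Ce, hS, hK, hCf, hCe, hdata⟩ :=
    GradientDiscretisation.exists_dataBounds n p κ Γ M V hp hΓ0
  obtain ⟨B, R, hB, hR, hmaj⟩ :=
    GradientDiscretisation.exists_energyMajorant (p := p) hp hκ hΓ0 hS hK hCf hCe V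
  obtain ⟨C, hC, hmom⟩ := exists_integral_partialSups_rpow_le hB hR hq (noiseExponent p)
  set c : ℝ := (2 ^ p)⁻¹ / 2 with hc
  have hc0 : 0 < c := by positivity
  -- The kinetic term contributes 1 and the dissipation c⁻¹ to the power q; the factor 2 ^ q
  -- separates ‖vin‖² from τN in the moment bound.
  refine ⟨(1 + (c⁻¹) ^ q) * C * 2 ^ q, by positivity, ?_⟩
  intro O hO _ hV σ g hσ hσM hg hgM X Y _ _ _ _ _ _ D hD Ω _ P _ 𝓕 W hW τ hτ vin v π hv N
  have H := hdata O hO hV σ g hσ hσM hg hgM X Y D hD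
  obtain ⟨y, hy, hy0, hvy⟩ := H.exists_adapted hp hκ hΓ0 hS hK hCf hCe hW hτ hv
  obtain ⟨Z, U, b, hU, hdom⟩ := hmaj n O X Y D σ g H Ω P 𝓕 W τ y v (‖vin‖ ^ 2) hW hτ hy
    (fun ω => by gcongr; exact hy0 ω) hvy
  obtain ⟨hint, hle⟩ := hmom Ω P (𝓕.sampled τ) Z U b (‖vin‖ ^ 2) τ hτ (sq_nonneg _) hU N
  have hmeas := H.aestronglyMeasurable_energy hp (τ := τ)
    (fun k => (hy k).mono ((𝓕.sampled τ).le k) le_rfl) hvy q N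
  have heps (ω : Ω) (k : ℕ) : 0 ≤ τ * ‖D.eps ((1 / 2 : ℝ) • (v (k + 1) ω + v k ω))‖ ^ p := by
    have : 0 ≤ ‖D.eps ((1 / 2 : ℝ) • (v (k + 1) ω + v k ω))‖ := by
      rw [Lp.norm_def]; exact ENNReal.toReal_nonneg
    positivity
  have hnonneg (ω : Ω) : 0 ≤ (Finset.range (N + 1)).sup' Finset.nonempty_range_add_one
      (fun k => ‖D.recon (v k ω)‖ ^ (2 * q)) + (∑ k ∈ Finset.range N,
        τ * ‖D.eps ((1 / 2 : ℝ) • (v (k + 1) ω + v k ω))‖ ^ p) ^ q := by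
    refine add_nonneg ?_ (Real.rpow_nonneg (Finset.sum_nonneg fun k _ => heps ω k) _)
    refine (Real.rpow_nonneg (norm_nonneg (D.recon (v 0 ω))) (2 * q)).trans ?_
    exact Finset.le_sup' (fun k => ‖D.recon (v k ω)‖ ^ (2 * q))
      (Finset.mem_range.2 N.succ_pos)
  have hbound : ∀ᵐ ω ∂P, (Finset.range (N + 1)).sup' Finset.nonempty_range_add_one
      (fun k => ‖D.recon (v k ω)‖ ^ (2 * q)) + (∑ k ∈ Finset.range N,
        τ * ‖D.eps ((1 / 2 : ℝ) • (v (k + 1) ω + v k ω))‖ ^ p) ^ q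
      ≤ (1 + (c⁻¹) ^ q) * (partialSups (fun j => U j ω) N) ^ q := by
    filter_upwards [hdom] with ω hω
    have hsum (k : ℕ) : 0 ≤ ∑ j ∈ Finset.range k,
        τ * ‖D.eps ((1 / 2 : ℝ) • (v (j + 1) ω + v j ω))‖ ^ p :=
      Finset.sum_nonneg fun j _ => heps ω j
    have hsup (k : ℕ) (hk : k ≤ N) : U k ω ≤ partialSups (fun j => U j ω) N :=
      le_partialSups_of_le (fun j => U j ω) hk
    rw [add_mul, one_mul]
    refine add_le_add (Finset.sup'_le _ _ fun k hk => ?_) ?_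
    · rw [Real.rpow_mul (norm_nonneg _), Real.rpow_two]
      refine Real.rpow_le_rpow (sq_nonneg _) ?_ hq.le
      refine le_trans ?_ (hsup k (Nat.lt_succ_iff.1 (Finset.mem_range.1 hk)))
      have := mul_nonneg hc0.le (hsum k)
      linarith [hω k]
    · have h1 : c * (∑ j ∈ Finset.range N,
          τ * ‖D.eps ((1 / 2 : ℝ) • (v (j + 1) ω + v j ω))‖ ^ p)
          ≤ partialSups (fun j => U j ω) N := by
        linarith [hω N, hsup N le_rfl, sq_nonneg ‖D.recon (v N ω)‖]
      have h2 := (mul_nonneg hc0.le (hsum N)).trans h1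
      rw [← Real.mul_rpow (by positivity) h2]
      refine Real.rpow_le_rpow (hsum N) ?_ hq.le
      rw [inv_mul_eq_div, le_div_iff₀ hc0, mul_comm]
      exact h1
  have hint' := hint.const_mul (1 + (c⁻¹) ^ q)
  have hI : Integrable (fun ω => (Finset.range (N + 1)).sup' Finset.nonempty_range_add_one
      (fun k => ‖D.recon (v k ω)‖ ^ (2 * q)) + (∑ k ∈ Finset.range N,
        τ * ‖D.eps ((1 / 2 : ℝ) • (v (k + 1) ω + v k ω))‖ ^ p) ^ q) P := by
    refine hint'.mono' hmeas ?_
    filter_upwards [hbound] with ω hω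
    rw [Real.norm_of_nonneg (hnonneg ω)]
    exact hω
  refine ⟨hI, (integral_mono_ae hI hint' hbound).trans ?_⟩
  rw [integral_const_mul]
  have h1 := add_rpow_le_two_rpow_mul (sq_nonneg ‖vin‖) (by positivity : 0 ≤ (τ : ℝ) * N) hq.le
  rw [← Real.rpow_two, ← Real.rpow_mul (norm_nonneg _), Real.rpow_two] at h1
  calc _ ≤ (1 + (c⁻¹) ^ q) * (C * (2 ^ q * (‖vin‖ ^ (2 * q) + (τ * N) ^ q))) := by
        gcongr
        refine hle.trans ?_
        gcongr
    _ = _ := by ring
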